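/- **Setting.** Let $(\mathcal M,g)$ be a closed (compact, without boundary) connected smooth Riemannian 3-manifold with Levi-Civita connection $D$ and Laplacian $\Delta=D^aD_a$. Assume that the scalar curvature is a positive constant $R$. For a vector field $w$ put $$(\mathcal L w)_{ab}=D_aw_b+D_bw_a-\tfrac23 (D_cw^c)g_{ab},\qquad (\mathbb L w)^a=-D_b(\mathcal L w)^{ab},$$ and assume that there are no conformal Killing fields: a $C^2$ vector field $w$ with $\mathcal L w=0$ is zero. Let $\sigma$ be a symmetric 2-tensor field of class $C^1$ with $g^{ab}\sigma_{ab}=0$, $D^b\sigma_{ab}=0$, and with $|\sigma|=\sqrt{\sigma_{ab}\sigma^{ab}}$ equal to a positive constant. Let $0<\alpha<1$ and $\tau\in C^{1,\alpha}(\mathcal M)$. For $\rho\in\mathbb R$ consider $$F((\phi,w),\lambda)=\begin{bmatrix}-\Delta\phi+\tfrac R8\phi+\lambda^2\tfrac{\tau^2}{12}\phi^5-\tfrac18|\sigma+\mathcal L w|^2\phi^{-7}-2\pi\rho e^{-\lambda}\phi^5\\[2pt] \mathbb L w+\tfrac23\lambda\,(D^a\tau)\,\phi^6\end{bmatrix},$$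 and let $$\rho_c=\frac{R^{3/2}}{24\sqrt3\,\pi|\sigma|},\qquad \phi_c=\Big(\frac{R}{24\pi\rho_c}\Big)^{1/4}.$$ **Theorem.** Let $\rho=\rho_c$. 1. For all $\lambda\in\mathbb R$, $F(\cdot,\lambda)$ maps the pairs $(\phi,w)\in C^{2,\alpha}(\mathcal M)\oplus C^{2,\alpha}(\mathcal{TM})$ with $\phi$ nowhere zero into $C^{0,\alpha}(\mathcal M)\oplus C^{0,\alpha}(\mathcal{TM})$. 2. The map $X=(\phi,w)\mapsto F(X,0)$ between these spaces is Fréchet differentiable at $X=(\phi_c,0)$, with derivative $$D_XF((\phi_c,0),0)=\begin{bmatrix}-\Delta&\tilde{\mathbb L}\\0&\mathbb L\end{bmatrix},\qquad \tilde{\mathbb L}h=-\tfrac14\phi_c^{-7}\sigma_{ab}(\mathcal L h)^{ab}.$$ 3. The kernel of $D_XF((\phi_c,0),0)$ is one-dimensional and spanned by the constant pair $(1,0)$. 4. There is exactly one bounded linear operator $B:C^{2,\alpha}(\mathcal M)\oplus C^{2,\alpha}(\mathcal{TM})\to C^{0,\alpha}(\mathcal M)\oplus C^{0,\alpha}(\mathcal{TM})$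 that is adjoint to $A=D_XF((\phi_c,0),0)$ in the $L^2$ inner product, that is, $$\langle Ay,z\rangle_{L^2}=\langle y,Bz\rangle_{L^2}\quad\text{for all }y,z\in C^{2,\alpha}(\mathcal M)\oplus C^{2,\alpha}(\mathcal{TM}),$$ where $\langle(u,v),(u',v')\rangle_{L^2}=\int_{\mathcal M}(uu'+g(v,v'))\,dV_g$. It is $$B=\begin{bmatrix}-\Delta&0\\\hat{\mathbb L}&\mathbb L\end{bmatrix},\qquad(\hat{\mathbb L}u)^a=D_b\big(\tfrac12\phi_c^{-7}u\,\sigma^{ab}\big).$$ Its kernel is one-dimensional and spanned by $(1,0)$. -/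

import Mathlib

open Bundle Set Filter Metric MeasureTheory FiberBundle NormedSpace
open scoped Manifold ContDiff Topology ENNReal

noncomputable section

namespace CTT

section connection

/- A finite-dimensional manifold `M` with a Riemannian metric on its tangent bundle. -/
variable {E : Type*} [NormedAddCommGroup E] [NormedSpace ℝ E] [FiniteDimensional ℝ E]
  {H : Type*} [TopologicalSpace H] {I : ModelWithCorners ℝ E H}
  {M : Type*} [TopologicalSpace M] [ChartedSpace H M]
  [RiemannianBundle (fun x : M ↦ TangentSpace I x)]

instance (x : M) : FiniteDimensional ℝ (TangentSpace I x) :=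
  inferInstanceAs (FiniteDimensional ℝ E)

instance (x : M) : CompleteSpace (TangentSpace I x) := FiniteDimensional.complete ℝ _

/-- The right-hand side of the Koszul formula,
`X⟨Y,Z⟩ + Y⟨X,Z⟩ - Z⟨X,Y⟩ + ⟨[X,Y],Z⟩ - ⟨[X,Z],Y⟩ - ⟨[Y,Z],X⟩`. -/
def koszul (X Y Z : Π x : M, TangentSpace I x) (x : M) : ℝ :=
  d% (fun q ↦ inner ℝ (Y q) (Z q)) x (X x)
    + d% (fun q ↦ inner ℝ (X q) (Z q)) x (Y x)
    - d% (fun q ↦ inner ℝ (X q) (Y q)) x (Z x)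
    + inner ℝ (VectorField.mlieBracket I X Y x) (Z x)
    - inner ℝ (VectorField.mlieBracket I X Z x) (Y x)
    - inner ℝ (VectorField.mlieBracket I Y Z x) (X x)

variable [IsManifold I ∞ M] [IsContMDiffRiemannianBundle I ∞ E (fun x : M ↦ TangentSpace I x)]

theorem mdiff_inner {X Y : Π x : M, TangentSpace I x} {x : M} (hX : MDiffAt (T% X) x)
    (hY : MDiffAt (T% Y) x) : MDiffAt (fun q ↦ inner ℝ (X q) (Y q)) x :=
  MDifferentiableAt.inner_bundle (E := fun x : M ↦ TangentSpace I x) (F := E) hX hY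

theorem koszul_tensorial_left (Y Z : Π x : M, TangentSpace I x) (x : M) (hY : MDiffAt (T% Y) x)
    (hZ : MDiffAt (T% Z) x) : TensorialAt I E (fun X : (Π x : M, TangentSpace I x) ↦ koszul X Y Z x) x where
  smul {f X} hf hX := by
    have : CompleteSpace E := FiniteDimensional.complete ℝ _
    have h1 := mvfderiv_fun_mul hf (mdiff_inner hX hZ)
    have h2 := mvfderiv_fun_mul hf (mdiff_inner hX hY)
    simp only [koszul, Pi.smul_apply', real_inner_smul_left, h1, h2,
      VectorField.mlieBracket_smul_left hf hX, inner_add_left, real_inner_smul_right, map_smul]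
    simp [real_inner_comm]
    ring
  add {X X'} hX hX' := by
    have : CompleteSpace E := FiniteDimensional.complete ℝ _
    have h1 := mvfderiv_fun_add (mdiff_inner hX hZ) (mdiff_inner hX' hZ)
    have h2 := mvfderiv_fun_add (mdiff_inner hX hY) (mdiff_inner hX' hY)
    simp only [koszul, Pi.add_apply, h1, h2, inner_add_left, inner_add_right, map_add,
      VectorField.mlieBracket_add_left hX hX']
    simp
    ring

theorem koszul_tensorial_right (X Y : Π x : M, TangentSpace I x) (x : M) (hX : MDiffAt (T% X) x)
    (hY : MDiffAt (T% Y) x) : TensorialAt I E (fun Z : (Π x : M, TangentSpace I x) ↦ koszul X Y Z x) x where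
  smul {f Z} hf hZ := by
    have : CompleteSpace E := FiniteDimensional.complete ℝ _
    have h1 := mvfderiv_fun_mul hf (mdiff_inner hY hZ)
    have h2 := mvfderiv_fun_mul hf (mdiff_inner hX hZ)
    simp only [koszul, Pi.smul_apply', real_inner_smul_right, h1, h2,
      VectorField.mlieBracket_smul_right hf hZ, inner_add_left, real_inner_smul_left, map_smul]
    rw [real_inner_comm (Y x) (Z x), real_inner_comm (X x) (Z x)]
    simp
    ring
  add {Z Z'} hZ hZ' := by
    have : CompleteSpace E := FiniteDimensional.complete ℝ _
    have h1 := mvfderiv_fun_add (mdiff_inner hY hZ) (mdiff_inner hY hZ')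
    have h2 := mvfderiv_fun_add (mdiff_inner hX hZ) (mdiff_inner hX hZ')
    simp only [koszul, Pi.add_apply, h1, h2, inner_add_left, inner_add_right, map_add,
      VectorField.mlieBracket_add_right hZ hZ']
    simp
    ring

theorem koszul_add_middle {X Y Y' Z : Π x : M, TangentSpace I x} {x : M} (hX : MDiffAt (T% X) x)
    (hY : MDiffAt (T% Y) x) (hY' : MDiffAt (T% Y') x) (hZ : MDiffAt (T% Z) x) :
    koszul X (Y + Y') Z x = koszul X Y Z x + koszul X Y' Z x := by
  have : CompleteSpace E := FiniteDimensional.complete ℝ _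
  have h1 := mvfderiv_fun_add (mdiff_inner hY hZ) (mdiff_inner hY' hZ)
  have h2 := mvfderiv_fun_add (mdiff_inner hX hY) (mdiff_inner hX hY')
  simp only [koszul, Pi.add_apply, h1, h2, inner_add_left, inner_add_right, map_add,
    VectorField.mlieBracket_add_left hY hY', VectorField.mlieBracket_add_right hY hY']
  simp
  ring

theorem koszul_smul_middle {X Y Z : Π x : M, TangentSpace I x} {f : M → ℝ} {x : M}
    (hX : MDiffAt (T% X) x)
    (hY : MDiffAt (T% Y) x) (hf : MDiffAt f x) (hZ : MDiffAt (T% Z) x) :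
    koszul X (f • Y) Z x = f x * koszul X Y Z x + 2 * (d% f x (X x) * inner ℝ (Y x) (Z x)) := by
  have : CompleteSpace E := FiniteDimensional.complete ℝ _
  have h1 := mvfderiv_fun_mul hf (mdiff_inner hY hZ)
  have h2 := mvfderiv_fun_mul hf (mdiff_inner hX hY)
  simp only [koszul, Pi.smul_apply', real_inner_smul_right, real_inner_smul_left, h1, h2,
    VectorField.mlieBracket_smul_left hf hY, VectorField.mlieBracket_smul_right hf hY,
    inner_add_left, map_smul]
  simp [real_inner_comm]
  ring

/-- The Koszul expression at `x` as a bilinear form in the values `X x` and `Z x`. -/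
def koszulForm (Y : Π x : M, TangentSpace I x) (x : M) (hY : MDiffAt (T% Y) x) :
    TangentSpace I x →L[ℝ] TangentSpace I x →L[ℝ] ℝ :=
  TensorialAt.mkHom₂ (fun X Z ↦ koszul X Y Z x) x
    (fun Z hZ ↦ koszul_tensorial_left Y Z x hY hZ) (fun X hX ↦ koszul_tensorial_right X Y x hX hY)

theorem koszulForm_apply {X Y Z : Π x : M, TangentSpace I x} {x : M} (hX : MDiffAt (T% X) x)
    (hY : MDiffAt (T% Y) x) (hZ : MDiffAt (T% Z) x) :
    koszulForm Y x hY (X x) (Z x) = koszul X Y Z x :=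
  TensorialAt.mkHom₂_apply _ _ hX hZ

open scoped Classical in
/-- The Levi-Civita derivative of `Y` at `x`: `2 ⟨D_X Y, Z⟩` is the Koszul expression
(and the value is `0` where `Y` is not differentiable). -/
def leviCivitaFun (Y : Π x : M, TangentSpace I x) (x : M) :
    TangentSpace I x →L[ℝ] TangentSpace I x :=
  if hY : MDiffAt (T% Y) x then
    LinearMap.toContinuousLinearMap
      { toFun := fun v ↦
          (InnerProductSpace.toDual ℝ (TangentSpace I x)).symm ((1 / 2 : ℝ) • koszulForm Y x hY v)
        map_add' := fun v w ↦ by simp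
        map_smul' := fun c v ↦ by
          rw [map_smul (koszulForm Y x hY), smul_comm, LinearIsometryEquiv.map_smulₛₗ]
          simp }
  else 0

theorem inner_leviCivitaFun {X Y Z : Π x : M, TangentSpace I x} {x : M} (hX : MDiffAt (T% X) x)
    (hY : MDiffAt (T% Y) x) (hZ : MDiffAt (T% Z) x) :
    inner ℝ (leviCivitaFun Y x (X x)) (Z x) = 1 / 2 * koszul X Y Z x := by
  rw [← koszulForm_apply hX hY hZ, leviCivitaFun, dif_pos hY]
  simp [real_inner_smul_left]

theorem leviCivitaFun_eq {Y : Π x : M, TangentSpace I x} {x : M} (hY : MDiffAt (T% Y) x)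
    {A : TangentSpace I x →L[ℝ] TangentSpace I x}
    (h : ∀ X Z : Π x : M, TangentSpace I x, MDiffAt (T% X) x → MDiffAt (T% Z) x →
      inner ℝ (A (X x)) (Z x) = 1 / 2 * koszul X Y Z x) : leviCivitaFun Y x = A := by
  ext v
  refine ext_inner_right ℝ fun w ↦ ?_
  have hv := mdifferentiableAt_extend I E (V := fun x : M ↦ TangentSpace I x) (x := x) v
  have hw := mdifferentiableAt_extend I E (V := fun x : M ↦ TangentSpace I x) (x := x) w
  have h1 := inner_leviCivitaFun hv hY hw
  have h2 := h _ _ hv hw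
  simp only [extend_apply_self] at h1 h2
  rw [h1, h2]

variable (I M) in
/-- The Levi-Civita connection of the Riemannian metric of `M`. It is torsion-free
(`leviCivita_torsion`) and compatible with the metric (`leviCivita_metric`). -/
def leviCivita : CovariantDerivative I E (TangentSpace I : M → Type _) where
  toFun := leviCivitaFun
  isCovariantDerivativeOnUniv :=
    { add := fun {Y Y' x} hY hY' _ ↦ by
        refine leviCivitaFun_eq (mdifferentiableAt_add_section hY hY') fun X Z hX hZ ↦ ?_
        simp only [add_apply, inner_add_left, inner_leviCivitaFun hX hY hZ,
          inner_leviCivitaFun hX hY' hZ, koszul_add_middle hX hY hY' hZ]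
        ring
      leibniz := fun {Y f x} hY hf _ ↦ by
        refine leviCivitaFun_eq (hf.smul_section hY) fun X Z hX hZ ↦ ?_
        simp only [add_apply, inner_add_left, smul_apply,
          real_inner_smul_left, inner_leviCivitaFun hX hY hZ,
          koszul_smul_middle hX hY hf hZ, ContinuousLinearMap.smulRight_apply]
        ring }

theorem leviCivita_torsion : (leviCivita I M).torsion = 0 := by
  have : CompleteSpace E := FiniteDimensional.complete ℝ _
  rw [CovariantDerivative.torsion_eq_zero_iff]
  intro X Y x hX hY
  refine ext_inner_right ℝ fun w ↦ ?_
  have hw := mdifferentiableAt_extend I E (V := fun x : M ↦ TangentSpace I x) (x := x) w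
  have h1 := inner_leviCivitaFun hX hY hw
  have h2 := inner_leviCivitaFun hY hX hw
  have h3 := VectorField.mlieBracket_swap_apply (I := I) (V := Y) (W := X) (x := x)
  simp only [extend_apply_self] at h1 h2
  change inner ℝ (leviCivitaFun Y x (X x) - leviCivitaFun X x (Y x)) w = _
  rw [inner_sub_left, h1, h2]
  simp only [koszul, h3, extend_apply_self, inner_neg_left]
  simp only [real_inner_comm]
  ring

theorem leviCivita_metric {X Y Z : Π x : M, TangentSpace I x} {x : M} (hX : MDiffAt (T% X) x)
    (hY : MDiffAt (T% Y) x) (hZ : MDiffAt (T% Z) x) :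
    d% (fun q ↦ inner ℝ (Y q) (Z q)) x (X x) =
      inner ℝ (leviCivita I M Y x (X x)) (Z x) + inner ℝ (Y x) (leviCivita I M Z x (X x)) := by
  have h1 := inner_leviCivitaFun hX hY hZ
  have h2 := inner_leviCivitaFun hX hZ hY
  change _ = inner ℝ (leviCivitaFun Y x (X x)) (Z x) + inner ℝ (Y x) (leviCivitaFun Z x (X x))
  have h3 := VectorField.mlieBracket_swap_apply (I := I) (V := Z) (W := Y) (x := x)
  rw [real_inner_comm _ (Y x), h1, h2]
  simp only [koszul, h3, inner_neg_left]
  simp only [real_inner_comm]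
  ring

end connection

section tensors

variable {E : Type*} [NormedAddCommGroup E] [NormedSpace ℝ E]
  {H : Type*} [TopologicalSpace H] (I : ModelWithCorners ℝ E H)
  (M : Type*) [TopologicalSpace M] [ChartedSpace H M]

/-- Covariant 2-tensor fields: fields of bilinear forms on the tangent spaces. -/
abbrev Tensor2 : Type _ := Π x : M, TangentSpace I x →L[ℝ] TangentSpace I x →L[ℝ] ℝ

variable {I M}

/-- The 2-tensor field `S` is of class `C^n`, as a section of the bundle of bilinear forms. -/
def Tensor2.IsContMDiff [IsManifold I ∞ M] (n : ℕ∞) (S : Tensor2 I M) : Prop :=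
  ContMDiff I (I.prod 𝓘(ℝ, E →L[ℝ] E →L[ℝ] ℝ)) n
    (fun x ↦ TotalSpace.mk' (E →L[ℝ] E →L[ℝ] ℝ) x (S x))

end tensors

section operators

variable {E : Type*} [NormedAddCommGroup E] [NormedSpace ℝ E] [FiniteDimensional ℝ E]
  {H : Type*} [TopologicalSpace H] {I : ModelWithCorners ℝ E H}
  {M : Type*} [TopologicalSpace M] [ChartedSpace H M] [IsManifold I ∞ M]
  [RiemannianBundle (fun x : M ↦ TangentSpace I x)]
  [IsContMDiffRiemannianBundle I ∞ E (fun x : M ↦ TangentSpace I x)]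

/-- The Levi-Civita derivative `D w` of a vector field: `nabla w x v = (D_v w)(x)`. -/
def nabla (w : Π x : M, TangentSpace I x) (x : M) : TangentSpace I x →L[ℝ] TangentSpace I x :=
  leviCivita I M w x

/-- The vector field equal to `a` at `x` with constant components in the preferred chart at `x`;
it is smooth near `x`. It serves to evaluate tensorial expressions at `x`. -/
def localExt {x : M} (a : TangentSpace I x) : Π q : M, TangentSpace I q :=
  FiberBundle.extend E a

variable (I) in
/-- An orthonormal basis of the tangent space at `x`. -/
def frame (x : M) : OrthonormalBasis (Fin (Module.finrank ℝ (TangentSpace I x))) ℝ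
    (TangentSpace I x) :=
  stdOrthonormalBasis ℝ (TangentSpace I x)

variable (I) in
/-- The gradient of `u`: the vector field metrically dual to `du`. -/
def grad (u : M → ℝ) (x : M) : TangentSpace I x :=
  (InnerProductSpace.toDual ℝ (TangentSpace I x)).symm (d% u x)

/-- The divergence `D_c w^c`. -/
def divergence (w : Π x : M, TangentSpace I x) (x : M) : ℝ :=
  LinearMap.trace ℝ (TangentSpace I x) (nabla w x).toLinearMap

variable (I) in
/-- The Laplace-Beltrami operator `Δ u = div (grad u)`. -/
def laplacian (u : M → ℝ) (x : M) : ℝ := divergence (grad I u) x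

/-- The curvature `R(a,b)c = D_a D_b c - D_b D_a c - D_[a,b] c` at `x`. -/
def riemann (x : M) (a b c : TangentSpace I x) : TangentSpace I x :=
  nabla (fun q ↦ nabla (localExt c) q (localExt b q)) x a - nabla (fun q ↦ nabla (localExt c) q (localExt a q)) x b
    - nabla (localExt c) x (VectorField.mlieBracket I (localExt a) (localExt b) x)

variable (I) in
/-- The scalar curvature `∑ i j, ⟨R(e_i,e_j)e_j, e_i⟩`. -/
def scalarCurvature (x : M) : ℝ :=
  ∑ i, ∑ j, inner ℝ (riemann x (frame I x i) (frame I x j) (frame I x j)) (frame I x i)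

theorem isBilinearMap_conformalKilling (w : Π x : M, TangentSpace I x) (x : M) :
    IsBilinearMap ℝ (fun a b : TangentSpace I x ↦
      (inner ℝ (nabla w x a) b + inner ℝ (nabla w x b) a
        - 2 / 3 * divergence w x * inner ℝ a b : ℝ)) where
  add_left a a' b := by simp only [map_add, inner_add_left, inner_add_right]; ring
  smul_left c a b := by
    simp only [map_smul, real_inner_smul_left, real_inner_smul_right, smul_eq_mul]; ring
  add_right a b b' := by simp only [map_add, inner_add_left, inner_add_right]; ring
  smul_right c a b := by
    simp only [map_smul, real_inner_smul_left, real_inner_smul_right, smul_eq_mul]; ring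

/-- The conformal Killing operator in dimension three, with lowered indices:
`(𝓛 w)_ab = D_a w_b + D_b w_a - (2/3) (D_c w^c) g_ab`, see `conformalKilling_apply`. -/
def conformalKilling (w : Π x : M, TangentSpace I x) : Tensor2 I M := fun x ↦
  (isBilinearMap_conformalKilling w x).toLinearMap.toContinuousBilinearMap

theorem conformalKilling_apply (w : Π x : M, TangentSpace I x) (x : M)
    (a b : TangentSpace I x) : conformalKilling w x a b =
      inner ℝ (nabla w x a) b + inner ℝ (nabla w x b) a - 2 / 3 * divergence w x * inner ℝ a b :=
  rfl

/-- The full contraction `S_ab T^ab`. -/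
def contract (S T : Tensor2 I M) (x : M) : ℝ :=
  ∑ i, ∑ j, S x (frame I x i) (frame I x j) * T x (frame I x i) (frame I x j)

/-- The covariant derivative `(D_z S)(a, b)` of a 2-tensor field at `x`. -/
def nablaTensor (S : Tensor2 I M) (x : M)
    (z a b : TangentSpace I x) : ℝ :=
  d% (fun q : M ↦ S q (localExt a q) (localExt b q)) x z - S x (nabla (localExt a) x z) b
    - S x a (nabla (localExt b) x z)

/-- The divergence `D_b S^ab` of a 2-tensor field, as a vector field. -/
def tensorDivergence (S : Tensor2 I M)
    (x : M) : TangentSpace I x :=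
  ∑ i, (∑ j, nablaTensor S x (frame I x j) (frame I x i) (frame I x j)) • frame I x i

/-- The operator `𝕃 w = -D_b (𝓛 w)^ab`. -/
def vectorLaplacian (w : Π x : M, TangentSpace I x) (x : M) : TangentSpace I x :=
  -tensorDivergence (conformalKilling w) x

variable (I M) in
/-- There are no conformal Killing fields: a `C^2` vector field `w` with `𝓛 w = 0` vanishes. -/
def NoConformalKilling : Prop :=
  ∀ w : Π x : M, TangentSpace I x, CMDiff 2 (T% w) → conformalKilling w = 0 → w = 0

/-- Transverse traceless tensor fields: symmetric, trace-free and divergence-free 2-tensor fields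
of class `C^1`. -/
structure IsTT (σ : Tensor2 I M) : Prop where
  contMDiff : σ.IsContMDiff 1
  symm : ∀ x a b, σ x a b = σ x b a
  trace_eq_zero : ∀ x, ∑ i, σ x (frame I x i) (frame I x i) = 0
  divergence_eq_zero : ∀ x, tensorDivergence σ x = 0

end operators

local notation "E3" => EuclideanSpace ℝ (Fin 3)

section volume

variable {M : Type*} [TopologicalSpace M] [ChartedSpace E3 M] [IsManifold (𝓡 3) ∞ M]
  [RiemannianBundle (fun x : M ↦ TangentSpace (𝓡 3) x)]

/-- The Gram matrix `g_ij` of the coordinate vector fields of the chart at `p`, at the point with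
coordinates `y`. -/
def gram (p : M) (y : E3) : Matrix (Fin 3) (Fin 3) ℝ :=
  letI D : E3 →L[ℝ] TangentSpace (𝓡 3) ((extChartAt (𝓡 3) p).symm y) :=
    mfderiv 𝓘(ℝ, E3) (𝓡 3) (extChartAt (𝓡 3) p).symm y
  Matrix.of fun i j ↦ inner ℝ (D (EuclideanSpace.basisFun (Fin 3) ℝ i))
    (D (EuclideanSpace.basisFun (Fin 3) ℝ j))

/-- The measure `√(det g_ij) dy` on the domain of the chart at `p`. -/
def chartVolume [MeasurableSpace M] (p : M) : Measure M :=
  ((volume.restrict (extChartAt (𝓡 3) p).target).withDensity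
    fun y ↦ ENNReal.ofReal √(gram p y).det).map (extChartAt (𝓡 3) p).symm

variable (M) in
/-- A smooth partition of unity subordinate to the chart domains. -/
def chartPartition [CompactSpace M] [T2Space M] : SmoothPartitionOfUnity M (𝓡 3) M univ :=
  (SmoothPartitionOfUnity.exists_isSubordinate_chartAt_source (𝓡 3) M).choose

variable (M) in
/-- The Riemannian volume measure `dV_g`, put together from the chart volumes. -/
def riemannianVolume [CompactSpace M] [T2Space M] [MeasurableSpace M] : Measure M :=
  Measure.sum fun p : M ↦ (chartVolume p).withDensity fun q ↦ ENNReal.ofReal (chartPartition M p q)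

/-- The `L²` inner product of pairs of a function and a vector field. -/
def l2Inner [CompactSpace M] [T2Space M] [MeasurableSpace M]
    (x y : (M → ℝ) × (Π q : M, TangentSpace (𝓡 3) q)) : ℝ :=
  ∫ q, (x.1 q * y.1 q + inner ℝ (x.2 q) (y.2 q)) ∂riemannianVolume M

end volume

section holder

variable {F : Type*} [NormedAddCommGroup F] [NormedSpace ℝ F]

/-- The `C^{k,α}` norm (possibly infinite) of `f` on a set `K`: the sup norms on `K` of the
derivatives of order at most `k`, plus the `α`-Hölder seminorm on `K` of the one of order `k`. -/
def holderENorm (k : ℕ) (α : ℝ) (K : Set E3) (f : E3 → F) : ℝ≥0∞ :=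
  (∑ j ∈ Finset.range (k + 1), ⨆ y ∈ K, ‖iteratedFDeriv ℝ j f y‖ₑ) +
    ⨆ y ∈ K, ⨆ z ∈ K, ‖iteratedFDeriv ℝ k f y - iteratedFDeriv ℝ k f z‖ₑ /
      ENNReal.ofReal (dist y z ^ α)

theorem holderENorm_add_le {k : ℕ} {α : ℝ} {K U : Set E3} (hU : IsOpen U) (hK : K ⊆ U)
    {f g : E3 → F} (hf : ContDiffOn ℝ k f U) (hg : ContDiffOn ℝ k g U) :
    holderENorm k α K (f + g) ≤ holderENorm k α K f + holderENorm k α K g := by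
  have hD : ∀ j ≤ k, ∀ y ∈ K, iteratedFDeriv ℝ j (f + g) y =
      iteratedFDeriv ℝ j f y + iteratedFDeriv ℝ j g y := fun j hj y hy ↦
    iteratedFDeriv_add_apply
      ((hf.contDiffAt (hU.mem_nhds (hK hy))).of_le (by exact_mod_cast hj))
      ((hg.contDiffAt (hU.mem_nhds (hK hy))).of_le (by exact_mod_cast hj))
  unfold holderENorm
  rw [add_add_add_comm, ← Finset.sum_add_distrib]
  gcongr with j hj
  · refine iSup₂_le fun y hy ↦ ?_
    rw [hD j (by simpa [Nat.lt_succ_iff] using hj) y hy]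
    refine (enorm_add_le _ _).trans (add_le_add ?_ ?_)
    · exact le_iSup₂ (f := fun y (_ : y ∈ K) ↦ ‖iteratedFDeriv ℝ j f y‖ₑ) y hy
    · exact le_iSup₂ (f := fun y (_ : y ∈ K) ↦ ‖iteratedFDeriv ℝ j g y‖ₑ) y hy
  · refine iSup₂_le fun y hy ↦ iSup₂_le fun z hz ↦ ?_
    rw [hD k le_rfl y hy, hD k le_rfl z hz, add_sub_add_comm]
    refine (ENNReal.div_le_div_right (enorm_add_le _ _) _).trans ?_
    rw [ENNReal.add_div]
    refine add_le_add ?_ ?_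
    · exact le_iSup₂_of_le y hy (le_iSup₂_of_le z hz le_rfl)
    · exact le_iSup₂_of_le y hy (le_iSup₂_of_le z hz le_rfl)

theorem holderENorm_smul {k : ℕ} {α : ℝ} {K U : Set E3} (hU : IsOpen U) (hK : K ⊆ U)
    (c : ℝ) {f : E3 → F} (hf : ContDiffOn ℝ k f U) :
    holderENorm k α K (c • f) = ‖c‖ₑ * holderENorm k α K f := by
  have hD : ∀ j ≤ k, ∀ y ∈ K, iteratedFDeriv ℝ j (c • f) y = c • iteratedFDeriv ℝ j f y :=
    fun j hj y hy ↦ iteratedFDeriv_const_smul_apply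
      ((hf.contDiffAt (hU.mem_nhds (hK hy))).of_le (by exact_mod_cast hj))
  unfold holderENorm
  rw [mul_add, Finset.mul_sum]
  congr 1
  · refine Finset.sum_congr rfl fun j hj ↦ ?_
    simp only [ENNReal.mul_iSup]
    refine iSup_congr fun y ↦ iSup_congr fun hy ↦ ?_
    rw [hD j (by simpa [Nat.lt_succ_iff] using hj) y hy, enorm_smul]
  · simp only [ENNReal.mul_iSup]
    refine iSup_congr fun y ↦ iSup_congr fun hy ↦ iSup_congr fun z ↦ iSup_congr fun hz ↦ ?_
    rw [hD k le_rfl y hy, hD k le_rfl z hz, ← smul_sub, enorm_smul, mul_div_assoc]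

theorem holderENorm_const {k : ℕ} {α : ℝ} {K : Set E3} (c : F) :
    holderENorm k α K (fun _ : E3 ↦ c) < ⊤ := by
  have h : ∀ j (y : E3), ‖iteratedFDeriv ℝ j (fun _ : E3 ↦ c) y‖ₑ ≤ ‖c‖ₑ := fun j y ↦ by
    rcases j with _ | j
    · simp [enorm_eq_nnnorm, nnnorm, norm_iteratedFDeriv_zero]
    · simp [iteratedFDeriv_const_of_ne (Nat.succ_ne_zero j) c]
  have h' : ∀ j (y z : E3), iteratedFDeriv ℝ j (fun _ : E3 ↦ c) y =
      iteratedFDeriv ℝ j (fun _ : E3 ↦ c) z := fun j y z ↦ by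
    rcases j with _ | j
    · ext m; simp
    · simp [iteratedFDeriv_const_of_ne (Nat.succ_ne_zero j) c]
  refine ENNReal.add_lt_top.2 ⟨ENNReal.sum_lt_top.2 fun j _ ↦
    (iSup₂_le fun y _ ↦ h j y).trans_lt enorm_lt_top, ?_⟩
  refine lt_of_le_of_lt (iSup₂_le fun y _ ↦ iSup₂_le fun z _ ↦ ?_) ENNReal.zero_lt_top
  simp [h' k y z]

end holder

section spaces

variable (M : Type*) [TopologicalSpace M] [ChartedSpace E3 M]

/-- A finite cover of `M` by coordinate balls: the open balls around the `centers`, in the preferred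
charts there, cover `M`, and the closed balls lie in the chart images. Such covers exist on a compact
`M`, and any two of them give equivalent Hölder norms. -/
structure HolderCover where
  centers : Finset M
  radius : M → ℝ
  closedBall_subset : ∀ p ∈ centers,
    closedBall (extChartAt (𝓡 3) p p) (radius p) ⊆ (extChartAt (𝓡 3) p).target
  covers : ∀ q : M, ∃ p ∈ centers, q ∈ (extChartAt (𝓡 3) p).source ∧
    extChartAt (𝓡 3) p q ∈ ball (extChartAt (𝓡 3) p p) (radius p)

instance [CompactSpace M] : Nonempty (HolderCover M) := by
  have h : ∀ p : M, ∃ r > 0, closedBall (extChartAt (𝓡 3) p p) r ⊆ (extChartAt (𝓡 3) p).target :=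
    fun p ↦ Metric.nhds_basis_closedBall.mem_iff.1
      ((isOpen_extChartAt_target p).mem_nhds (mem_extChartAt_target p))
  choose r hr hball using h
  obtain ⟨t, ht⟩ := CompactSpace.elim_nhds_subcover
    (fun p : M ↦ (extChartAt (𝓡 3) p).source ∩
      extChartAt (𝓡 3) p ⁻¹' ball (extChartAt (𝓡 3) p p) (r p))
    (fun p ↦ inter_mem (extChartAt_source_mem_nhds p)
      ((continuousAt_extChartAt p).preimage_mem_nhds (ball_mem_nhds _ (hr p))))
  refine ⟨⟨t, r, fun p _ ↦ hball p, fun q ↦ ?_⟩⟩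
  have hq : q ∈ (⊤ : Set M) := trivial
  rw [← ht] at hq
  simp only [mem_iUnion] at hq
  obtain ⟨p, hp, h1, h2⟩ := hq
  exact ⟨p, hp, h1, h2⟩

variable {M}

/-- The closed coordinate ball around `p`. -/
def HolderCover.ball (𝒞 : HolderCover M) (p : M) : Set E3 :=
  closedBall (extChartAt (𝓡 3) p p) (𝒞.radius p)

variable {F V : Type*} [NormedAddCommGroup F] [NormedSpace ℝ F] [AddCommGroup V] [Module ℝ V]

/-- The sum over the cover of the `C^{k,α}` norms of the coordinate expressions `T p v`. -/
def atlasENorm (𝒞 : HolderCover M) (T : M → V →ₗ[ℝ] (E3 → F)) (k : ℕ) (α : ℝ) (v : V) : ℝ≥0∞ :=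
  ∑ p ∈ 𝒞.centers, holderENorm k α (𝒞.ball p) (T p v)

theorem holderENorm_zero {k : ℕ} {α : ℝ} {K : Set E3} :
    holderENorm k α K (0 : E3 → F) = 0 := by
  have h := holderENorm_smul (k := k) (α := α) (K := K) isOpen_univ (subset_univ _) 0
    (contDiffOn_const (c := (0 : F)))
  simpa using h

theorem atlasENorm_add_le {𝒞 : HolderCover M} {T : M → V →ₗ[ℝ] (E3 → F)} {k : ℕ} {α : ℝ} {v w : V}
    (hv : ∀ p ∈ 𝒞.centers, ContDiffOn ℝ k (T p v) (extChartAt (𝓡 3) p).target)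
    (hw : ∀ p ∈ 𝒞.centers, ContDiffOn ℝ k (T p w) (extChartAt (𝓡 3) p).target) :
    atlasENorm 𝒞 T k α (v + w) ≤ atlasENorm 𝒞 T k α v + atlasENorm 𝒞 T k α w := by
  unfold atlasENorm
  rw [← Finset.sum_add_distrib]
  refine Finset.sum_le_sum fun p hp ↦ ?_
  rw [map_add]
  exact holderENorm_add_le (isOpen_extChartAt_target p) (𝒞.closedBall_subset p hp) (hv p hp) (hw p hp)

theorem atlasENorm_smul {𝒞 : HolderCover M} {T : M → V →ₗ[ℝ] (E3 → F)} {k : ℕ} {α : ℝ} (c : ℝ)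
    {v : V} (hv : ∀ p ∈ 𝒞.centers, ContDiffOn ℝ k (T p v) (extChartAt (𝓡 3) p).target) :
    atlasENorm 𝒞 T k α (c • v) = ‖c‖ₑ * atlasENorm 𝒞 T k α v := by
  unfold atlasENorm
  rw [Finset.mul_sum]
  refine Finset.sum_congr rfl fun p hp ↦ ?_
  rw [map_smul]
  exact holderENorm_smul (isOpen_extChartAt_target p) (𝒞.closedBall_subset p hp) c (hv p hp)

/-- The elements `v` whose coordinate expressions `T p v` are of class `C^k` with finite
`C^{k,α}` norm. -/
def holderSubmodule (𝒞 : HolderCover M) (T : M → V →ₗ[ℝ] (E3 → F)) (k : ℕ) (α : ℝ) :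
    Submodule ℝ V where
  carrier := {v | (∀ p ∈ 𝒞.centers, ContDiffOn ℝ k (T p v) (extChartAt (𝓡 3) p).target) ∧
    atlasENorm 𝒞 T k α v < ⊤}
  add_mem' {v w} hv hw := by
    refine ⟨fun p hp ↦ ?_, (atlasENorm_add_le hv.1 hw.1).trans_lt
      (ENNReal.add_lt_top.2 ⟨hv.2, hw.2⟩)⟩
    rw [map_add]
    exact (hv.1 p hp).add (hw.1 p hp)
  zero_mem' := by
    refine ⟨fun p _ ↦ ?_, ?_⟩
    · rw [map_zero]
      exact contDiffOn_const
    · simp [atlasENorm, holderENorm_zero]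
  smul_mem' c v hv := by
    refine ⟨fun p hp ↦ ?_, ?_⟩
    · rw [map_smul]
      exact (hv.1 p hp).const_smul c
    · rw [atlasENorm_smul c hv.1]
      exact ENNReal.mul_lt_top enorm_lt_top hv.2

/-- The space `C^{k,α}` determined by the coordinate expressions `T`, to be normed by `atlasENorm`. -/
def HolderSpace (𝒞 : HolderCover M) (T : M → V →ₗ[ℝ] (E3 → F)) (k : ℕ) (α : ℝ) : Type _ :=
  holderSubmodule 𝒞 T k α

namespace HolderSpace

variable {𝒞 : HolderCover M} {T : M → V →ₗ[ℝ] (E3 → F)} {k : ℕ} {α : ℝ}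

instance : AddCommGroup (HolderSpace 𝒞 T k α) :=
  inferInstanceAs (AddCommGroup (holderSubmodule 𝒞 T k α))

instance : Module ℝ (HolderSpace 𝒞 T k α) :=
  inferInstanceAs (Module ℝ (holderSubmodule 𝒞 T k α))

/-- The underlying function or field. -/
def val (v : HolderSpace 𝒞 T k α) : V := Subtype.val (p := (· ∈ holderSubmodule 𝒞 T k α)) v

theorem property (v : HolderSpace 𝒞 T k α) : v.val ∈ holderSubmodule 𝒞 T k α :=
  Subtype.property (p := (· ∈ holderSubmodule 𝒞 T k α)) v

theorem val_injective : Function.Injective (val : HolderSpace 𝒞 T k α → V) :=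
  Subtype.val_injective

instance : Norm (HolderSpace 𝒞 T k α) :=
  ⟨fun v ↦ (atlasENorm 𝒞 T k α v.val).toReal⟩

open scoped Classical in
/-- The element of `C^{k,α}` given by `v` if `v` is in this space, and `0` otherwise. -/
def ofVal (v : V) : HolderSpace 𝒞 T k α := if h : v ∈ holderSubmodule 𝒞 T k α then ⟨v, h⟩ else 0

theorem core (hT : ∀ v : V, (∀ p ∈ 𝒞.centers, ∀ y ∈ 𝒞.ball p, T p v y = 0) → v = 0) :
    NormedSpace.Core ℝ (HolderSpace 𝒞 T k α) where
  norm_nonneg v := ENNReal.toReal_nonneg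
  norm_smul c v := by
    change (atlasENorm 𝒞 T k α (c • v.val)).toReal = |c| * (atlasENorm 𝒞 T k α v.val).toReal
    rw [atlasENorm_smul c v.property.1, ENNReal.toReal_mul, toReal_enorm, Real.norm_eq_abs]
  norm_triangle v w := by
    change (atlasENorm 𝒞 T k α (v.val + w.val)).toReal ≤
      (atlasENorm 𝒞 T k α v.val).toReal + (atlasENorm 𝒞 T k α w.val).toReal
    rw [← ENNReal.toReal_add v.property.2.ne w.property.2.ne]
    exact ENNReal.toReal_mono (ENNReal.add_lt_top.2 ⟨v.property.2, w.property.2⟩).ne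
      (atlasENorm_add_le v.property.1 w.property.1)
  norm_eq_zero_iff v := by
    constructor
    · intro h
      have h0 : atlasENorm 𝒞 T k α v.val = 0 :=
        ((ENNReal.toReal_eq_zero_iff _).1 h).resolve_right v.property.2.ne
      refine val_injective (hT _ fun p hp y hy ↦ ?_)
      have h1 := (Finset.sum_eq_zero_iff.1 h0) p hp
      have h2 := (Finset.sum_eq_zero_iff.1 (add_eq_zero.1 h1).1) 0 (by simp)
      simp only [ENNReal.iSup_eq_zero] at h2
      have h3 := h2 y hy
      rw [enorm_eq_zero] at h3
      have h4 : iteratedFDeriv ℝ 0 (T p v.val) y 0 = 0 := by rw [h3]; rfl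
      simpa using h4
    · rintro rfl
      change (atlasENorm 𝒞 T k α (0 : V)).toReal = 0
      simp [atlasENorm, holderENorm_zero]

end HolderSpace

section functions

/-- The coordinate expression of a function in the chart at `p`. -/
def funRep (p : M) : (M → ℝ) →ₗ[ℝ] (E3 → ℝ) where
  toFun u := u ∘ (extChartAt (𝓡 3) p).symm
  map_add' _ _ := rfl
  map_smul' _ _ := rfl

/-- The space `C^{k,α}(M)` of functions. -/
abbrev HolderFun (𝒞 : HolderCover M) (k : ℕ) (α : ℝ) : Type _ := HolderSpace 𝒞 (funRep (M := M)) k α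

variable {𝒞 : HolderCover M} {k : ℕ} {α : ℝ}

theorem HolderFun.core : NormedSpace.Core ℝ (HolderFun 𝒞 k α) :=
  HolderSpace.core fun u hu ↦ by
    funext q
    obtain ⟨p, hp, hq, hb⟩ := 𝒞.covers q
    have h := hu p hp _ (ball_subset_closedBall hb)
    have h' : u ((extChartAt (𝓡 3) p).symm (extChartAt (𝓡 3) p q)) = 0 := h
    rwa [(extChartAt (𝓡 3) p).left_inv hq] at h'

instance : NormedAddCommGroup (HolderFun 𝒞 k α) := NormedAddCommGroup.ofCore HolderFun.core
instance : NormedSpace ℝ (HolderFun 𝒞 k α) := NormedSpace.ofCore HolderFun.core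

instance : CoeFun (HolderFun 𝒞 k α) fun _ ↦ M → ℝ := ⟨fun u ↦ u.val⟩

/-- Constant functions, as elements of `C^{k,α}(M)`. -/
def HolderFun.const (𝒞 : HolderCover M) (k : ℕ) (α : ℝ) (c : ℝ) : HolderFun 𝒞 k α :=
  ⟨fun _ ↦ c, fun _ _ ↦ contDiffOn_const, ENNReal.sum_lt_top.2 fun _ _ ↦ holderENorm_const c⟩

end functions

section fields

variable [IsManifold (𝓡 3) ∞ M]

/-- The components of a vector field in the chart at `p`. -/
def fieldRep (p : M) : (Π q : M, TangentSpace (𝓡 3) q) →ₗ[ℝ] (E3 → E3) where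
  toFun w y := mfderiv (𝓡 3) 𝓘(ℝ, E3) (extChartAt (𝓡 3) p) ((extChartAt (𝓡 3) p).symm y)
    (w ((extChartAt (𝓡 3) p).symm y))
  map_add' v w := by ext1 y; exact ContinuousLinearMap.map_add _ _ _
  map_smul' c v := by ext1 y; exact ContinuousLinearMap.map_smul _ _ _

/-- The space `C^{k,α}(TM)` of vector fields. -/
abbrev HolderField (𝒞 : HolderCover M) (k : ℕ) (α : ℝ) : Type _ :=
  HolderSpace 𝒞 (fieldRep (M := M)) k α

variable {𝒞 : HolderCover M} {k : ℕ} {α : ℝ}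

theorem HolderField.core : NormedSpace.Core ℝ (HolderField 𝒞 k α) :=
  HolderSpace.core fun w hw ↦ by
    funext q
    obtain ⟨p, hp, hq, hb⟩ := 𝒞.covers q
    have h := hw p hp _ (ball_subset_closedBall hb)
    have h' : mfderiv (𝓡 3) 𝓘(ℝ, E3) (extChartAt (𝓡 3) p)
        ((extChartAt (𝓡 3) p).symm (extChartAt (𝓡 3) p q))
        (w ((extChartAt (𝓡 3) p).symm (extChartAt (𝓡 3) p q))) = 0 := h
    rw [(extChartAt (𝓡 3) p).left_inv hq] at h'
    have hinv := isInvertible_mfderiv_extChartAt (I := 𝓡 3) hq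
    exact hinv.injective (h'.trans (map_zero _).symm)

instance : NormedAddCommGroup (HolderField 𝒞 k α) := NormedAddCommGroup.ofCore HolderField.core
instance : NormedSpace ℝ (HolderField 𝒞 k α) := NormedSpace.ofCore HolderField.core

instance : CoeFun (HolderField 𝒞 k α) fun _ ↦ Π q : M, TangentSpace (𝓡 3) q :=
  ⟨fun u ↦ u.val⟩

end fields

end spaces

section system

variable {M : Type*} [TopologicalSpace M] [ChartedSpace E3 M] [IsManifold (𝓡 3) ∞ M]
  [RiemannianBundle (fun x : M ↦ TangentSpace (𝓡 3) x)]
  [IsContMDiffRiemannianBundle (𝓡 3) ∞ E3 (fun x : M ↦ TangentSpace (𝓡 3) x)]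

/-- The left-hand side of the Hamiltonian constraint,
`-Δφ + (R/8) φ + λ² (τ²/12) φ⁵ - (1/8) |σ + 𝓛w|² φ⁻⁷ - 2πρ e^{-λ} φ⁵`. -/
def hamiltonian (τ : M → ℝ) (σ : Tensor2 (𝓡 3) M) (ρ : ℝ) (φ : M → ℝ)
    (w : Π x : M, TangentSpace (𝓡 3) x) (lam : ℝ) (x : M) : ℝ :=
  -laplacian (𝓡 3) φ x + scalarCurvature (𝓡 3) x / 8 * φ x + lam ^ 2 * (τ x ^ 2 / 12) * φ x ^ 5
    - 1 / 8 * contract (σ + conformalKilling w) (σ + conformalKilling w) x * φ x ^ (-7 : ℤ)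
    - 2 * Real.pi * ρ * Real.exp (-lam) * φ x ^ 5

/-- The left-hand side of the momentum constraint, `𝕃w + λ (2/3) (grad τ) φ⁶`. -/
def momentum (τ : M → ℝ) (φ : M → ℝ) (w : Π x : M, TangentSpace (𝓡 3) x) (lam : ℝ) (x : M) :
    TangentSpace (𝓡 3) x :=
  vectorLaplacian w x + (lam * φ x ^ 6) • ((2 / 3 : ℝ) • grad (𝓡 3) τ x)

/-- `X = C^{2,α}(M) ⊕ C^{2,α}(TM)`. -/
abbrev DomainSpace (𝒞 : HolderCover M) (α : ℝ) : Type _ := HolderFun 𝒞 2 α × HolderField 𝒞 2 α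

/-- `Z = C^{0,α}(M) ⊕ C^{0,α}(TM)`. -/
abbrev TargetSpace (𝒞 : HolderCover M) (α : ℝ) : Type _ := HolderFun 𝒞 0 α × HolderField 𝒞 0 α

/-- The operator `F((φ, w), λ)` of the coupled system, as a map into `C^{0,α}(M) ⊕ C^{0,α}(TM)`.
(It is meant for `φ` without zeros, where both components are in these spaces.) -/
def constraintMap {𝒞 : HolderCover M} {α : ℝ} (τ : M → ℝ) (σ : Tensor2 (𝓡 3) M) (ρ : ℝ)
    (X : DomainSpace 𝒞 α) (lam : ℝ) : TargetSpace 𝒞 α :=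
  (HolderSpace.ofVal (hamiltonian τ σ ρ X.1 X.2 lam), HolderSpace.ofVal (momentum τ X.1 X.2 lam))

/-- `B` is the adjoint of `A` with respect to the `L²` inner product on pairs. -/
def IsL2Adjoint [CompactSpace M] [T2Space M] [MeasurableSpace M] {𝒞 : HolderCover M} {α : ℝ}
    (A B : DomainSpace 𝒞 α →L[ℝ] TargetSpace 𝒞 α) : Prop :=
  ∀ y z : DomainSpace 𝒞 α, l2Inner ((A y).1.val, (A y).2.val) (z.1.val, z.2.val) =
    l2Inner (y.1.val, y.2.val) ((B z).1.val, (B z).2.val)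

/-- The critical density `ρ_c = R^{3/2} / (24 √3 π |σ|)`. -/
def rhoC (R s : ℝ) : ℝ := R ^ (3 / 2 : ℝ) / (24 * √3 * Real.pi * s)

/-- The critical constant `φ_c = (R / (24 π ρ_c))^{1/4}`. -/
def phiC (R s : ℝ) : ℝ := (R / (24 * Real.pi * rhoC R s)) ^ (1 / 4 : ℝ)

end system

end CTT

end

open CTT

set_option linter.unusedSectionVars false
set_option linter.style.haveILetI false

noncomputable section

namespace CTT

local notation "E3" => EuclideanSpace ℝ (Fin 3)

/-- The partial derivative `∂_i f` of a function on `ℝ³`. -/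
def pd (i : Fin 3) (f : E3 → ℝ) (y : E3) : ℝ := fderiv ℝ f y (EuclideanSpace.single i 1)

section coordinates

variable {M : Type*} [TopologicalSpace M] [ChartedSpace E3 M] [IsManifold (𝓡 3) ∞ M]

/-- The `i`-th standard basis vector, as a constant vector field on `ℝ³`. -/
def constField (i : Fin 3) : Π x : E3, TangentSpace 𝓘(ℝ, E3) x :=
  fun _ ↦ (EuclideanSpace.single i 1 : E3)

/-- The `i`-th coordinate vector field of the chart at `p`. -/
def coordField (p : M) (i : Fin 3) : Π q : M, TangentSpace (𝓡 3) q :=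
  VectorField.mpullback (𝓡 3) 𝓘(ℝ, E3) (extChartAt (𝓡 3) p) (constField i)

/-- The vector field `w` is of class `C^n` at `x`. -/
abbrev FieldCAt (n : ℕ∞ω) (w : Π q : M, TangentSpace (𝓡 3) q) (x : M) : Prop :=
  ContMDiffAt (𝓡 3) ((𝓡 3).prod 𝓘(ℝ, E3)) n (fun q ↦ TotalSpace.mk' E3 q (w q)) x

/-- The vector field `w` is differentiable at `x`. -/
abbrev FieldDAt (w : Π q : M, TangentSpace (𝓡 3) q) (x : M) : Prop :=
  MDifferentiableAt (𝓡 3) ((𝓡 3).prod 𝓘(ℝ, E3)) (fun q ↦ TotalSpace.mk' E3 q (w q)) x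

variable {p q : M} {y : E3} {i j k : Fin 3}

theorem mfderiv_coordField (hq : q ∈ (extChartAt (𝓡 3) p).source) :
    mfderiv (𝓡 3) 𝓘(ℝ, E3) (extChartAt (𝓡 3) p) q (coordField p i q) =
      (EuclideanSpace.single i 1 : E3) := by
  have h := isInvertible_mfderiv_extChartAt (I := 𝓡 3) hq
  exact h.self_apply_inverse _

theorem contMDiffAt_coordField (hq : q ∈ (extChartAt (𝓡 3) p).source) :
    FieldCAt ∞ (coordField p i) q := by
  have h := isInvertible_mfderiv_extChartAt (I := 𝓡 3) hq
  refine ContMDiffAt.mpullback_vectorField_preimage (n := ∞) (m := ∞)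
    (contMDiffAt_vectorSpace_iff_contDiffAt.2 contDiffAt_const)
    (contMDiffAt_extChartAt' (by simpa using hq)) h ?_
  simp

theorem coordField_symm_eq (hy : y ∈ (extChartAt (𝓡 3) p).target) :
    mfderiv 𝓘(ℝ, E3) (𝓡 3) (extChartAt (𝓡 3) p).symm y (EuclideanSpace.single i 1 : E3) =
      coordField p i ((extChartAt (𝓡 3) p).symm y) := by
  have hs := (extChartAt (𝓡 3) p).map_target hy
  have h := isInvertible_mfderiv_extChartAt (I := 𝓡 3) hs
  apply h.injective
  rw [mfderiv_coordField hs]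
  have h2 := mfderiv_extChartAt_comp_mfderivWithin_extChartAt_symm (I := 𝓡 3) hy
  simp only [modelWithCornersSelf_coe, range_id, mfderivWithin_univ] at h2
  exact congrArg (fun A : E3 →L[ℝ] E3 ↦ A (EuclideanSpace.single i 1)) h2

theorem fieldRep_extChartAt {w : Π q : M, TangentSpace (𝓡 3) q}
    (hq : q ∈ (extChartAt (𝓡 3) p).source) : fieldRep p w (extChartAt (𝓡 3) p q) =
      mfderiv (𝓡 3) 𝓘(ℝ, E3) (extChartAt (𝓡 3) p) q (w q) := by
  have h : ∀ q' : M, q' = q → (mfderiv (𝓡 3) 𝓘(ℝ, E3) (extChartAt (𝓡 3) p) q' (w q') : E3) =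
      mfderiv (𝓡 3) 𝓘(ℝ, E3) (extChartAt (𝓡 3) p) q (w q) := by rintro q' rfl; rfl
  exact h _ ((extChartAt (𝓡 3) p).left_inv hq)

theorem fieldRep_ext {v w : Π q : M, TangentSpace (𝓡 3) q} (hy : y ∈ (extChartAt (𝓡 3) p).target)
    (h : fieldRep p v y = fieldRep p w y) :
    v ((extChartAt (𝓡 3) p).symm y) = w ((extChartAt (𝓡 3) p).symm y) :=
  (isInvertible_mfderiv_extChartAt (I := 𝓡 3) ((extChartAt (𝓡 3) p).map_target hy)).injective h

theorem field_eq_sum (w : Π q : M, TangentSpace (𝓡 3) q)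
    (hy : y ∈ (extChartAt (𝓡 3) p).target) :
    w ((extChartAt (𝓡 3) p).symm y) =
      ∑ i, fieldRep p w y i • coordField p i ((extChartAt (𝓡 3) p).symm y) := by
  have h := isInvertible_mfderiv_extChartAt (I := 𝓡 3) ((extChartAt (𝓡 3) p).map_target hy)
  apply h.injective
  rw [map_sum]
  simp only [map_smul, mfderiv_coordField ((extChartAt (𝓡 3) p).map_target hy)]
  change fieldRep p w y = _
  have h3 : fieldRep p w y = ∑ i, fieldRep p w y i • (EuclideanSpace.single i 1 : E3) := by
    ext i
    fin_cases i <;> simp [Fin.sum_univ_three]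
  exact h3

theorem mlieBracket_coordField (hq : q ∈ (extChartAt (𝓡 3) p).source) :
    VectorField.mlieBracket (𝓡 3) (coordField p i) (coordField p j) q = 0 := by
  have : IsManifold (𝓡 3) (minSmoothness ℝ 2) M := by
    rw [minSmoothness_of_isRCLikeNormedField]; infer_instance
  have hd : ∀ i (z : E3), FieldDAt (M := E3) (constField i) z := fun i z ↦
    (contMDiffAt_vectorSpace_iff_contDiffAt (n := 1).2 contDiffAt_const).mdifferentiableAt one_ne_zero
  have h0 : ∀ z, VectorField.mlieBracket 𝓘(ℝ, E3) (constField i) (constField j) z = 0 := by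
    intro z
    rw [← VectorField.mlieBracketWithin_univ, VectorField.mlieBracketWithin_eq_lieBracketWithin]
    have h1 : VectorField.lieBracketWithin ℝ (fun _ : E3 ↦ (EuclideanSpace.single i 1 : E3))
        (fun _ : E3 ↦ (EuclideanSpace.single j 1 : E3)) univ z = 0 := by
      simp [VectorField.lieBracketWithin]
    exact h1
  refine (VectorField.mpullback_mlieBracket (n := ∞) (hd i _) (hd j _)
    (contMDiffAt_extChartAt' (by simpa using hq)) ?_).symm.trans ?_
  · rw [minSmoothness_of_isRCLikeNormedField]; exact ENat.LEInfty.out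
  · rw [VectorField.mpullback_apply, h0, map_zero]

theorem contMDiffAt_funRep_iff {u : M → ℝ} {n : ℕ∞} (hy : y ∈ (extChartAt (𝓡 3) p).target) :
    ContMDiffAt (𝓡 3) 𝓘(ℝ) n u ((extChartAt (𝓡 3) p).symm y) ↔ ContDiffAt ℝ n (funRep p u) y := by
  have hs := (extChartAt (𝓡 3) p).map_target hy
  have hn : (n : WithTop ℕ∞) ≤ (∞ : ℕ∞ω) := by exact_mod_cast le_top
  have h1 : ContMDiffAt 𝓘(ℝ, E3) (𝓡 3) n (extChartAt (𝓡 3) p).symm y :=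
    ((contMDiffOn_extChartAt_symm (n := ∞) p).contMDiffAt
      ((isOpen_extChartAt_target p).mem_nhds hy)).of_le hn
  constructor
  · intro h
    exact contMDiffAt_iff_contDiffAt.1 (h.comp y h1)
  · intro h
    have h2 : ContMDiffAt (𝓡 3) 𝓘(ℝ, E3) n (extChartAt (𝓡 3) p) ((extChartAt (𝓡 3) p).symm y) :=
      (contMDiffAt_extChartAt' (n := ∞) (by simpa using hs)).of_le hn
    have h3 : ContMDiffAt 𝓘(ℝ, E3) 𝓘(ℝ, ℝ) n (funRep p u)
        (extChartAt (𝓡 3) p ((extChartAt (𝓡 3) p).symm y)) := by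
      rw [(extChartAt (𝓡 3) p).right_inv hy]; exact contMDiffAt_iff_contDiffAt.2 h
    refine (h3.comp _ h2).congr_of_eventuallyEq ?_
    filter_upwards [(isOpen_extChartAt_source p).mem_nhds hs] with q hq
    exact congrArg u ((extChartAt (𝓡 3) p).left_inv hq).symm

theorem contMDiffAt_fieldRep_iff {w : Π q : M, TangentSpace (𝓡 3) q} {n : ℕ∞}
    (hy : y ∈ (extChartAt (𝓡 3) p).target) :
    FieldCAt n w ((extChartAt (𝓡 3) p).symm y) ↔ ContDiffAt ℝ n (fieldRep p w) y := by
  have hs := (extChartAt (𝓡 3) p).map_target hy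
  have hs' : (extChartAt (𝓡 3) p).symm y ∈ (chartAt E3 p).source := by simpa using hs
  have hn : (n : WithTop ℕ∞) ≤ (∞ : ℕ∞ω) := by exact_mod_cast le_top
  have : ContMDiffVectorBundle n E3 (TangentSpace (𝓡 3) : M → Type _) (𝓡 3) :=
    inferInstance
  have h1 : ContMDiffAt 𝓘(ℝ, E3) (𝓡 3) n (extChartAt (𝓡 3) p).symm y :=
    ((contMDiffOn_extChartAt_symm (n := ∞) p).contMDiffAt
      ((isOpen_extChartAt_target p).mem_nhds hy)).of_le hn
  have key : ∀ q ∈ (chartAt E3 p).source,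
      (trivializationAt E3 (TangentSpace (𝓡 3)) p ⟨q, w q⟩).2 =
        mfderiv (𝓡 3) 𝓘(ℝ, E3) (extChartAt (𝓡 3) p) q (w q) := by
    intro q hq
    have h4 := congrArg (fun A : TangentSpace (𝓡 3) q →L[ℝ] E3 ↦ A (w q))
      (TangentBundle.continuousLinearMapAt_trivializationAt (I := 𝓡 3) (x₀ := p) hq)
    refine Eq.trans ?_ h4
    have h5 : q ∈ (trivializationAt E3 (TangentSpace (𝓡 3)) p).baseSet := by simpa using hq
    exact (congrFun ((trivializationAt E3 (TangentSpace (𝓡 3)) p).coe_linearMapAt_of_mem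
      (R := ℝ) h5) (w q)).symm
  refine (Bundle.Trivialization.contMDiffAt_section_iff
    (trivializationAt E3 (TangentSpace (𝓡 3)) p) (by simpa using hs')).trans ?_
  constructor
  · intro h
    refine (contMDiffAt_iff_contDiffAt.1 (h.comp y h1)).congr_of_eventuallyEq ?_
    filter_upwards [(isOpen_extChartAt_target p).mem_nhds hy] with z hz
    exact (key _ (by simpa using (extChartAt (𝓡 3) p).map_target hz)).symm
  · intro h
    have h2 : ContMDiffAt (𝓡 3) 𝓘(ℝ, E3) n (extChartAt (𝓡 3) p) ((extChartAt (𝓡 3) p).symm y) :=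
      (contMDiffAt_extChartAt' (n := ∞) (by simpa using hs)).of_le hn
    have h3 : ContMDiffAt 𝓘(ℝ, E3) 𝓘(ℝ, E3) n (fieldRep p w)
        (extChartAt (𝓡 3) p ((extChartAt (𝓡 3) p).symm y)) := by
      rw [(extChartAt (𝓡 3) p).right_inv hy]; exact contMDiffAt_iff_contDiffAt.2 h
    refine (h3.comp _ h2).congr_of_eventuallyEq ?_
    filter_upwards [(isOpen_extChartAt_source p).mem_nhds hs] with q hq
    rw [key q (by simpa using hq)]
    exact (fieldRep_extChartAt hq).symm

theorem mvfderiv_coordField {u : M → ℝ} (hy : y ∈ (extChartAt (𝓡 3) p).target)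
    (hu : MDifferentiableAt (𝓡 3) 𝓘(ℝ) u ((extChartAt (𝓡 3) p).symm y)) :
    mvfderiv (𝓡 3) u ((extChartAt (𝓡 3) p).symm y) (coordField p i ((extChartAt (𝓡 3) p).symm y)) =
      pd i (funRep p u) y := by
  have h1 : MDifferentiableAt 𝓘(ℝ, E3) (𝓡 3) (extChartAt (𝓡 3) p).symm y :=
    ((contMDiffOn_extChartAt_symm (n := ∞) p).contMDiffAt
      ((isOpen_extChartAt_target p).mem_nhds hy)).mdifferentiableAt (by simp)
  rw [← coordField_symm_eq hy, pd]
  refine (mvfderiv_comp_apply y hu h1 _).symm.trans ?_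
  exact congrArg (fun A : E3 →L[ℝ] ℝ ↦ A (EuclideanSpace.single i 1)) mfderiv_eq_fderiv

end coordinates

theorem pd_congr {f g : E3 → ℝ} {y : E3} {i : Fin 3} (h : f =ᶠ[𝓝 y] g) : pd i f y = pd i g y := by
  rw [pd, pd, h.fderiv_eq]

theorem pd_add {f g : E3 → ℝ} {y : E3} {i : Fin 3} (hf : DifferentiableAt ℝ f y)
    (hg : DifferentiableAt ℝ g y) : pd i (fun z ↦ f z + g z) y = pd i f y + pd i g y := by
  simp only [pd]; rw [fderiv_fun_add hf hg]; rfl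

theorem pd_mul {f g : E3 → ℝ} {y : E3} {i : Fin 3} (hf : DifferentiableAt ℝ f y)
    (hg : DifferentiableAt ℝ g y) :
    pd i (fun z ↦ f z * g z) y = f y * pd i g y + g y * pd i f y := by
  simp only [pd]; rw [fderiv_fun_mul hf hg]; rfl

theorem pd_sum {ι : Type*} {s : Finset ι} {f : ι → E3 → ℝ} {y : E3} {i : Fin 3}
    (hf : ∀ a ∈ s, DifferentiableAt ℝ (f a) y) :
    pd i (fun z ↦ ∑ a ∈ s, f a z) y = ∑ a ∈ s, pd i (f a) y := by
  simp only [pd]; rw [fderiv_fun_sum hf]; simp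

theorem contDiffAt_pd {f : E3 → ℝ} {y : E3} {i : Fin 3} {m n : ℕ∞ω} (hf : ContDiffAt ℝ n f y)
    (hmn : m + 1 ≤ n) : ContDiffAt ℝ m (pd i f) y :=
  (hf.fderiv_right hmn).clm_apply contDiffAt_const

section linear

variable {V : Type*} [NormedAddCommGroup V] [InnerProductSpace ℝ V] {ι : Type*} [Fintype ι]

/-- The trace of a bilinear form with respect to the metric can be computed with an orthonormal
basis or with a basis `e` and its dual basis `e'`. -/
theorem sum_orthonormal_eq_sum_dual (f : OrthonormalBasis ι ℝ V) {e e' : Fin 3 → V}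
    (he : ∀ v, v = ∑ k, inner ℝ v (e' k) • e k) {β : V → V → ℝ} (hβ : IsBilinearMap ℝ β) :
    ∑ j, β (f j) (f j) = ∑ k, β (e' k) (e k) := by
  have h1 : ∀ v, β v v = ∑ k, inner ℝ v (e' k) * β v (e k) := fun v ↦ by
    have h2 := congrArg (hβ.toLinearMap v) (he v)
    rw [map_sum] at h2
    simp only [map_smul, smul_eq_mul] at h2
    exact h2
  simp only [h1]
  rw [Finset.sum_comm]
  refine Finset.sum_congr rfl fun k _ ↦ ?_
  have h3 := congrArg (fun v ↦ hβ.toLinearMap v (e k)) (f.sum_repr' (e' k))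
  simp only [map_sum, LinearMap.sum_apply, map_smul, LinearMap.smul_apply, smul_eq_mul] at h3
  exact h3

end linear

section metric

variable {M : Type*} [TopologicalSpace M] [ChartedSpace E3 M] [IsManifold (𝓡 3) ∞ M]
  [RiemannianBundle (fun x : M ↦ TangentSpace (𝓡 3) x)]

variable {p q : M} {y : E3} {i j k l : Fin 3}

theorem gram_apply (hy : y ∈ (extChartAt (𝓡 3) p).target) :
    gram p y i j = inner ℝ (coordField p i ((extChartAt (𝓡 3) p).symm y))
      (coordField p j ((extChartAt (𝓡 3) p).symm y)) := by
  rw [← coordField_symm_eq hy, ← coordField_symm_eq hy, gram]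
  simp only [Matrix.of_apply, EuclideanSpace.basisFun_apply]
  rfl

theorem gram_symm (hy : y ∈ (extChartAt (𝓡 3) p).target) : gram p y i j = gram p y j i := by
  rw [gram_apply hy, gram_apply hy, real_inner_comm]

theorem sum_smul_coordField_eq_zero (hy : y ∈ (extChartAt (𝓡 3) p).target) {x : Fin 3 → ℝ}
    (h : ∑ i, x i • coordField p i ((extChartAt (𝓡 3) p).symm y) = 0) : x = 0 := by
  have hs := (extChartAt (𝓡 3) p).map_target hy
  have h1 := congrArg (mfderiv (𝓡 3) 𝓘(ℝ, E3) (extChartAt (𝓡 3) p)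
    ((extChartAt (𝓡 3) p).symm y)) h
  rw [map_sum, map_zero] at h1
  simp only [map_smul, mfderiv_coordField hs] at h1
  have h2 : ∑ i, x i • (EuclideanSpace.single i 1 : E3) = 0 := h1
  funext i
  have h3 := congrArg (fun v : E3 ↦ v i) h2
  fin_cases i <;> simpa [Fin.sum_univ_three] using h3

theorem gram_posDef (hy : y ∈ (extChartAt (𝓡 3) p).target) : (gram p y).PosDef := by
  refine Matrix.PosDef.of_dotProduct_mulVec_pos ?_ fun x hx ↦ ?_
  · ext i j
    exact gram_symm hy
  · have h : star x ⬝ᵥ (gram p y).mulVec x =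
        inner ℝ (∑ i, x i • coordField p i ((extChartAt (𝓡 3) p).symm y))
          (∑ i, x i • coordField p i ((extChartAt (𝓡 3) p).symm y)) := by
      rw [sum_inner]
      refine Finset.sum_congr rfl fun i _ ↦ ?_
      rw [real_inner_smul_left, inner_sum, Matrix.mulVec]
      simp only [real_inner_smul_right, ← gram_apply hy, dotProduct, star_trivial]
      congr 1
      exact Finset.sum_congr rfl fun j _ ↦ mul_comm _ _
    rw [h]
    exact real_inner_self_pos.2 fun h0 ↦ hx (sum_smul_coordField_eq_zero hy h0)

/-- The inverse metric `g^ij` in the chart at `p`. -/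
def ginv (p : M) (y : E3) : Matrix (Fin 3) (Fin 3) ℝ := (gram p y)⁻¹

theorem ginv_mul_gram (hy : y ∈ (extChartAt (𝓡 3) p).target) : ginv p y * gram p y = 1 :=
  Matrix.nonsing_inv_mul _ (gram_posDef hy).det_pos.ne'.isUnit

theorem ginv_symm (hy : y ∈ (extChartAt (𝓡 3) p).target) : ginv p y i j = ginv p y j i := by
  have h : (gram p y).transpose = gram p y := by ext i j; exact gram_symm hy
  have h2 : (ginv p y).transpose = ginv p y := by
    rw [ginv, Matrix.transpose_nonsing_inv, h]
  exact congrFun (congrFun h2 j) i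

/-- The dual basis of the coordinate vector fields of the chart at `p`, at the point with
coordinates `y`. -/
def dualVec (p : M) (k : Fin 3) (y : E3) : TangentSpace (𝓡 3) ((extChartAt (𝓡 3) p).symm y) :=
  ∑ l, ginv p y k l • coordField p l ((extChartAt (𝓡 3) p).symm y)

theorem inner_coordField_dualVec (hy : y ∈ (extChartAt (𝓡 3) p).target) :
    inner ℝ (coordField p i ((extChartAt (𝓡 3) p).symm y)) (dualVec p k y) =
      if k = i then 1 else 0 := by
  rw [dualVec, inner_sum]
  simp only [real_inner_smul_right]
  have h := congrFun (congrFun (ginv_mul_gram hy) k) i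
  rw [Matrix.mul_apply, Matrix.one_apply] at h
  rw [← h]
  refine Finset.sum_congr rfl fun l _ ↦ ?_
  rw [gram_apply hy, real_inner_comm]

/-- The `k`-th component of a field is its inner product with the `k`-th dual vector. -/
theorem fieldRep_eq_inner (w : Π q : M, TangentSpace (𝓡 3) q)
    (hy : y ∈ (extChartAt (𝓡 3) p).target) :
    fieldRep p w y k = inner ℝ (w ((extChartAt (𝓡 3) p).symm y)) (dualVec p k y) := by
  rw [field_eq_sum w hy, sum_inner]
  simp only [real_inner_smul_left, inner_coordField_dualVec hy, mul_ite, mul_one, mul_zero,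
    Finset.sum_ite_eq, Finset.mem_univ, if_true]

theorem vec_eq_sum (hy : y ∈ (extChartAt (𝓡 3) p).target)
    (v : TangentSpace (𝓡 3) ((extChartAt (𝓡 3) p).symm y)) :
    v = ∑ k, inner ℝ v (dualVec p k y) • coordField p k ((extChartAt (𝓡 3) p).symm y) := by
  classical
  have h := field_eq_sum (p := p) (y := y) (Function.update (fun _ ↦ 0) _ v) hy
  simp only [fieldRep_eq_inner _ hy, Function.update_self] at h
  exact h

variable [IsContMDiffRiemannianBundle (𝓡 3) ∞ E3 (fun x : M ↦ TangentSpace (𝓡 3) x)]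

theorem contMDiffAt_inner {v w : Π q : M, TangentSpace (𝓡 3) q} {n : ℕ∞} (hv : FieldCAt n v q)
    (hw : FieldCAt n w q) : ContMDiffAt (𝓡 3) 𝓘(ℝ) n (fun q ↦ inner ℝ (v q) (w q)) q := by
  have : IsContMDiffRiemannianBundle (𝓡 3) n E3 (fun x : M ↦ TangentSpace (𝓡 3) x) :=
    IsContMDiffRiemannianBundle.of_le (n := ∞) (by exact_mod_cast le_top)
  exact ContMDiffAt.inner_bundle (E := fun x : M ↦ TangentSpace (𝓡 3) x) (F := E3) hv hw

theorem funRep_inner_eqOn : EqOn (funRep p fun q ↦ inner ℝ (coordField p i q) (coordField p j q))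
    (fun y ↦ gram p y i j) (extChartAt (𝓡 3) p).target := fun _ hy ↦ (gram_apply hy).symm

theorem contDiffAt_gram (hy : y ∈ (extChartAt (𝓡 3) p).target) :
    ContDiffAt ℝ ∞ (fun y ↦ gram p y i j) y := by
  have hs := (extChartAt (𝓡 3) p).map_target hy
  have h := (contMDiffAt_funRep_iff (n := ⊤) hy).1
    (contMDiffAt_inner (n := ⊤) (contMDiffAt_coordField (i := i) hs) (contMDiffAt_coordField (i := j) hs))
  exact h.congr_of_eventuallyEq (funRep_inner_eqOn.eventuallyEq_of_mem
    ((isOpen_extChartAt_target p).mem_nhds hy)).symm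

theorem contDiffAt_det_gram (hy : y ∈ (extChartAt (𝓡 3) p).target) :
    ContDiffAt ℝ ∞ (fun y ↦ (gram p y).det) y := by
  have h : ∀ i j, ContDiffAt ℝ ∞ (fun y ↦ gram p y i j) y := fun i j ↦ contDiffAt_gram hy
  simp only [Matrix.det_fin_three]
  fun_prop

theorem contDiffAt_ginv (hy : y ∈ (extChartAt (𝓡 3) p).target) :
    ContDiffAt ℝ ∞ (fun y ↦ ginv p y i j) y := by
  have h : ∀ i j, ContDiffAt ℝ ∞ (fun y ↦ gram p y i j) y := fun i j ↦ contDiffAt_gram hy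
  have hd := contDiffAt_det_gram hy
  have h0 := (gram_posDef hy).det_pos.ne'
  have h1 : (fun y ↦ ginv p y i j) = fun y ↦ (gram p y).det⁻¹ * (gram p y).adjugate i j := by
    funext y
    rw [ginv, Matrix.inv_def, Ring.inverse_eq_inv']; rfl
  rw [h1]
  refine (hd.inv h0).mul ?_
  simp only [Matrix.adjugate_fin_three]
  fin_cases i <;> fin_cases j <;> simp <;> fun_prop

end metric

section connection

variable {M : Type*} [TopologicalSpace M] [ChartedSpace E3 M] [IsManifold (𝓡 3) ∞ M]
  [RiemannianBundle (fun x : M ↦ TangentSpace (𝓡 3) x)]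
  [IsContMDiffRiemannianBundle (𝓡 3) ∞ E3 (fun x : M ↦ TangentSpace (𝓡 3) x)]

variable {p q x : M} {y : E3} {i j k l a b c : Fin 3}

theorem FieldCAt.fieldDAt {w : Π q : M, TangentSpace (𝓡 3) q} (h : FieldCAt 1 w x) : FieldDAt w x :=
  h.mdifferentiableAt one_ne_zero

theorem fieldDAt_coordField (hq : q ∈ (extChartAt (𝓡 3) p).source) : FieldDAt (coordField p i) q :=
  (contMDiffAt_coordField hq).mdifferentiableAt (by simp)

theorem target_mem_nhds (hy : y ∈ (extChartAt (𝓡 3) p).target) :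
    (extChartAt (𝓡 3) p).target ∈ 𝓝 y := (isOpen_extChartAt_target p).mem_nhds hy

theorem inner_nabla_coordField (hy : y ∈ (extChartAt (𝓡 3) p).target) :
    inner ℝ (nabla (coordField p j) ((extChartAt (𝓡 3) p).symm y)
      (coordField p i ((extChartAt (𝓡 3) p).symm y))) (coordField p l ((extChartAt (𝓡 3) p).symm y)) =
      1 / 2 * (pd i (fun z ↦ gram p z j l) y + pd j (fun z ↦ gram p z i l) y
        - pd l (fun z ↦ gram p z i j) y) := by
  have hs := (extChartAt (𝓡 3) p).map_target hy
  have key : ∀ i j l, mvfderiv (𝓡 3) (fun q ↦ inner ℝ (coordField p j q) (coordField p l q))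
      ((extChartAt (𝓡 3) p).symm y) (coordField p i ((extChartAt (𝓡 3) p).symm y)) =
      pd i (fun z ↦ gram p z j l) y := fun i j l ↦ by
    rw [mvfderiv_coordField hy (mdiff_inner (fieldDAt_coordField hs) (fieldDAt_coordField hs))]
    exact pd_congr (funRep_inner_eqOn.eventuallyEq_of_mem (target_mem_nhds hy))
  have h := inner_leviCivitaFun (fieldDAt_coordField (i := i) hs) (fieldDAt_coordField (i := j) hs)
    (fieldDAt_coordField (i := l) hs)
  refine h.trans ?_
  rw [koszul, key, key, key, mlieBracket_coordField hs, mlieBracket_coordField hs,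
    mlieBracket_coordField hs, inner_zero_left, inner_zero_left, inner_zero_left]
  ring

/-- The Christoffel symbols `Γ^k_ij` of the chart at `p`. -/
def christoffel (p : M) (i j k : Fin 3) (y : E3) : ℝ :=
  inner ℝ (nabla (coordField p j) ((extChartAt (𝓡 3) p).symm y)
    (coordField p i ((extChartAt (𝓡 3) p).symm y))) (dualVec p k y)

theorem christoffel_eq (hy : y ∈ (extChartAt (𝓡 3) p).target) :
    christoffel p i j k y = ∑ l, ginv p y k l * (1 / 2 * (pd i (fun z ↦ gram p z j l) y
      + pd j (fun z ↦ gram p z i l) y - pd l (fun z ↦ gram p z i j) y)) := by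
  rw [christoffel, dualVec, inner_sum]
  simp only [real_inner_smul_right, inner_nabla_coordField hy]

theorem contDiffAt_christoffel (hy : y ∈ (extChartAt (𝓡 3) p).target) :
    ContDiffAt ℝ ∞ (christoffel p i j k) y := by
  have h : ∀ i j l, ContDiffAt ℝ ∞ (pd i fun z ↦ gram p z j l) y := fun i j l ↦
    contDiffAt_pd (contDiffAt_gram hy) (by simp)
  have h' : ∀ k l, ContDiffAt ℝ ∞ (fun z ↦ ginv p z k l) y := fun k l ↦ contDiffAt_ginv hy
  have h2 : ContDiffAt ℝ ∞ (fun y ↦ ∑ l, ginv p y k l * (1 / 2 * (pd i (fun z ↦ gram p z j l) y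
      + pd j (fun z ↦ gram p z i l) y - pd l (fun z ↦ gram p z i j) y))) y :=
    ContDiffAt.sum fun l _ ↦ (h' k l).mul
      (contDiffAt_const.mul (((h i j l).add (h j i l)).sub (h l i j)))
  refine h2.congr_of_eventuallyEq ?_
  filter_upwards [target_mem_nhds hy] with z hz using christoffel_eq hz

theorem nabla_coordField_eq (hy : y ∈ (extChartAt (𝓡 3) p).target) :
    nabla (coordField p j) ((extChartAt (𝓡 3) p).symm y)
      (coordField p i ((extChartAt (𝓡 3) p).symm y)) =
      ∑ k, christoffel p i j k y • coordField p k ((extChartAt (𝓡 3) p).symm y) :=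
  vec_eq_sum hy _

theorem contDiffAt_fieldRep {w : Π q : M, TangentSpace (𝓡 3) q} {n : ℕ∞}
    (hy : y ∈ (extChartAt (𝓡 3) p).target) (hw : FieldCAt n w ((extChartAt (𝓡 3) p).symm y)) :
    ContDiffAt ℝ n (fun z ↦ fieldRep p w z i) y :=
  contDiffAt_euclidean.1 ((contMDiffAt_fieldRep_iff hy).1 hw) i

theorem leviCivita_sum {w : Fin 3 → Π q : M, TangentSpace (𝓡 3) q} (hw : ∀ i, FieldDAt (w i) x)
    (v : TangentSpace (𝓡 3) x) :
    nabla (fun q ↦ ∑ i, w i q) x v = ∑ i, nabla (w i) x v := by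
  have h1 : (fun q ↦ ∑ i, w i q) = w 0 + w 1 + w 2 := by
    funext q; simp [Fin.sum_univ_three]
  have hlc := (leviCivita (𝓡 3) M).isCovariantDerivativeOnUniv
  rw [h1, Fin.sum_univ_three]
  have h2 := hlc.add (mdifferentiableAt_add_section (hw 0) (hw 1)) (hw 2) (mem_univ x)
  have h3 := hlc.add (hw 0) (hw 1) (mem_univ x)
  rw [h3] at h2
  exact congrArg (fun A ↦ A v) h2

theorem nabla_smul {w : Π q : M, TangentSpace (𝓡 3) q} {u : M → ℝ} (hw : FieldDAt w x)
    (hu : MDifferentiableAt (𝓡 3) 𝓘(ℝ) u x) (v : TangentSpace (𝓡 3) x) :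
    nabla (fun q ↦ u q • w q) x v = u x • nabla w x v + mvfderiv (𝓡 3) u x v • w x := by
  have h := (leviCivita (𝓡 3) M).isCovariantDerivativeOnUniv.leibniz hw hu (mem_univ x)
  exact congrArg (fun A ↦ A v) h

theorem mdifferentiableAt_coord {w : Π q : M, TangentSpace (𝓡 3) q}
    (hy : y ∈ (extChartAt (𝓡 3) p).target) (hw : FieldCAt 1 w ((extChartAt (𝓡 3) p).symm y)) :
    MDifferentiableAt (𝓡 3) 𝓘(ℝ) (fun q ↦ fieldRep p w (extChartAt (𝓡 3) p q) i)
      ((extChartAt (𝓡 3) p).symm y) ∧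
    (funRep p fun q ↦ fieldRep p w (extChartAt (𝓡 3) p q) i) =ᶠ[𝓝 y] fun z ↦ fieldRep p w z i := by
  have h : (funRep p fun q ↦ fieldRep p w (extChartAt (𝓡 3) p q) i) =ᶠ[𝓝 y]
      fun z ↦ fieldRep p w z i := by
    filter_upwards [target_mem_nhds hy] with z hz
    exact congrArg (fun z ↦ fieldRep p w z i) ((extChartAt (𝓡 3) p).right_inv hz)
  refine ⟨?_, h⟩
  refine ContMDiffAt.mdifferentiableAt (n := 1) ?_ one_ne_zero
  exact (contMDiffAt_funRep_iff (n := 1) hy).2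
    ((contDiffAt_fieldRep hy hw).congr_of_eventuallyEq h)

/-- The components `(D_i w)^k` in the chart at `p`. -/
def nablaRep (p : M) (w : Π q : M, TangentSpace (𝓡 3) q) (i k : Fin 3) (y : E3) : ℝ :=
  pd i (fun z ↦ fieldRep p w z k) y + ∑ j, fieldRep p w y j * christoffel p i j k y

theorem nabla_eq_sum {w : Π q : M, TangentSpace (𝓡 3) q}
    (hy : y ∈ (extChartAt (𝓡 3) p).target) (hw : FieldCAt 1 w ((extChartAt (𝓡 3) p).symm y)) :
    nabla w ((extChartAt (𝓡 3) p).symm y) (coordField p i ((extChartAt (𝓡 3) p).symm y)) =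
      ∑ k, nablaRep p w i k y • coordField p k ((extChartAt (𝓡 3) p).symm y) := by
  have hs := (extChartAt (𝓡 3) p).map_target hy
  have hd : ∀ j, FieldDAt
      (fun q ↦ fieldRep p w (extChartAt (𝓡 3) p q) j • coordField p j q)
      ((extChartAt (𝓡 3) p).symm y) := fun j ↦
    (mdifferentiableAt_coord hy hw).1.smul_section (fieldDAt_coordField hs)
  have hev : ∀ᶠ q in 𝓝 ((extChartAt (𝓡 3) p).symm y), w q =
      ∑ j, fieldRep p w (extChartAt (𝓡 3) p q) j • coordField p j q := by
    filter_upwards [(isOpen_extChartAt_source p).mem_nhds hs] with q hq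
    have h := field_eq_sum w ((extChartAt (𝓡 3) p).map_source hq)
    rwa [(extChartAt (𝓡 3) p).left_inv hq] at h
  have hsum : FieldDAt (fun q ↦ ∑ j, fieldRep p w (extChartAt (𝓡 3) p q) j • coordField p j q)
      ((extChartAt (𝓡 3) p).symm y) :=
    hw.fieldDAt.congr_of_eventuallyEq (by
      filter_upwards [hev] with q hq
      rw [hq])
  have h1 : nabla w ((extChartAt (𝓡 3) p).symm y) =
      nabla (fun q ↦ ∑ j, fieldRep p w (extChartAt (𝓡 3) p q) j • coordField p j q)
        ((extChartAt (𝓡 3) p).symm y) :=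
    (leviCivita (𝓡 3) M).isCovariantDerivativeOnUniv.congr_of_eventuallyEq hw.fieldDAt hsum
      univ_mem hev
  rw [h1, leviCivita_sum hd]
  have h2 : ∀ j, nabla (fun q ↦ fieldRep p w (extChartAt (𝓡 3) p q) j • coordField p j q)
      ((extChartAt (𝓡 3) p).symm y) (coordField p i ((extChartAt (𝓡 3) p).symm y)) =
      fieldRep p w y j • ∑ k, christoffel p i j k y • coordField p k ((extChartAt (𝓡 3) p).symm y)
        + pd i (fun z ↦ fieldRep p w z j) y • coordField p j ((extChartAt (𝓡 3) p).symm y) := by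
    intro j
    have hj := mdifferentiableAt_coord (i := j) hy hw
    rw [nabla_smul (fieldDAt_coordField hs) hj.1, mvfderiv_coordField hy hj.1, pd_congr hj.2,
      nabla_coordField_eq hy, (extChartAt (𝓡 3) p).right_inv hy]
  simp only [h2, nablaRep, add_smul, Finset.sum_add_distrib, Finset.smul_sum, smul_smul,
    Finset.sum_smul]
  rw [add_comm, Finset.sum_comm]

theorem inner_nabla_dualVec {w : Π q : M, TangentSpace (𝓡 3) q}
    (hy : y ∈ (extChartAt (𝓡 3) p).target) (hw : FieldCAt 1 w ((extChartAt (𝓡 3) p).symm y)) :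
    inner ℝ (nabla w ((extChartAt (𝓡 3) p).symm y)
      (coordField p i ((extChartAt (𝓡 3) p).symm y))) (dualVec p k y) = nablaRep p w i k y := by
  rw [nabla_eq_sum hy hw, sum_inner]
  simp only [real_inner_smul_left, inner_coordField_dualVec hy, mul_ite, mul_one, mul_zero,
    Finset.sum_ite_eq, Finset.mem_univ, if_true]

theorem sum_frame_eq (hy : y ∈ (extChartAt (𝓡 3) p).target)
    {β : TangentSpace (𝓡 3) ((extChartAt (𝓡 3) p).symm y) →
      TangentSpace (𝓡 3) ((extChartAt (𝓡 3) p).symm y) → ℝ} (hβ : IsBilinearMap ℝ β) :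
    ∑ j, β (frame (𝓡 3) _ j) (frame (𝓡 3) _ j) =
      ∑ k, β (dualVec p k y) (coordField p k ((extChartAt (𝓡 3) p).symm y)) :=
  sum_orthonormal_eq_sum_dual _ (vec_eq_sum hy) hβ

theorem divergence_eq_frame (w : Π q : M, TangentSpace (𝓡 3) q) :
    divergence w x = ∑ j, inner ℝ (frame (𝓡 3) x j) (nabla w x (frame (𝓡 3) x j)) :=
  LinearMap.trace_eq_sum_inner _ (frame (𝓡 3) x)

theorem divergence_eq {w : Π q : M, TangentSpace (𝓡 3) q}
    (hy : y ∈ (extChartAt (𝓡 3) p).target) (hw : FieldCAt 1 w ((extChartAt (𝓡 3) p).symm y)) :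
    divergence w ((extChartAt (𝓡 3) p).symm y) = ∑ k, nablaRep p w k k y := by
  rw [divergence_eq_frame, sum_frame_eq hy
    (β := fun a b ↦ inner ℝ a (nabla w ((extChartAt (𝓡 3) p).symm y) b))]
  · refine Finset.sum_congr rfl fun k _ ↦ ?_
    rw [real_inner_comm, inner_nabla_dualVec hy hw]
  · constructor <;> intros <;>
      simp only [map_add, map_smul, inner_add_left, inner_add_right, real_inner_smul_left,
        real_inner_smul_right, smul_eq_mul]

theorem inner_grad (u : M → ℝ) (v : TangentSpace (𝓡 3) x) :
    inner ℝ (grad (𝓡 3) u x) v = mvfderiv (𝓡 3) u x v := by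
  rw [grad, InnerProductSpace.toDual_symm_apply]

theorem fieldRep_grad {u : M → ℝ} (hy : y ∈ (extChartAt (𝓡 3) p).target)
    (hu : MDifferentiableAt (𝓡 3) 𝓘(ℝ) u ((extChartAt (𝓡 3) p).symm y)) :
    fieldRep p (grad (𝓡 3) u) y k = ∑ l, ginv p y k l * pd l (funRep p u) y := by
  rw [fieldRep_eq_inner _ hy, inner_grad, dualVec, map_sum]
  simp only [map_smul, smul_eq_mul, mvfderiv_coordField hy hu]

end connection

section tensors

variable {M : Type*} [TopologicalSpace M] [ChartedSpace E3 M] [IsManifold (𝓡 3) ∞ M]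
  [RiemannianBundle (fun x : M ↦ TangentSpace (𝓡 3) x)]
  [IsContMDiffRiemannianBundle (𝓡 3) ∞ E3 (fun x : M ↦ TangentSpace (𝓡 3) x)]

variable {p q x : M} {y : E3} {i j k l a b c : Fin 3} {S T : Tensor2 (𝓡 3) M}

/-- The components `S_ab` in the chart at `p`. -/
def tensorRep (p : M) (S : Tensor2 (𝓡 3) M) (a b : Fin 3) (y : E3) : ℝ :=
  S ((extChartAt (𝓡 3) p).symm y) (coordField p a ((extChartAt (𝓡 3) p).symm y))
    (coordField p b ((extChartAt (𝓡 3) p).symm y))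

theorem tensor_apply_eq (hy : y ∈ (extChartAt (𝓡 3) p).target)
    (v w : TangentSpace (𝓡 3) ((extChartAt (𝓡 3) p).symm y)) :
    S ((extChartAt (𝓡 3) p).symm y) v w = ∑ a, ∑ b, inner ℝ v (dualVec p a y) *
      inner ℝ w (dualVec p b y) * tensorRep p S a b y := by
  conv_lhs => rw [vec_eq_sum hy v, vec_eq_sum hy w]
  simp only [map_sum, map_smul, sum_apply, smul_apply, smul_eq_mul, tensorRep, Finset.mul_sum]
  rw [Finset.sum_comm]
  refine Finset.sum_congr rfl fun a _ ↦ Finset.sum_congr rfl fun b _ ↦ ?_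
  ring

theorem inner_dualVec_dualVec (hy : y ∈ (extChartAt (𝓡 3) p).target) :
    inner ℝ (dualVec p k y) (dualVec p l y) = ginv p y k l := by
  conv_lhs => rw [dualVec]
  rw [sum_inner]
  simp only [real_inner_smul_left, inner_coordField_dualVec hy, mul_ite, mul_one, mul_zero,
    Finset.sum_ite_eq, Finset.mem_univ, if_true]

/-- The components of the covariant derivative `D_c S_ab` in the chart at `p`. -/
def covRep (p : M) (S : Tensor2 (𝓡 3) M) (c a b : Fin 3) (y : E3) : ℝ :=
  pd c (tensorRep p S a b) y - ∑ k, christoffel p c a k y * tensorRep p S k b y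
    - ∑ k, christoffel p c b k y * tensorRep p S a k y

/-- The function `S(A, B)` in coordinates. -/
theorem funRep_tensor_apply (A B : Π q : M, TangentSpace (𝓡 3) q) :
    EqOn (funRep p fun q ↦ S q (A q) (B q))
      (fun z ↦ ∑ a, ∑ b, fieldRep p A z a * fieldRep p B z b * tensorRep p S a b z)
      (extChartAt (𝓡 3) p).target := by
  intro z hz
  refine (tensor_apply_eq hz _ _).trans ?_
  simp only [fieldRep_eq_inner _ hz]

theorem contMDiffAt_tensor_apply {A B : Π q : M, TangentSpace (𝓡 3) q} {n : ℕ∞}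
    (hy : y ∈ (extChartAt (𝓡 3) p).target) (hS : ∀ a b, ContDiffAt ℝ n (tensorRep p S a b) y)
    (hA : FieldCAt n A ((extChartAt (𝓡 3) p).symm y))
    (hB : FieldCAt n B ((extChartAt (𝓡 3) p).symm y)) :
    ContMDiffAt (𝓡 3) 𝓘(ℝ) n (fun q ↦ S q (A q) (B q)) ((extChartAt (𝓡 3) p).symm y) := by
  refine (contMDiffAt_funRep_iff hy).2 (ContDiffAt.congr_of_eventuallyEq ?_
    ((funRep_tensor_apply A B).eventuallyEq_of_mem (target_mem_nhds hy)))
  exact ContDiffAt.sum fun a _ ↦ ContDiffAt.sum fun b _ ↦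
    ((contDiffAt_fieldRep hy hA).mul (contDiffAt_fieldRep hy hB)).mul (hS a b)

/-- The Leibniz rule for `S(A, B)`. -/
theorem mvfderiv_tensor_apply {A B : Π q : M, TangentSpace (𝓡 3) q}
    (hy : y ∈ (extChartAt (𝓡 3) p).target) (hS : ∀ a b, ContDiffAt ℝ 1 (tensorRep p S a b) y)
    (hA : FieldCAt 1 A ((extChartAt (𝓡 3) p).symm y))
    (hB : FieldCAt 1 B ((extChartAt (𝓡 3) p).symm y)) :
    mvfderiv (𝓡 3) (fun q ↦ S q (A q) (B q)) ((extChartAt (𝓡 3) p).symm y)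
        (coordField p c ((extChartAt (𝓡 3) p).symm y)) =
      (∑ a, ∑ b, fieldRep p A y a * fieldRep p B y b * covRep p S c a b y) +
      S ((extChartAt (𝓡 3) p).symm y) (nabla A ((extChartAt (𝓡 3) p).symm y)
        (coordField p c ((extChartAt (𝓡 3) p).symm y))) (B ((extChartAt (𝓡 3) p).symm y)) +
      S ((extChartAt (𝓡 3) p).symm y) (A ((extChartAt (𝓡 3) p).symm y))
        (nabla B ((extChartAt (𝓡 3) p).symm y)
          (coordField p c ((extChartAt (𝓡 3) p).symm y))) := by
  have hA' : ∀ a, DifferentiableAt ℝ (fun z ↦ fieldRep p A z a) y := fun a ↦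
    (contDiffAt_fieldRep (n := 1) hy hA).differentiableAt one_ne_zero
  have hB' : ∀ b, DifferentiableAt ℝ (fun z ↦ fieldRep p B z b) y := fun b ↦
    (contDiffAt_fieldRep (n := 1) hy hB).differentiableAt one_ne_zero
  have hS' : ∀ a b, DifferentiableAt ℝ (tensorRep p S a b) y := fun a b ↦
    (hS a b).differentiableAt one_ne_zero
  have hP : ∀ a b, DifferentiableAt ℝ
      (fun z ↦ fieldRep p A z a * fieldRep p B z b * tensorRep p S a b z) y := fun a b ↦
    ((hA' a).mul (hB' b)).mul (hS' a b)
  rw [mvfderiv_coordField hy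
    ((contMDiffAt_tensor_apply (n := 1) hy hS hA hB).mdifferentiableAt one_ne_zero),
    pd_congr ((funRep_tensor_apply A B).eventuallyEq_of_mem (target_mem_nhds hy)),
    pd_sum fun a _ ↦ DifferentiableAt.fun_sum fun b _ ↦ hP a b]
  have h1 : ∀ a, pd c (fun z ↦ ∑ b, fieldRep p A z a * fieldRep p B z b * tensorRep p S a b z) y =
      ∑ b, (fieldRep p A y a * fieldRep p B y b * pd c (tensorRep p S a b) y +
        tensorRep p S a b y * (fieldRep p A y a * pd c (fun z ↦ fieldRep p B z b) y +
          fieldRep p B y b * pd c (fun z ↦ fieldRep p A z a) y)) := by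
    intro a
    rw [pd_sum fun b _ ↦ hP a b]
    refine Finset.sum_congr rfl fun b _ ↦ ?_
    rw [pd_mul (f := fun z ↦ fieldRep p A z a * fieldRep p B z b) ((hA' a).mul (hB' b)) (hS' a b),
      pd_mul (hA' a) (hB' b)]
  simp only [h1]
  simp only [tensor_apply_eq hy (nabla A _ _), tensor_apply_eq hy (A _),
    inner_nabla_dualVec hy hA, inner_nabla_dualVec hy hB, ← fieldRep_eq_inner _ hy, nablaRep,
    covRep, Fin.sum_univ_three]
  ring

theorem nablaTensor_coord (hy : y ∈ (extChartAt (𝓡 3) p).target)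
    (hS : ∀ a b, ContDiffAt ℝ 1 (tensorRep p S a b) y)
    (z v w : TangentSpace (𝓡 3) ((extChartAt (𝓡 3) p).symm y)) :
    nablaTensor S ((extChartAt (𝓡 3) p).symm y) z v w = ∑ c, ∑ a, ∑ b,
      inner ℝ z (dualVec p c y) * inner ℝ v (dualVec p a y) * inner ℝ w (dualVec p b y) *
        covRep p S c a b y := by
  have hv : FieldCAt 1 (localExt v) ((extChartAt (𝓡 3) p).symm y) := contMDiffAt_extend _ _ v
  have hw : FieldCAt 1 (localExt w) ((extChartAt (𝓡 3) p).symm y) := contMDiffAt_extend _ _ w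
  have hv' : ∀ a, fieldRep p (localExt v) y a = inner ℝ v (dualVec p a y) := fun a ↦ by
    rw [fieldRep_eq_inner _ hy, localExt, extend_apply_self]
  have hw' : ∀ a, fieldRep p (localExt w) y a = inner ℝ w (dualVec p a y) := fun a ↦ by
    rw [fieldRep_eq_inner _ hy, localExt, extend_apply_self]
  have ev : localExt v ((extChartAt (𝓡 3) p).symm y) = v := extend_apply_self _ _
  have ew : localExt w ((extChartAt (𝓡 3) p).symm y) = w := extend_apply_self _ _
  have h1 : ∀ c, nablaTensor S ((extChartAt (𝓡 3) p).symm y)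
      (coordField p c ((extChartAt (𝓡 3) p).symm y)) v w = ∑ a, ∑ b,
      inner ℝ v (dualVec p a y) * inner ℝ w (dualVec p b y) * covRep p S c a b y := fun c ↦ by
    have h := mvfderiv_tensor_apply (c := c) hy hS hv hw
    rw [nablaTensor]
    refine (congrArg (fun t ↦ t - _ - _) h).trans ?_
    simp only [hv', hw', ev, ew]
    ring
  have h2 : nablaTensor S ((extChartAt (𝓡 3) p).symm y) z v w = ∑ c, inner ℝ z (dualVec p c y) *
      nablaTensor S ((extChartAt (𝓡 3) p).symm y)
        (coordField p c ((extChartAt (𝓡 3) p).symm y)) v w := by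
    conv_lhs => rw [vec_eq_sum hy z]
    simp only [nablaTensor, map_sum, map_smul, sum_apply, smul_apply, smul_eq_mul, mul_sub,
      Finset.sum_sub_distrib]
  rw [h2]
  simp only [h1, Finset.mul_sum, mul_assoc]

theorem inner_tensorDivergence (v : TangentSpace (𝓡 3) x)
    (hlin : ∀ z w, IsLinearMap ℝ fun v ↦ nablaTensor S x z v w) :
    inner ℝ (tensorDivergence S x) v =
      ∑ j, nablaTensor S x (frame (𝓡 3) x j) v (frame (𝓡 3) x j) := by
  rw [tensorDivergence, sum_inner]
  simp only [real_inner_smul_left, Finset.sum_mul]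
  rw [Finset.sum_comm]
  refine Finset.sum_congr rfl fun j _ ↦ ?_
  have h := congrArg ((hlin (frame (𝓡 3) x j) (frame (𝓡 3) x j)).mk') ((frame (𝓡 3) x).sum_repr' v)
  rw [map_sum] at h
  simp only [map_smul, IsLinearMap.mk'_apply, smul_eq_mul] at h
  rw [← h]
  exact Finset.sum_congr rfl fun i _ ↦ mul_comm _ _

theorem isLinearMap_nablaTensor (hy : y ∈ (extChartAt (𝓡 3) p).target)
    (hS : ∀ a b, ContDiffAt ℝ 1 (tensorRep p S a b) y)
    (z w : TangentSpace (𝓡 3) ((extChartAt (𝓡 3) p).symm y)) :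
    IsLinearMap ℝ fun v ↦ nablaTensor S ((extChartAt (𝓡 3) p).symm y) z v w := by
  constructor <;> intros <;>
    simp only [nablaTensor_coord hy hS, inner_add_left, real_inner_smul_left, smul_eq_mul,
      Fin.sum_univ_three] <;> ring

theorem inner_tensorDivergence_coord (hy : y ∈ (extChartAt (𝓡 3) p).target)
    (hS : ∀ a b, ContDiffAt ℝ 1 (tensorRep p S a b) y)
    (v : TangentSpace (𝓡 3) ((extChartAt (𝓡 3) p).symm y)) :
    inner ℝ (tensorDivergence S ((extChartAt (𝓡 3) p).symm y)) v =
      ∑ a, inner ℝ v (dualVec p a y) * ∑ c, ∑ b, ginv p y b c * covRep p S c a b y := by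
  have hbil : IsBilinearMap ℝ fun z w ↦ nablaTensor S ((extChartAt (𝓡 3) p).symm y) z v w := by
    constructor <;> intros <;>
      simp only [nablaTensor_coord hy hS, inner_add_left, real_inner_smul_left, smul_eq_mul,
        Fin.sum_univ_three] <;> ring
  rw [inner_tensorDivergence v (isLinearMap_nablaTensor hy hS), sum_frame_eq hy hbil]
  have hd : ∀ k c, inner ℝ (dualVec p k y) (dualVec p c y) = ginv p y k c := fun k c ↦ inner_dualVec_dualVec hy
  simp only [nablaTensor_coord hy hS, hd, inner_coordField_dualVec hy, Fin.sum_univ_three]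
  simp
  ring

/-- The components of `tensorDivergence S` in the chart at `p`. -/
theorem fieldRep_tensorDivergence (hy : y ∈ (extChartAt (𝓡 3) p).target)
    (hS : ∀ a b, ContDiffAt ℝ 1 (tensorRep p S a b) y) :
    fieldRep p (tensorDivergence S) y k =
      ∑ a, ginv p y k a * ∑ c, ∑ b, ginv p y b c * covRep p S c a b y := by
  rw [fieldRep_eq_inner _ hy, inner_tensorDivergence_coord hy hS]
  refine Finset.sum_congr rfl fun a _ ↦ ?_
  congr 1
  exact inner_dualVec_dualVec hy

theorem contract_eq (hy : y ∈ (extChartAt (𝓡 3) p).target) :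
    contract S T ((extChartAt (𝓡 3) p).symm y) = ∑ a, ∑ b, ∑ c, ∑ d, ginv p y a c * ginv p y b d *
      (tensorRep p S a b y * tensorRep p T c d y) := by
  have h1 : ∀ i, ∑ j, S ((extChartAt (𝓡 3) p).symm y) (frame (𝓡 3) _ i) (frame (𝓡 3) _ j) *
      T ((extChartAt (𝓡 3) p).symm y) (frame (𝓡 3) _ i) (frame (𝓡 3) _ j) =
      ∑ k, S ((extChartAt (𝓡 3) p).symm y) (frame (𝓡 3) _ i) (dualVec p k y) *
        T ((extChartAt (𝓡 3) p).symm y) (frame (𝓡 3) _ i)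
          (coordField p k ((extChartAt (𝓡 3) p).symm y)) := fun i ↦
    sum_frame_eq hy (β := fun v w ↦ S ((extChartAt (𝓡 3) p).symm y) (frame (𝓡 3) _ i) v *
      T ((extChartAt (𝓡 3) p).symm y) (frame (𝓡 3) _ i) w) (by
        constructor <;> intros <;> simp only [map_add, map_smul, smul_eq_mul] <;> ring)
  rw [contract]
  simp only [h1]
  rw [Finset.sum_comm]
  have h2 : ∀ k, ∑ i, S ((extChartAt (𝓡 3) p).symm y) (frame (𝓡 3) _ i) (dualVec p k y) *
        T ((extChartAt (𝓡 3) p).symm y) (frame (𝓡 3) _ i)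
          (coordField p k ((extChartAt (𝓡 3) p).symm y)) =
      ∑ l, S ((extChartAt (𝓡 3) p).symm y) (dualVec p l y) (dualVec p k y) *
        T ((extChartAt (𝓡 3) p).symm y) (coordField p l ((extChartAt (𝓡 3) p).symm y))
          (coordField p k ((extChartAt (𝓡 3) p).symm y)) := fun k ↦
    sum_frame_eq hy (β := fun v w ↦ S ((extChartAt (𝓡 3) p).symm y) v (dualVec p k y) *
      T ((extChartAt (𝓡 3) p).symm y) w (coordField p k ((extChartAt (𝓡 3) p).symm y))) (by
        constructor <;> intros <;>
          simp only [map_add, map_smul, smul_eq_mul, add_apply, smul_apply] <;> ring)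
  simp only [h2]
  have h3 : ∀ l k, S ((extChartAt (𝓡 3) p).symm y) (dualVec p l y) (dualVec p k y) =
      ∑ a, ∑ b, ginv p y l a * ginv p y k b * tensorRep p S a b y := fun l k ↦ by
    simp only [dualVec, map_add, map_smul, add_apply, smul_apply, smul_eq_mul, tensorRep,
      Fin.sum_univ_three]
    ring
  simp only [h3]
  have h4 : ∀ l k, T ((extChartAt (𝓡 3) p).symm y) (coordField p l ((extChartAt (𝓡 3) p).symm y))
          (coordField p k ((extChartAt (𝓡 3) p).symm y)) = tensorRep p T l k y := fun _ _ ↦ rfl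
  have h5 : ∀ i j, ginv p y i j = ginv p y j i := fun i j ↦ ginv_symm hy
  simp only [h4, Finset.sum_mul]
  rw [Finset.sum_comm' (t' := Finset.univ) (s' := fun _ ↦ Finset.univ) (by simp)]
  calc _ = ∑ l, ∑ a, ∑ k, ∑ b, ginv p y l a * ginv p y k b * tensorRep p S a b y *
        tensorRep p T l k y := Finset.sum_congr rfl fun l _ ↦ Finset.sum_comm
    _ = ∑ a, ∑ l, ∑ k, ∑ b, ginv p y l a * ginv p y k b * tensorRep p S a b y *
        tensorRep p T l k y := Finset.sum_comm
    _ = ∑ a, ∑ l, ∑ b, ∑ k, ginv p y l a * ginv p y k b * tensorRep p S a b y *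
        tensorRep p T l k y :=
      Finset.sum_congr rfl fun _ _ ↦ Finset.sum_congr rfl fun _ _ ↦ Finset.sum_comm
    _ = ∑ a, ∑ b, ∑ l, ∑ k, ginv p y l a * ginv p y k b * tensorRep p S a b y *
        tensorRep p T l k y := Finset.sum_congr rfl fun _ _ ↦ Finset.sum_comm
    _ = _ := by
      refine Finset.sum_congr rfl fun a _ ↦ Finset.sum_congr rfl fun b _ ↦
        Finset.sum_congr rfl fun l _ ↦ Finset.sum_congr rfl fun k _ ↦ ?_
      rw [h5 l a, h5 k b]; ring

theorem tensorRep_conformalKilling {w : Π q : M, TangentSpace (𝓡 3) q}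
    (hy : y ∈ (extChartAt (𝓡 3) p).target) (hw : FieldCAt 1 w ((extChartAt (𝓡 3) p).symm y)) :
    tensorRep p (conformalKilling w) a b y = (∑ k, nablaRep p w a k y * gram p y k b)
      + (∑ k, nablaRep p w b k y * gram p y k a)
      - 2 / 3 * (∑ k, nablaRep p w k k y) * gram p y a b := by
  rw [tensorRep, conformalKilling_apply, nabla_eq_sum hy hw, nabla_eq_sum hy hw,
    divergence_eq hy hw, ← gram_apply hy, sum_inner, sum_inner]
  simp only [real_inner_smul_left, ← gram_apply hy]

end tensors

section identities

variable {M : Type*} [TopologicalSpace M] [ChartedSpace E3 M] [IsManifold (𝓡 3) ∞ M]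
  [RiemannianBundle (fun x : M ↦ TangentSpace (𝓡 3) x)]
  [IsContMDiffRiemannianBundle (𝓡 3) ∞ E3 (fun x : M ↦ TangentSpace (𝓡 3) x)]

variable {p q x : M} {y : E3} {i j k l a b c : Fin 3} {S T : Tensor2 (𝓡 3) M}
  {w : Π q : M, TangentSpace (𝓡 3) q} {u v : M → ℝ}

theorem exists_chart_point (x : M) :
    ∃ p : M, ∃ y ∈ (extChartAt (𝓡 3) p).target, (extChartAt (𝓡 3) p).symm y = x :=
  ⟨x, _, mem_extChartAt_target x, extChartAt_to_inv x⟩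

/-- The tensor field `S` has components of class `C^n` in all charts. -/
def HasCompC (n : ℕ∞) (S : Tensor2 (𝓡 3) M) : Prop :=
  ∀ p : M, ∀ y ∈ (extChartAt (𝓡 3) p).target, ∀ a b, ContDiffAt ℝ n (tensorRep p S a b) y

theorem Tensor2.IsContMDiff.hasCompC {n : ℕ∞} (hS : S.IsContMDiff n) : HasCompC n S := by
  intro p y hy a b
  have hs := (extChartAt (𝓡 3) p).map_target hy
  have hn : (n : ℕ∞ω) ≤ (∞ : ℕ∞ω) := by exact_mod_cast le_top
  have h : ContMDiffAt (𝓡 3) ((𝓡 3).prod 𝓘(ℝ, ℝ)) n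
      (fun q ↦ TotalSpace.mk' ℝ (E := Bundle.Trivial M ℝ) q
        (S q (coordField p a q) (coordField p b q))) ((extChartAt (𝓡 3) p).symm y) :=
    ContMDiffAt.clm_bundle_apply₂ (E₃ := Bundle.Trivial M ℝ) (hS _)
      ((contMDiffAt_coordField hs).of_le hn) ((contMDiffAt_coordField hs).of_le hn)
  have h2 := (contMDiffAt_section (F := ℝ) (E := Bundle.Trivial M ℝ) _).1 h
  exact (contMDiffAt_funRep_iff (u := fun q ↦ S q (coordField p a q) (coordField p b q)) hy).1 h2

theorem contDiffAt_nablaRep {n : ℕ∞} (hy : y ∈ (extChartAt (𝓡 3) p).target)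
    (hw : FieldCAt (n + 1 : ℕ∞) w ((extChartAt (𝓡 3) p).symm y)) :
    ContDiffAt ℝ n (nablaRep p w i k) y := by
  have hn : (n : ℕ∞ω) ≤ (∞ : ℕ∞ω) := by exact_mod_cast le_top
  refine (contDiffAt_pd (contDiffAt_fieldRep hy hw) (by push_cast; rfl)).add
    (ContDiffAt.sum fun j _ ↦ ContDiffAt.mul ?_ ((contDiffAt_christoffel hy).of_le hn))
  exact (contDiffAt_fieldRep hy hw).of_le (by push_cast; exact le_self_add)

theorem hasCompC_conformalKilling {n : ℕ∞} (hw : ∀ x, FieldCAt (n + 1 : ℕ∞) w x) :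
    HasCompC n (conformalKilling w) := by
  intro p y hy a b
  have hn : (n : ℕ∞ω) ≤ (∞ : ℕ∞ω) := by exact_mod_cast le_top
  have hN : ∀ i k, ContDiffAt ℝ n (nablaRep p w i k) y := fun i k ↦ contDiffAt_nablaRep hy (hw _)
  have hG : ∀ i k, ContDiffAt ℝ n (fun z ↦ gram p z i k) y := fun i k ↦
    (contDiffAt_gram hy).of_le hn
  have h1 : ∀ x, FieldCAt 1 w x := fun x ↦ (hw x).of_le (by push_cast; exact le_add_self)
  refine ContDiffAt.congr_of_eventuallyEq (f := fun y ↦ (∑ k, nablaRep p w a k y * gram p y k b)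
      + (∑ k, nablaRep p w b k y * gram p y k a)
      - 2 / 3 * (∑ k, nablaRep p w k k y) * gram p y a b) ?_ ?_
  · exact ((ContDiffAt.sum fun k _ ↦ (hN a k).mul (hG k b)).add
      (ContDiffAt.sum fun k _ ↦ (hN b k).mul (hG k a))).sub
      ((contDiffAt_const.mul (ContDiffAt.sum fun k _ ↦ hN k k)).mul (hG a b))
  · filter_upwards [target_mem_nhds hy] with z hz using tensorRep_conformalKilling hz (h1 _)

theorem hasCompC_smul {n : ℕ∞} (hu : ContMDiff (𝓡 3) 𝓘(ℝ) n u) (hS : HasCompC n S) :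
    HasCompC n (fun q ↦ u q • S q) := fun p y hy a b ↦
  ((contMDiffAt_funRep_iff hy).1 (hu _)).mul (hS p y hy a b)

/-- The vector field `S(w, ·)^♯`. -/
def sharp (S : Tensor2 (𝓡 3) M) (w : Π q : M, TangentSpace (𝓡 3) q) (x : M) :
    TangentSpace (𝓡 3) x := (InnerProductSpace.toDual ℝ (TangentSpace (𝓡 3) x)).symm (S x (w x))

theorem inner_sharp (v : TangentSpace (𝓡 3) x) : inner ℝ (sharp S w x) v = S x (w x) v := by
  rw [sharp, InnerProductSpace.toDual_symm_apply]

theorem fieldCAt_of_comp {n : ℕ∞} (hy : y ∈ (extChartAt (𝓡 3) p).target)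
    (h : ∀ i, ContDiffAt ℝ n (fun z ↦ fieldRep p w z i) y) :
    FieldCAt n w ((extChartAt (𝓡 3) p).symm y) :=
  (contMDiffAt_fieldRep_iff hy).2 (contDiffAt_euclidean.2 h)

theorem fieldCAt_sharp {n : ℕ∞} (hS : HasCompC n S) (hw : ∀ x, FieldCAt n w x) (x : M) :
    FieldCAt n (sharp S w) x := by
  obtain ⟨p, y, hy, rfl⟩ := exists_chart_point x
  have hn : (n : ℕ∞ω) ≤ (∞ : ℕ∞ω) := by exact_mod_cast le_top
  refine fieldCAt_of_comp hy fun k ↦ ContDiffAt.congr_of_eventuallyEq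
    (f := fun z ↦ ∑ a, ∑ b, fieldRep p w z a * ginv p z k b * tensorRep p S a b z) ?_ ?_
  · exact ContDiffAt.sum fun a _ ↦ ContDiffAt.sum fun b _ ↦
      ((contDiffAt_fieldRep hy (hw _)).mul ((contDiffAt_ginv hy).of_le hn)).mul (hS p y hy a b)
  · filter_upwards [target_mem_nhds hy] with z hz
    rw [fieldRep_eq_inner _ hz, inner_sharp, tensor_apply_eq hz]
    simp only [inner_dualVec_dualVec hz, ← fieldRep_eq_inner _ hz]

theorem fieldCAt_grad {n : ℕ∞} (hu : ContMDiff (𝓡 3) 𝓘(ℝ) (n + 1 : ℕ∞) u) (x : M) :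
    FieldCAt n (grad (𝓡 3) u) x := by
  obtain ⟨p, y, hy, rfl⟩ := exists_chart_point x
  have hn : (n : ℕ∞ω) ≤ (∞ : ℕ∞ω) := by exact_mod_cast le_top
  refine fieldCAt_of_comp hy fun k ↦ ContDiffAt.congr_of_eventuallyEq
    (f := fun z ↦ ∑ l, ginv p z k l * pd l (funRep p u) z) ?_ ?_
  · exact ContDiffAt.sum fun a _ ↦ ((contDiffAt_ginv hy).of_le hn).mul
      (contDiffAt_pd ((contMDiffAt_funRep_iff hy).1 (hu _)) (by push_cast; rfl))
  · filter_upwards [target_mem_nhds hy] with z hz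
    exact fieldRep_grad hz ((hu _).mdifferentiableAt (by simp))

theorem mvfderiv_tensor_apply' {A B : Π q : M, TangentSpace (𝓡 3) q} (hS : HasCompC 1 S)
    (hA : FieldCAt 1 A x) (hB : FieldCAt 1 B x) (z : TangentSpace (𝓡 3) x) :
    mvfderiv (𝓡 3) (fun q ↦ S q (A q) (B q)) x z = nablaTensor S x z (A x) (B x) +
      S x (nabla A x z) (B x) + S x (A x) (nabla B x z) := by
  obtain ⟨p, y, hy, rfl⟩ := exists_chart_point x
  conv_lhs => rw [vec_eq_sum hy z]
  rw [nablaTensor_coord hy (hS p y hy)]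
  have h1 : ∀ A : Π q : M, TangentSpace (𝓡 3) q, nabla A ((extChartAt (𝓡 3) p).symm y) z =
      ∑ k, inner ℝ z (dualVec p k y) • nabla A ((extChartAt (𝓡 3) p).symm y)
        (coordField p k ((extChartAt (𝓡 3) p).symm y)) := fun A ↦ by
    conv_lhs => rw [vec_eq_sum hy z]
    simp only [map_sum, map_smul]
  rw [h1 A, h1 B]
  simp only [map_sum, map_smul, sum_apply, smul_apply,
    mvfderiv_tensor_apply hy (hS p y hy) hA hB, smul_eq_mul, ← fieldRep_eq_inner _ hy]
  simp only [mul_add, Finset.sum_add_distrib, Finset.mul_sum, mul_assoc]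

theorem inner_nabla_sharp (hS : HasCompC 1 S) (hw : ∀ x, FieldCAt 1 w x)
    (z v : TangentSpace (𝓡 3) x) : inner ℝ (nabla (sharp S w) x z) v =
      nablaTensor S x z (w x) v + S x (nabla w x z) v := by
  have hv : FieldCAt 1 (localExt v) x := contMDiffAt_extend _ _ v
  have hz : FieldCAt 1 (localExt z) x := contMDiffAt_extend _ _ z
  have ev : localExt v x = v := extend_apply_self _ _
  have ez : localExt z x = z := extend_apply_self _ _
  have h1 := mvfderiv_tensor_apply' hS (hw x) hv z
  have h2 := leviCivita_metric hz.fieldDAt (fieldCAt_sharp (n := 1) hS hw x).fieldDAt hv.fieldDAt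
  simp only [inner_sharp, ez, ev] at h1 h2
  have h3 : S x (w x) (nabla (localExt v) x z) =
      S x (w x) ((leviCivita (𝓡 3) M) (localExt v) x z) := rfl
  rw [h1, h3] at h2
  change inner ℝ ((leviCivita (𝓡 3) M) (sharp S w) x z) v = _
  linarith

/-- `D_b (S^ab w_a) = w_a D_b S^ab + S^ab D_b w_a`. -/
theorem divergence_sharp (hS : HasCompC 1 S) (hw : ∀ x, FieldCAt 1 w x) (x : M) :
    divergence (sharp S w) x = inner ℝ (tensorDivergence S x) (w x) +
      ∑ j, S x (nabla w x (frame (𝓡 3) x j)) (frame (𝓡 3) x j) := by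
  have hlin : ∀ z v, IsLinearMap ℝ fun w ↦ nablaTensor S x z w v := by
    obtain ⟨p, y, hy, rfl⟩ := exists_chart_point x
    exact isLinearMap_nablaTensor hy (hS p y hy)
  rw [divergence_eq_frame, inner_tensorDivergence _ hlin, ← Finset.sum_add_distrib]
  refine Finset.sum_congr rfl fun j _ ↦ ?_
  rw [real_inner_comm, inner_nabla_sharp hS hw]

theorem divergence_smul (hw : FieldDAt w x) (hu : MDifferentiableAt (𝓡 3) 𝓘(ℝ) u x) :
    divergence (fun q ↦ u q • w q) x = u x * divergence w x + mvfderiv (𝓡 3) u x (w x) := by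
  have h0 := congrArg (mvfderiv (𝓡 3) u x) ((frame (𝓡 3) x).sum_repr' (w x))
  rw [map_sum] at h0
  simp only [map_smul, smul_eq_mul] at h0
  rw [divergence_eq_frame, divergence_eq_frame, ← h0, Finset.mul_sum, ← Finset.sum_add_distrib]
  refine Finset.sum_congr rfl fun j _ ↦ ?_
  rw [nabla_smul hw hu, inner_add_right, real_inner_smul_right, real_inner_smul_right]
  ring

theorem contract_conformalKilling (hsymm : ∀ a b, S x a b = S x b a)
    (htr : ∑ i, S x (frame (𝓡 3) x i) (frame (𝓡 3) x i) = 0) :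
    contract S (conformalKilling w) x =
      2 * ∑ j, S x (nabla w x (frame (𝓡 3) x j)) (frame (𝓡 3) x j) := by
  have h1 : ∀ i v, ∑ j, S x (frame (𝓡 3) x i) (frame (𝓡 3) x j) * inner ℝ v (frame (𝓡 3) x j) =
      S x (frame (𝓡 3) x i) v := fun i v ↦ by
    have h := congrArg (S x (frame (𝓡 3) x i)) ((frame (𝓡 3) x).sum_repr' v)
    rw [map_sum] at h
    simp only [map_smul, smul_eq_mul] at h
    rw [← h]
    refine Finset.sum_congr rfl fun j _ ↦ ?_
    rw [real_inner_comm, mul_comm]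
  have h2 : ∑ i, ∑ j, S x (frame (𝓡 3) x i) (frame (𝓡 3) x j) *
      inner ℝ (nabla w x (frame (𝓡 3) x j)) (frame (𝓡 3) x i) =
      ∑ j, S x (frame (𝓡 3) x j) (nabla w x (frame (𝓡 3) x j)) := by
    rw [Finset.sum_comm]
    refine Finset.sum_congr rfl fun j _ ↦ ?_
    rw [← h1]
    refine Finset.sum_congr rfl fun i _ ↦ ?_
    rw [hsymm]
  have h3 : ∑ i, ∑ j, S x (frame (𝓡 3) x i) (frame (𝓡 3) x j) *
      inner ℝ (frame (𝓡 3) x i) (frame (𝓡 3) x j) = 0 := by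
    simp only [h1]; exact htr
  simp only [contract, conformalKilling_apply, mul_sub, mul_add, Finset.sum_sub_distrib,
    Finset.sum_add_distrib]
  rw [h2]
  simp only [h1]
  have h4 : ∑ i, ∑ j, S x (frame (𝓡 3) x i) (frame (𝓡 3) x j) *
      (2 / 3 * divergence w x * inner ℝ (frame (𝓡 3) x i) (frame (𝓡 3) x j)) = 0 := by
    have h5 := congrArg (fun t ↦ 2 / 3 * divergence w x * t) h3
    simp only [mul_zero, Finset.mul_sum] at h5
    rw [← h5]
    refine Finset.sum_congr rfl fun i _ ↦ Finset.sum_congr rfl fun j _ ↦ ?_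
    ring
  rw [h4, sub_zero, two_mul]
  congr 1 <;> exact Finset.sum_congr rfl fun j _ ↦ hsymm _ _

theorem conformalKilling_symm (w : Π q : M, TangentSpace (𝓡 3) q) (x : M)
    (a b : TangentSpace (𝓡 3) x) : conformalKilling w x a b = conformalKilling w x b a := by
  rw [conformalKilling_apply, conformalKilling_apply, real_inner_comm b a]; ring

theorem finrank_tangentSpace (x : M) : Module.finrank ℝ (TangentSpace (𝓡 3) x) = 3 :=
  (finrank_euclideanSpace_fin (𝕜 := ℝ) (n := 3))

theorem conformalKilling_trace (w : Π q : M, TangentSpace (𝓡 3) q) (x : M) :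
    ∑ i, conformalKilling w x (frame (𝓡 3) x i) (frame (𝓡 3) x i) = 0 := by
  have h1 : ∀ i, conformalKilling w x (frame (𝓡 3) x i) (frame (𝓡 3) x i) =
      2 * inner ℝ (frame (𝓡 3) x i) (nabla w x (frame (𝓡 3) x i)) - 2 / 3 * divergence w x := by
    intro i
    rw [conformalKilling_apply, real_inner_self_eq_norm_sq, (frame (𝓡 3) x).norm_eq_one,
      real_inner_comm]
    ring
  simp only [h1, Finset.sum_sub_distrib, ← Finset.mul_sum, ← divergence_eq_frame]
  simp only [Finset.sum_const, Finset.card_univ, Fintype.card_fin, finrank_tangentSpace]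
  simp only [nsmul_eq_mul]
  push_cast
  ring

end identities

section euclidean

variable {f : E3 → ℝ} {U K : Set E3} {i : Fin 3}

theorem integral_pd_eq_zero (hf : ContDiff ℝ 1 f) (hc : HasCompactSupport f) :
    ∫ y, pd i f y = 0 := by
  have h := integral_mul_fderiv_eq_neg_fderiv_mul_of_integrable (μ := (volume : Measure E3))
    (f := fun _ ↦ (1 : ℝ)) (g := f) (v := (EuclideanSpace.single i 1 : E3)) (by simp)
    (by
      simp only [one_mul]
      exact (hf.continuous_fderiv (by simp)).clm_apply continuous_const |>.integrable_of_hasCompactSupport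
        (hc.fderiv_apply (𝕜 := ℝ) _))
    (by simpa using hf.continuous.integrable_of_hasCompactSupport hc)
    (fun x _ ↦ differentiableAt_const _) (fun x _ ↦ hf.differentiable (by simp) x)
  simpa [pd] using h

theorem continuous_pd (hf : ContDiff ℝ 1 f) : Continuous (pd i f) :=
  (hf.continuous_fderiv (by simp)).clm_apply continuous_const

theorem exists_contDiff_eqOn (hU : IsOpen U) (hK : IsCompact K) (hKU : K ⊆ U)
    (hf : ∀ y ∈ U, ContDiffAt ℝ 1 f y) (h0 : ∀ y ∈ U, y ∉ K → f y = 0) :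
    ∃ g : E3 → ℝ, ContDiff ℝ 1 g ∧ HasCompactSupport g ∧ (∀ y ∈ U, pd i f y = pd i g y) ∧
      ∀ y ∉ U, pd i g y = 0 := by
  set g : E3 → ℝ := U.indicator f
  have hgf : ∀ y ∈ U, g =ᶠ[𝓝 y] f := fun y hy ↦ by
    filter_upwards [hU.mem_nhds hy] with z hz using indicator_of_mem hz f
  have hg0 : ∀ y, y ∉ K → g y = 0 := fun y hy ↦ by
    by_cases hyU : y ∈ U
    · rw [show g y = f y from indicator_of_mem hyU f]
      exact h0 y hyU hy
    · exact indicator_of_notMem hyU f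
  have hg0' : ∀ y, y ∉ K → g =ᶠ[𝓝 y] fun _ ↦ 0 := fun y hy ↦ by
    filter_upwards [hK.isClosed.isOpen_compl.mem_nhds hy] with z hz using hg0 z hz
  have hg : ContDiff ℝ 1 g := contDiff_iff_contDiffAt.2 fun y ↦ by
    by_cases hy : y ∈ U
    · exact (hf y hy).congr_of_eventuallyEq (hgf y hy)
    · exact contDiffAt_const.congr_of_eventuallyEq (hg0' y fun h ↦ hy (hKU h))
  have hc : HasCompactSupport g := HasCompactSupport.intro hK fun y hy ↦ hg0 y hy
  refine ⟨g, hg, hc, fun y hy ↦ (pd_congr (hgf y hy)).symm, fun y hy ↦ ?_⟩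
  rw [pd_congr (hg0' y fun h ↦ hy (hKU h))]
  simp [pd]

theorem integrableOn_pd (hU : IsOpen U) (hK : IsCompact K) (hKU : K ⊆ U)
    (hf : ∀ y ∈ U, ContDiffAt ℝ 1 f y) (h0 : ∀ y ∈ U, y ∉ K → f y = 0) :
    IntegrableOn (pd i f) U := by
  obtain ⟨g, hg, hc, hfg, -⟩ := exists_contDiff_eqOn (i := i) hU hK hKU hf h0
  have h : Integrable (pd i g) := (continuous_pd hg).integrable_of_hasCompactSupport
    (hc.fderiv_apply (𝕜 := ℝ) _)
  exact h.integrableOn.congr_fun (fun y hy ↦ (hfg y hy).symm) hU.measurableSet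

/-- The integral over `U` of a partial derivative of a function supported in a compact subset. -/
theorem setIntegral_pd_eq_zero (hU : IsOpen U) (hK : IsCompact K) (hKU : K ⊆ U)
    (hf : ∀ y ∈ U, ContDiffAt ℝ 1 f y) (h0 : ∀ y ∈ U, y ∉ K → f y = 0) :
    ∫ y in U, pd i f y = 0 := by
  obtain ⟨g, hg, hc, hfg, hg0⟩ := exists_contDiff_eqOn (i := i) hU hK hKU hf h0
  rw [setIntegral_congr_fun hU.measurableSet hfg,
    setIntegral_eq_integral_of_forall_compl_eq_zero hg0, integral_pd_eq_zero hg hc]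

/-- Jacobi's formula for the derivative of a determinant. -/
theorem pd_det {G : E3 → Matrix (Fin 3) (Fin 3) ℝ} {y : E3}
    (hG : ∀ a b, DifferentiableAt ℝ (fun z ↦ G z a b) y) :
    pd i (fun z ↦ (G z).det) y = ∑ a, ∑ b, (G y).adjugate a b * pd i (fun z ↦ G z b a) y := by
  have h : ∀ a b, HasFDerivAt (fun z ↦ G z a b) (fderiv ℝ (fun z ↦ G z a b) y) y :=
    fun a b ↦ (hG a b).hasFDerivAt
  have hd := (((((((h 0 0).mul (h 1 1)).mul (h 2 2)).sub (((h 0 0).mul (h 1 2)).mul (h 2 1))).sub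
    (((h 0 1).mul (h 1 0)).mul (h 2 2))).add (((h 0 1).mul (h 1 2)).mul (h 2 0))).add
    (((h 0 2).mul (h 1 0)).mul (h 2 1))).sub (((h 0 2).mul (h 1 1)).mul (h 2 0))
  have hd' : HasFDerivAt (fun z ↦ (G z).det) _ y :=
    hd.congr_of_eventuallyEq (Eventually.of_forall fun z ↦ Matrix.det_fin_three (G z))
  refine (DFunLike.congr_fun hd'.fderiv _).trans ?_
  rw [Matrix.adjugate_fin_three]
  simp [Fin.sum_univ_three, pd]
  ring

end euclidean

section divergence
variable {M : Type*} [TopologicalSpace M] [ChartedSpace E3 M] [IsManifold (𝓡 3) ∞ M]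
  [RiemannianBundle (fun x : M ↦ TangentSpace (𝓡 3) x)]
  [IsContMDiffRiemannianBundle (𝓡 3) ∞ E3 (fun x : M ↦ TangentSpace (𝓡 3) x)]

variable {p q x : M} {y : E3} {i j k l : Fin 3} {w : Π q : M, TangentSpace (𝓡 3) q}

/-- The density `√(det g)` of the volume in the chart at `p`. -/
def sqrtDet (p : M) (y : E3) : ℝ := √(gram p y).det

theorem sqrtDet_pos (hy : y ∈ (extChartAt (𝓡 3) p).target) : 0 < sqrtDet p y :=
  Real.sqrt_pos.2 (gram_posDef hy).det_pos

theorem contDiffAt_sqrtDet (hy : y ∈ (extChartAt (𝓡 3) p).target) :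
    ContDiffAt ℝ ∞ (sqrtDet p) y :=
  (contDiffAt_det_gram hy).sqrt (gram_posDef hy).det_pos.ne'

theorem sum_christoffel (hy : y ∈ (extChartAt (𝓡 3) p).target) :
    sqrtDet p y * ∑ k, christoffel p k j k y = pd j (sqrtDet p) y := by
  have hd : ∀ a b, DifferentiableAt ℝ (fun z ↦ gram p z a b) y := fun a b ↦
    (contDiffAt_gram hy).differentiableAt (by simp)
  have hpos := (gram_posDef hy).det_pos
  have h1 : pd j (sqrtDet p) y = pd j (fun z ↦ (gram p z).det) y / (2 * sqrtDet p y) := by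
    have := (((contDiffAt_det_gram hy).differentiableAt (by simp)).hasFDerivAt.sqrt hpos.ne').fderiv
    simp only [pd]
    rw [show sqrtDet p = fun z ↦ √(gram p z).det from rfl, this]
    simp only [smul_apply, smul_eq_mul]
    ring
  have hadj : ∀ a b, (gram p y).adjugate a b = (gram p y).det * ginv p y a b := fun a b ↦ by
    rw [ginv, Matrix.inv_def]
    simp [hpos.ne']
  have hsq : sqrtDet p y * sqrtDet p y = (gram p y).det := Real.mul_self_sqrt hpos.le
  have hs := (sqrtDet_pos hy).ne'
  have hpd : ∀ c a b, pd c (fun z ↦ gram p z a b) y = pd c (fun z ↦ gram p z b a) y := fun c a b ↦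
    pd_congr (by filter_upwards [target_mem_nhds hy] with z hz using gram_symm hz)
  rw [h1, pd_det hd, eq_div_iff (by positivity)]
  simp only [hadj, christoffel_eq hy]
  have h2 : sqrtDet p y * (∑ k, ∑ l, ginv p y k l * (1 / 2 * (pd k (fun z ↦ gram p z j l) y
      + pd j (fun z ↦ gram p z k l) y - pd l (fun z ↦ gram p z k j) y))) * (2 * sqrtDet p y) =
      (gram p y).det * ∑ k, ∑ l, ginv p y k l * ((pd k (fun z ↦ gram p z j l) y
      + pd j (fun z ↦ gram p z k l) y - pd l (fun z ↦ gram p z k j) y)) := by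
    rw [← hsq]
    simp only [mul_left_comm _ (1 / 2 : ℝ), ← Finset.mul_sum]
    ring
  refine h2.trans ?_
  have h3 : ∑ k, ∑ l, ginv p y k l * pd k (fun z ↦ gram p z j l) y =
      ∑ k, ∑ l, ginv p y k l * pd l (fun z ↦ gram p z k j) y := by
    rw [Finset.sum_comm]
    refine Finset.sum_congr rfl fun a _ ↦ Finset.sum_congr rfl fun b _ ↦ ?_
    rw [ginv_symm hy, hpd]
  simp only [mul_sub, mul_add, Finset.sum_sub_distrib, Finset.sum_add_distrib]
  rw [h3, add_sub_cancel_left]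
  simp only [Finset.mul_sum]
  refine Finset.sum_congr rfl fun a _ ↦ Finset.sum_congr rfl fun b _ ↦ ?_
  rw [hpd j b a, mul_assoc]

/-- `√(det g) div w = ∂_k (√(det g) w^k)`. -/
theorem sqrtDet_mul_divergence (hy : y ∈ (extChartAt (𝓡 3) p).target)
    (hw : FieldCAt 1 w ((extChartAt (𝓡 3) p).symm y)) :
    sqrtDet p y * divergence w ((extChartAt (𝓡 3) p).symm y) =
      ∑ k, pd k (fun z ↦ sqrtDet p z * fieldRep p w z k) y := by
  have h := fun k ↦ pd_mul (i := k) ((contDiffAt_sqrtDet hy).differentiableAt (by simp))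
    ((contDiffAt_fieldRep (i := k) (n := 1) hy hw).differentiableAt (by simp))
  refine (congrArg _ (divergence_eq hy hw)).trans ?_
  simp only [h, Finset.sum_add_distrib, nablaRep, mul_add, ← sum_christoffel hy, Finset.mul_sum]
  congr 1
  rw [Finset.sum_comm]
  exact Finset.sum_congr rfl fun a _ ↦ Finset.sum_congr rfl fun b _ ↦ by ring

end divergence

section volume
variable {M : Type*} [TopologicalSpace M] [ChartedSpace E3 M] [IsManifold (𝓡 3) ∞ M]
  [RiemannianBundle (fun x : M ↦ TangentSpace (𝓡 3) x)]
  [IsContMDiffRiemannianBundle (𝓡 3) ∞ E3 (fun x : M ↦ TangentSpace (𝓡 3) x)]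

variable {p q x : M} {y : E3} {i j k l : Fin 3} {w : Π q : M, TangentSpace (𝓡 3) q}

/-- The transition map from the chart at `q` to the chart at `p`. -/
def transition (q p : M) : E3 → E3 := extChartAt (𝓡 3) p ∘ (extChartAt (𝓡 3) q).symm

theorem hasFDerivAt_transition (hy : y ∈ (extChartAt (𝓡 3) q).target)
    (hp : (extChartAt (𝓡 3) q).symm y ∈ (extChartAt (𝓡 3) p).source) :
    ∃ J : E3 →L[ℝ] E3, HasFDerivAt (transition q p) J y ∧ ∀ i k,
      J (EuclideanSpace.single i 1) k = fieldRep p (coordField q i) (transition q p y) k := by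
  have hq : MDifferentiableAt 𝓘(ℝ, E3) (𝓡 3) (extChartAt (𝓡 3) q).symm y :=
    ((contMDiffOn_extChartAt_symm (n := ∞) q).contMDiffAt
      ((isOpen_extChartAt_target q).mem_nhds hy)).mdifferentiableAt (by simp)
  have hp' : MDifferentiableAt (𝓡 3) 𝓘(ℝ, E3) (extChartAt (𝓡 3) p) ((extChartAt (𝓡 3) q).symm y) :=
    (contMDiffAt_extChartAt' (n := ∞) (by simpa using hp)).mdifferentiableAt (by simp)
  have h := (hp'.hasMFDerivAt.comp y hq.hasMFDerivAt).hasFDerivAt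
  refine ⟨_, h, fun i k ↦ congrArg (fun v : E3 ↦ v k) ?_⟩
  have h2 := fieldRep_extChartAt (w := coordField q i) hp
  refine Eq.trans ?_ h2.symm
  exact congrArg (mfderiv (𝓡 3) 𝓘(ℝ, E3) (extChartAt (𝓡 3) p) ((extChartAt (𝓡 3) q).symm y))
    (coordField_symm_eq hy)

theorem sqrtDet_transition (hy : y ∈ (extChartAt (𝓡 3) q).target)
    (hp : (extChartAt (𝓡 3) q).symm y ∈ (extChartAt (𝓡 3) p).source) {J : E3 →L[ℝ] E3}
    (hJ : ∀ i k, J (EuclideanSpace.single i 1) k =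
      fieldRep p (coordField q i) (transition q p y) k) :
    sqrtDet q y = |J.det| * sqrtDet p (transition q p y) := by
  set A : Matrix (Fin 3) (Fin 3) ℝ := Matrix.of fun k i ↦ J (EuclideanSpace.single i 1) k
  have hz : transition q p y ∈ (extChartAt (𝓡 3) p).target := (extChartAt (𝓡 3) p).map_source hp
  have hzy : (extChartAt (𝓡 3) p).symm (transition q p y) = (extChartAt (𝓡 3) q).symm y :=
    (extChartAt (𝓡 3) p).left_inv hp
  have hdet : J.det = A.det := by
    have h : A = LinearMap.toMatrix (EuclideanSpace.basisFun (Fin 3) ℝ).toBasis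
        (EuclideanSpace.basisFun (Fin 3) ℝ).toBasis J.toLinearMap := by
      ext k i
      simp [A, LinearMap.toMatrix_apply]
    rw [h, LinearMap.det_toMatrix]
  have hgram : gram q y = A.transpose * gram p (transition q p y) * A := by
    ext i j
    refine (gram_apply hy).trans ?_
    rw [← hzy]
    refine (congrArg₂ (inner ℝ) (field_eq_sum (coordField q i) hz)
      (field_eq_sum (coordField q j) hz)).trans ?_
    simp only [sum_inner, inner_sum, real_inner_smul_left, real_inner_smul_right,
      Matrix.mul_apply, Matrix.transpose_apply, Finset.sum_mul, ← hJ, ← gram_apply hz, A,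
      Matrix.of_apply]
    exact Finset.sum_congr rfl fun a _ ↦ Finset.sum_congr rfl fun b _ ↦ by ring
  rw [sqrtDet, hgram, Matrix.det_mul, Matrix.det_mul, Matrix.det_transpose, hdet, sqrtDet,
    show A.det * (gram p (transition q p y)).det * A.det =
      A.det ^ 2 * (gram p (transition q p y)).det by ring,
    Real.sqrt_mul (sq_nonneg _), Real.sqrt_sq_eq_abs]

variable [MeasurableSpace M] [BorelSpace M]

theorem aemeasurable_chart_symm (p : M) {μ : Measure E3} :
    AEMeasurable (extChartAt (𝓡 3) p).symm (μ.restrict (extChartAt (𝓡 3) p).target) :=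
  (continuousOn_extChartAt_symm p).aemeasurable (isOpen_extChartAt_target p).measurableSet

theorem aemeasurable_sqrtDet (p : M) : AEMeasurable (fun y ↦ ENNReal.ofReal √(gram p y).det)
    (volume.restrict (extChartAt (𝓡 3) p).target) := by
  have h : ContinuousOn (sqrtDet p) (extChartAt (𝓡 3) p).target := fun y hy ↦
    (contDiffAt_sqrtDet hy).continuousAt.continuousWithinAt
  exact (h.aemeasurable (isOpen_extChartAt_target p).measurableSet).ennreal_ofReal

theorem aemeasurable_chart_symm' (p : M) : AEMeasurable (extChartAt (𝓡 3) p).symm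
    ((volume.restrict (extChartAt (𝓡 3) p).target).withDensity
      fun y ↦ ENNReal.ofReal √(gram p y).det) :=
  (aemeasurable_chart_symm p).mono_ac (withDensity_absolutelyContinuous _ _)

theorem lintegral_chartVolume {f : M → ℝ≥0∞} (hf : Measurable f) :
    ∫⁻ x, f x ∂chartVolume p = ∫⁻ y in (extChartAt (𝓡 3) p).target,
      ENNReal.ofReal (sqrtDet p y) * f ((extChartAt (𝓡 3) p).symm y) := by
  rw [chartVolume, lintegral_map' hf.aemeasurable (aemeasurable_chart_symm' p)]
  exact lintegral_withDensity_eq_lintegral_mul₀ (aemeasurable_sqrtDet p)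
    (hf.comp_aemeasurable (aemeasurable_chart_symm p))

theorem integral_chartVolume {f : M → ℝ} (hf : AEStronglyMeasurable f (chartVolume p)) :
    ∫ x, f x ∂chartVolume p = ∫ y in (extChartAt (𝓡 3) p).target,
      sqrtDet p y * f ((extChartAt (𝓡 3) p).symm y) := by
  rw [chartVolume] at hf ⊢
  rw [integral_map (aemeasurable_chart_symm' p) hf,
    integral_withDensity_eq_integral_toReal_smul₀ (aemeasurable_sqrtDet p) (by simp)]
  refine integral_congr_ae (Eventually.of_forall fun y ↦ ?_)
  simp [sqrtDet, ENNReal.toReal_ofReal (Real.sqrt_nonneg _)]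

theorem measurableSet_source (p : M) : MeasurableSet (extChartAt (𝓡 3) p).source :=
  (isOpen_extChartAt_source p).measurableSet

theorem chartVolume_apply {A : Set M} (hA : MeasurableSet A) :
    chartVolume p A = ∫⁻ y in (extChartAt (𝓡 3) p).target ∩ (extChartAt (𝓡 3) p).symm ⁻¹' A,
      ENNReal.ofReal (sqrtDet p y) := by
  rw [← lintegral_indicator_one hA, lintegral_chartVolume (measurable_one.indicator hA)]
  have hm : NullMeasurableSet ((extChartAt (𝓡 3) p).symm ⁻¹' A)
      (volume.restrict (extChartAt (𝓡 3) p).target) :=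
    (aemeasurable_chart_symm p).nullMeasurable hA
  rw [inter_comm, ← Measure.restrict_restrict₀ hm, ← lintegral_indicator₀ hm]
  refine lintegral_congr fun y ↦ ?_
  by_cases h : (extChartAt (𝓡 3) p).symm y ∈ A
  · rw [indicator_of_mem h, indicator_of_mem (show y ∈ _ ⁻¹' A from h)]
    simp
  · rw [indicator_of_notMem h, indicator_of_notMem (show y ∉ _ ⁻¹' A from h)]
    simp

theorem measurableSet_target_inter {A : Set M} (hA : MeasurableSet A) :
    MeasurableSet ((extChartAt (𝓡 3) p).target ∩ (extChartAt (𝓡 3) p).symm ⁻¹' A) := by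
  have ht := (isOpen_extChartAt_target (I := 𝓡 3) p).measurableSet
  have h : Measurable ((extChartAt (𝓡 3) p).target.domRestrict (extChartAt (𝓡 3) p).symm) :=
    (continuousOn_extChartAt_symm p).domRestrict.measurable
  have h2 := ht.subtype_image (h hA)
  convert h2 using 1
  ext y
  constructor
  · rintro ⟨h3, h4⟩
    exact ⟨⟨y, h3⟩, h4, rfl⟩
  · rintro ⟨⟨z, h3⟩, h4, rfl⟩
    exact ⟨h3, h4⟩

/-- The volumes of two charts agree on the overlap of their domains. -/
theorem chartVolume_eq {A : Set M} (hA : MeasurableSet A) (hp : A ⊆ (extChartAt (𝓡 3) p).source)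
    (hq : A ⊆ (extChartAt (𝓡 3) q).source) : chartVolume p A = chartVolume q A := by
  rw [chartVolume_apply hA, chartVolume_apply hA]
  set s := (extChartAt (𝓡 3) q).target ∩ (extChartAt (𝓡 3) q).symm ⁻¹' A
  have hJ : ∀ y ∈ s, ∃ J : E3 →L[ℝ] E3, HasFDerivAt (transition q p) J y ∧
      sqrtDet q y = |J.det| * sqrtDet p (transition q p y) := fun y hy ↦ by
    obtain ⟨J, h1, h2⟩ := hasFDerivAt_transition (p := p) hy.1 (hp hy.2)
    exact ⟨J, h1, sqrtDet_transition hy.1 (hp hy.2) h2⟩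
  choose! J hJ1 hJ2 using hJ
  have himg : transition q p '' s =
      (extChartAt (𝓡 3) p).target ∩ (extChartAt (𝓡 3) p).symm ⁻¹' A := by
    ext z
    constructor
    · rintro ⟨y, hy, rfl⟩
      refine ⟨(extChartAt (𝓡 3) p).map_source (hp hy.2), ?_⟩
      change (extChartAt (𝓡 3) p).symm (extChartAt (𝓡 3) p ((extChartAt (𝓡 3) q).symm y)) ∈ A
      rw [(extChartAt (𝓡 3) p).left_inv (hp hy.2)]
      exact hy.2
    · rintro ⟨hz, hzA⟩
      have hz' := hq hzA
      refine ⟨extChartAt (𝓡 3) q ((extChartAt (𝓡 3) p).symm z),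
        ⟨(extChartAt (𝓡 3) q).map_source hz', ?_⟩, ?_⟩
      · change (extChartAt (𝓡 3) q).symm _ ∈ A
        rw [(extChartAt (𝓡 3) q).left_inv hz']
        exact hzA
      · change extChartAt (𝓡 3) p ((extChartAt (𝓡 3) q).symm _) = z
        rw [(extChartAt (𝓡 3) q).left_inv hz', (extChartAt (𝓡 3) p).right_inv hz]
  have hinj : InjOn (transition q p) s := by
    refine (extChartAt (𝓡 3) p).injOn.comp ((extChartAt (𝓡 3) q).symm.injOn.mono ?_) ?_
    · exact fun y hy ↦ hy.1
    · exact fun y hy ↦ hp hy.2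
  rw [← himg, lintegral_image_eq_lintegral_abs_det_fderiv_mul volume
    (measurableSet_target_inter hA) (fun y hy ↦ (hJ1 y hy).hasFDerivWithinAt) hinj]
  refine setLIntegral_congr_fun (measurableSet_target_inter hA) fun y hy ↦ ?_
  rw [hJ2 y hy, ENNReal.ofReal_mul (abs_nonneg _)]

variable [CompactSpace M] [T2Space M]

theorem tsupport_chartPartition_subset (p : M) :
    tsupport (chartPartition M p) ⊆ (extChartAt (𝓡 3) p).source := by
  rw [extChartAt_source]
  exact (SmoothPartitionOfUnity.exists_isSubordinate_chartAt_source (𝓡 3) M).choose_spec p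

variable (M) in
theorem finite_chartPartition : {p : M | chartPartition M p ≠ 0}.Finite := by
  have h := (chartPartition M).locallyFinite.finite_nonempty_of_compact
  refine h.subset fun p hp ↦ ?_
  obtain ⟨x, hx⟩ : ∃ x, chartPartition M p x ≠ 0 := by
    by_contra! h
    exact hp (by ext x; exact h x)
  exact ⟨x, hx⟩

variable (M) in
/-- The finitely many indices at which the partition of unity does not vanish. -/
def partitionIndex : Finset M := (finite_chartPartition M).toFinset

theorem chartPartition_eq_zero (hp : p ∉ partitionIndex M) (x : M) : chartPartition M p x = 0 := by
  have h : chartPartition M p = 0 := by simpa [partitionIndex] using hp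
  simp [h]

theorem sum_chartPartition (x : M) : ∑ p ∈ partitionIndex M, chartPartition M p x = 1 := by
  rw [← (chartPartition M).sum_eq_one (mem_univ x)]
  refine (finsum_eq_sum_of_support_subset _ fun p hp ↦ ?_).symm
  by_contra h
  exact hp (chartPartition_eq_zero h x)

theorem measurable_chartPartition (p : M) : Measurable (chartPartition M p) :=
  (chartPartition M p).2.continuous.measurable

theorem riemannianVolume_apply {A : Set M} (hA : MeasurableSet A)
    (hq : A ⊆ (extChartAt (𝓡 3) q).source) : riemannianVolume M A = chartVolume q A := by
  have h1 : ∀ p : M, ((chartVolume p).withDensity fun x ↦ ENNReal.ofReal (chartPartition M p x)) A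
      = ∫⁻ x in A, ENNReal.ofReal (chartPartition M p x) ∂chartVolume q := fun p ↦ by
    have hs := measurableSet_source p
    have h0 : ∀ x ∈ A \ (extChartAt (𝓡 3) p).source,
        ENNReal.ofReal (chartPartition M p x) = 0 := fun x hx ↦ by
      have : chartPartition M p x = 0 := by
        by_contra h
        exact hx.2 (tsupport_chartPartition_subset p (subset_tsupport _ h))
      simp [this]
    have h2 : ∀ r : M, ∫⁻ x in A, ENNReal.ofReal (chartPartition M p x) ∂chartVolume r =
        ∫⁻ x in A ∩ (extChartAt (𝓡 3) p).source,
          ENNReal.ofReal (chartPartition M p x) ∂chartVolume r := fun r ↦ by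
      rw [← lintegral_inter_add_sdiff _ A hs, setLIntegral_congr_fun (hA.diff hs) h0]
      simp
    rw [withDensity_apply _ hA, h2, h2]
    congr 1
    ext B hB
    rw [Measure.restrict_apply hB, Measure.restrict_apply hB]
    exact chartVolume_eq (hB.inter (hA.inter hs)) (fun x hx ↦ hx.2.2) (fun x hx ↦ hq hx.2.1)
  rw [riemannianVolume, Measure.sum_apply _ hA]
  simp only [h1]
  rw [tsum_eq_sum (s := partitionIndex M) fun p hp ↦ by simp [chartPartition_eq_zero hp],
    ← lintegral_finsetSum' _ fun p _ ↦ (measurable_chartPartition p).ennreal_ofReal.aemeasurable]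
  have h3 : ∀ x : M, ∑ p ∈ partitionIndex M, ENNReal.ofReal (chartPartition M p x) = 1 := fun x ↦ by
    rw [← ENNReal.ofReal_sum_of_nonneg fun p _ ↦ (chartPartition M).nonneg p x,
      sum_chartPartition, ENNReal.ofReal_one]
  simp [h3]

theorem restrict_riemannianVolume (q : M) :
    (riemannianVolume M).restrict (extChartAt (𝓡 3) q).source =
      (chartVolume q).restrict (extChartAt (𝓡 3) q).source := by
  ext A hA
  rw [Measure.restrict_apply hA, Measure.restrict_apply hA]
  exact riemannianVolume_apply (hA.inter (measurableSet_source q)) fun x hx ↦ hx.2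

instance : IsLocallyFiniteMeasure (riemannianVolume M) where
  finiteAtNhds x := by
    obtain ⟨r, hr, hball⟩ := Metric.nhds_basis_closedBall.mem_iff.1
      ((isOpen_extChartAt_target (I := 𝓡 3) x).mem_nhds (mem_extChartAt_target x))
    set K := closedBall (extChartAt (𝓡 3) x x) r
    have hc : ContinuousOn (sqrtDet x) K := fun y hy ↦
      (contDiffAt_sqrtDet (hball hy)).continuousAt.continuousWithinAt
    have hfin : ∫⁻ y in K, ENNReal.ofReal (sqrtDet x y) < ⊤ := by
      have hi : IntegrableOn (sqrtDet x) K := hc.integrableOn_compact (isCompact_closedBall _ _)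
      exact hi.lintegral_lt_top
    set A := (extChartAt (𝓡 3) x).source ∩
      extChartAt (𝓡 3) x ⁻¹' ball (extChartAt (𝓡 3) x x) r
    have hA : IsOpen A := (continuousOn_extChartAt x).isOpen_inter_preimage
      (isOpen_extChartAt_source x) isOpen_ball
    refine ⟨A, hA.mem_nhds ⟨mem_extChartAt_source x, by simpa using hr⟩, ?_⟩
    rw [riemannianVolume_apply hA.measurableSet fun z hz ↦ hz.1,
      chartVolume_apply hA.measurableSet]
    refine (lintegral_mono_set fun y hy ↦ ?_).trans_lt hfin
    have h := hy.2.2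
    change extChartAt (𝓡 3) x ((extChartAt (𝓡 3) x).symm y) ∈
      Metric.ball (extChartAt (𝓡 3) x x) r at h
    rw [(extChartAt (𝓡 3) x).right_inv hy.1] at h
    exact ball_subset_closedBall h

instance : Measure.IsOpenPosMeasure (riemannianVolume M) where
  open_pos U hU hne := by
    obtain ⟨x, hx⟩ := hne
    set A := U ∩ (extChartAt (𝓡 3) x).source
    have hA : IsOpen A := hU.inter (isOpen_extChartAt_source x)
    intro h0
    have h1 : riemannianVolume M A = 0 := measure_mono_null inter_subset_left h0
    rw [riemannianVolume_apply hA.measurableSet fun z hz ↦ hz.2,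
      chartVolume_apply hA.measurableSet] at h1
    set s := (extChartAt (𝓡 3) x).target ∩ (extChartAt (𝓡 3) x).symm ⁻¹' A
    have hs : IsOpen s := (continuousOn_extChartAt_symm x).isOpen_inter_preimage
      (isOpen_extChartAt_target x) hA
    have hmem : extChartAt (𝓡 3) x x ∈ s := by
      refine ⟨mem_extChartAt_target x, ?_⟩
      change (extChartAt (𝓡 3) x).symm _ ∈ A
      rw [extChartAt_to_inv]
      exact ⟨hx, mem_extChartAt_source x⟩
    have hm : AEMeasurable (fun y ↦ ENNReal.ofReal (sqrtDet x y)) (volume.restrict s) :=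
      (aemeasurable_sqrtDet x).mono_measure (Measure.restrict_mono inter_subset_left le_rfl)
    rw [lintegral_eq_zero_iff' hm, Filter.EventuallyEq, ae_restrict_iff' hs.measurableSet] at h1
    have h2 : volume s = 0 := by
      refine measure_mono_null (fun y hy ↦ ?_) h1
      simp only [mem_compl_iff, mem_ofPred_eq, Classical.not_imp]
      exact ⟨hy, by simpa using sqrtDet_pos hy.1⟩
    exact hs.measure_ne_zero volume ⟨_, hmem⟩ h2

end volume

section integration
variable {M : Type*} [TopologicalSpace M] [ChartedSpace E3 M] [IsManifold (𝓡 3) ∞ M]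
  [RiemannianBundle (fun x : M ↦ TangentSpace (𝓡 3) x)]
  [IsContMDiffRiemannianBundle (𝓡 3) ∞ E3 (fun x : M ↦ TangentSpace (𝓡 3) x)]

variable {p q x : M} {y : E3} {i j k l : Fin 3} {w : Π q : M, TangentSpace (𝓡 3) q} {u v : M → ℝ}

theorem continuous_divergence (hw : ∀ x, FieldCAt 1 w x) : Continuous (divergence w) := by
  refine continuous_iff_continuousAt.2 fun x ↦ ?_
  obtain ⟨p, y, hy, rfl⟩ := exists_chart_point x
  have h : ContDiffAt ℝ (0 : ℕ∞) (funRep p (divergence w)) y := by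
    have h1 : ContDiffAt ℝ (0 : ℕ∞) (fun z ↦ ∑ k, nablaRep p w k k z) y :=
      ContDiffAt.sum fun k _ ↦ contDiffAt_nablaRep hy (by simpa using hw _)
    refine h1.congr_of_eventuallyEq ?_
    filter_upwards [target_mem_nhds hy] with z hz using divergence_eq hz (hw _)
  exact ((contMDiffAt_funRep_iff hy).2 h).continuousAt

theorem FieldCAt.smul' {n : ℕ∞} (hu : ContMDiffAt (𝓡 3) 𝓘(ℝ) n u x) (hw : FieldCAt n w x) :
    FieldCAt n (fun q ↦ u q • w q) x := by
  obtain ⟨p, y, hy, rfl⟩ := exists_chart_point x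
  refine fieldCAt_of_comp hy fun i ↦ ?_
  have h1 := (contMDiffAt_funRep_iff hy).1 hu
  have h2 := contDiffAt_fieldRep (i := i) hy hw
  refine (h1.mul h2).congr_of_eventuallyEq (Eventually.of_forall fun z ↦ ?_)
  exact congrArg (fun v : E3 ↦ v i) (ContinuousLinearMap.map_smul _ _ _)

theorem mvfderiv_eq_sum (hy : y ∈ (extChartAt (𝓡 3) p).target)
    (hu : MDifferentiableAt (𝓡 3) 𝓘(ℝ) u ((extChartAt (𝓡 3) p).symm y))
    (z : TangentSpace (𝓡 3) ((extChartAt (𝓡 3) p).symm y)) :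
    mvfderiv (𝓡 3) u ((extChartAt (𝓡 3) p).symm y) z =
      ∑ k, inner ℝ z (dualVec p k y) * pd k (funRep p u) y := by
  refine (congrArg _ (vec_eq_sum hy z)).trans ?_
  refine (map_sum _ _ _).trans (Finset.sum_congr rfl fun k _ ↦ ?_)
  refine (ContinuousLinearMap.map_smul _ _ _).trans ?_
  rw [mvfderiv_coordField hy hu]
  rfl

variable [MeasurableSpace M] [BorelSpace M] [CompactSpace M] [T2Space M]

theorem integrable_of_continuous (hu : Continuous u) : Integrable u (riemannianVolume M) :=
  hu.integrable_of_hasCompactSupport (HasCompactSupport.of_compactSpace u)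

theorem setIntegral_source_eq (hu : Continuous u) (h0 : ∀ x, x ∉ (extChartAt (𝓡 3) p).source → u x = 0) :
    ∫ x, u x ∂riemannianVolume M = ∫ y in (extChartAt (𝓡 3) p).target,
      sqrtDet p y * u ((extChartAt (𝓡 3) p).symm y) := by
  rw [← setIntegral_eq_integral_of_forall_compl_eq_zero (s := (extChartAt (𝓡 3) p).source) h0,
    restrict_riemannianVolume, setIntegral_eq_integral_of_forall_compl_eq_zero h0,
    integral_chartVolume hu.aestronglyMeasurable]

theorem mvfderiv_eq_zero (hu : u =ᶠ[𝓝 x] fun _ ↦ 0) (z : TangentSpace (𝓡 3) x) :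
    mvfderiv (𝓡 3) u x z = 0 := by
  have h : MDifferentiableAt (𝓡 3) 𝓘(ℝ) u x := mdifferentiableAt_const.congr_of_eventuallyEq hu
  obtain ⟨p, y, hy, rfl⟩ := exists_chart_point x
  rw [mvfderiv_eq_sum hy h]
  refine Finset.sum_eq_zero fun k _ ↦ ?_
  have h1 : funRep p u =ᶠ[𝓝 y] fun _ ↦ 0 :=
    ((continuousOn_extChartAt_symm p).continuousAt (target_mem_nhds hy)).eventually hu
  rw [pd_congr h1]
  simp [pd]

/-- The divergence theorem for a field supported in the domain of a chart. -/
theorem integral_divergence_smul_eq_zero (hu : ContMDiff (𝓡 3) 𝓘(ℝ) 1 u)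
    (hsupp : tsupport u ⊆ (extChartAt (𝓡 3) p).source) (hw : ∀ x, FieldCAt 1 w x) :
    ∫ x, divergence (fun q ↦ u q • w q) x ∂riemannianVolume M = 0 := by
  have hX : ∀ x, FieldCAt 1 (fun q ↦ u q • w q) x := fun x ↦ FieldCAt.smul' (n := 1) (hu x) (hw x)
  have h0 : ∀ x, x ∉ tsupport u → divergence (fun q ↦ u q • w q) x = 0 := fun x hx ↦ by
    have h1 : u =ᶠ[𝓝 x] fun _ ↦ 0 := notMem_tsupport_iff_eventuallyEq.1 hx
    rw [divergence_smul (hw x).fieldDAt ((hu x).mdifferentiableAt (by simp)), h1.eq_of_nhds]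
    rw [mvfderiv_eq_zero h1]
    simp
  rw [setIntegral_source_eq (p := p) (continuous_divergence hX) fun x hx ↦
    h0 x fun h ↦ hx (hsupp h)]
  rw [setIntegral_congr_fun (isOpen_extChartAt_target (I := 𝓡 3) p).measurableSet
    fun y hy ↦ sqrtDet_mul_divergence hy (hX _)]
  set K := extChartAt (𝓡 3) p '' tsupport u
  have hK : IsCompact K := (isClosed_tsupport u).isCompact.image_of_continuousOn
    ((continuousOn_extChartAt p).mono hsupp)
  have hKU : K ⊆ (extChartAt (𝓡 3) p).target := by
    rintro _ ⟨x, hx, rfl⟩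
    exact (extChartAt (𝓡 3) p).map_source (hsupp hx)
  have hd : ∀ k, ∀ y ∈ (extChartAt (𝓡 3) p).target,
      ContDiffAt ℝ 1 (fun z ↦ sqrtDet p z * fieldRep p (fun q ↦ u q • w q) z k) y := fun k y hy ↦
    ((contDiffAt_sqrtDet hy).of_le (by exact_mod_cast le_top)).mul
      (contDiffAt_fieldRep (n := 1) hy (hX _))
  have hzero : ∀ k, ∀ y ∈ (extChartAt (𝓡 3) p).target, y ∉ K →
      sqrtDet p y * fieldRep p (fun q ↦ u q • w q) y k = 0 := fun k y hy hyK ↦ by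
    have h1 : u ((extChartAt (𝓡 3) p).symm y) = 0 := by
      by_contra h
      exact hyK ⟨_, subset_tsupport _ h, (extChartAt (𝓡 3) p).right_inv hy⟩
    have h2 : fieldRep p (fun q ↦ u q • w q) y k =
        u ((extChartAt (𝓡 3) p).symm y) * fieldRep p w y k :=
      congrArg (fun v : E3 ↦ v k) (ContinuousLinearMap.map_smul _ _ _)
    rw [h2, h1]
    simp
  rw [integral_finsetSum _ fun k _ ↦ integrableOn_pd (isOpen_extChartAt_target p) hK hKU (hd k)
    (hzero k)]
  exact Finset.sum_eq_zero fun k _ ↦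
    setIntegral_pd_eq_zero (isOpen_extChartAt_target p) hK hKU (hd k) (hzero k)

/-- The divergence theorem on a closed manifold. -/
theorem integral_divergence_eq_zero (hw : ∀ x, FieldCAt 1 w x) :
    ∫ x, divergence w x ∂riemannianVolume M = 0 := by
  have hρ : ∀ p : M, ContMDiff (𝓡 3) 𝓘(ℝ) 1 (chartPartition M p) := fun p ↦
    (chartPartition M p).2.of_le (by exact_mod_cast le_top)
  have hd : ∀ x, ∑ p ∈ partitionIndex M, mvfderiv (𝓡 3) (chartPartition M p) x (w x) = 0 := fun x ↦ by
    obtain ⟨r, y, hy, rfl⟩ := exists_chart_point x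
    have h : ∀ p : M, MDifferentiableAt (𝓡 3) 𝓘(ℝ) (chartPartition M p)
        ((extChartAt (𝓡 3) r).symm y) := fun p ↦ (hρ p _).mdifferentiableAt (by simp)
    have h1 : ∀ p : M, DifferentiableAt ℝ (funRep r (chartPartition M p)) y := fun p ↦
      ((contMDiffAt_funRep_iff (n := 1) hy).1 (hρ p _)).differentiableAt (by simp)
    rw [Finset.sum_congr rfl fun p _ ↦ mvfderiv_eq_sum hy (h p) _, Finset.sum_comm]
    refine Finset.sum_eq_zero fun k _ ↦ ?_
    rw [← Finset.mul_sum, ← pd_sum fun p _ ↦ h1 p]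
    have h2 : (fun z ↦ ∑ p ∈ partitionIndex M, funRep r (chartPartition M p) z) = fun _ ↦ 1 :=
      funext fun z ↦ sum_chartPartition _
    rw [h2]
    simp [pd]
  have h1 : ∀ x, divergence w x =
      ∑ p ∈ partitionIndex M, divergence (fun q ↦ chartPartition M p q • w q) x := fun x ↦ by
    have h2 := fun p ↦ divergence_smul (hw x).fieldDAt ((hρ p x).mdifferentiableAt (by simp))
    simp only [h2, Finset.sum_add_distrib, hd, ← Finset.sum_mul, sum_chartPartition]
    ring
  simp only [h1]
  rw [integral_finsetSum _ fun p _ ↦ integrable_of_continuous (continuous_divergence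
    fun x ↦ FieldCAt.smul' (n := 1) (hρ p x) (hw x))]
  exact Finset.sum_eq_zero fun p _ ↦
    integral_divergence_smul_eq_zero (hρ p) (tsupport_chartPartition_subset p) hw

end integration

section green
variable {M : Type*} [TopologicalSpace M] [ChartedSpace E3 M] [IsManifold (𝓡 3) ∞ M]
  [RiemannianBundle (fun x : M ↦ TangentSpace (𝓡 3) x)]
  [IsContMDiffRiemannianBundle (𝓡 3) ∞ E3 (fun x : M ↦ TangentSpace (𝓡 3) x)]

variable {p q x : M} {y : E3} {i j k l : Fin 3} {v w : Π q : M, TangentSpace (𝓡 3) q} {u u' : M → ℝ}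
  {S T : Tensor2 (𝓡 3) M}

theorem continuous_of_funRep (h : ∀ p : M, ∀ y ∈ (extChartAt (𝓡 3) p).target,
    ContinuousAt (funRep p u) y) : Continuous u := by
  refine continuous_iff_continuousAt.2 fun x ↦ ?_
  obtain ⟨p, y, hy, rfl⟩ := exists_chart_point x
  have hq := (extChartAt (𝓡 3) p).map_target hy
  have h1 : ContinuousAt (funRep p u ∘ extChartAt (𝓡 3) p) ((extChartAt (𝓡 3) p).symm y) := by
    refine ContinuousAt.comp ?_ (continuousAt_extChartAt' hq)
    have := h p y hy
    rwa [← (extChartAt (𝓡 3) p).right_inv hy] at this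
  refine h1.congr ?_
  filter_upwards [(isOpen_extChartAt_source (I := 𝓡 3) p).mem_nhds hq] with z hz
  exact congrArg u ((extChartAt (𝓡 3) p).left_inv hz)

theorem continuous_contract (hS : HasCompC 0 S) (hT : HasCompC 0 T) :
    Continuous (contract S T) := by
  refine continuous_of_funRep fun p y hy ↦ ?_
  have h : ContinuousAt (fun z ↦ ∑ a, ∑ b, ∑ c, ∑ d, ginv p z a c * ginv p z b d *
      (tensorRep p S a b z * tensorRep p T c d z)) y :=
    tendsto_finsetSum _ fun a _ ↦ tendsto_finsetSum _ fun b _ ↦ tendsto_finsetSum _ fun c _ ↦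
      tendsto_finsetSum _ fun d _ ↦ ((contDiffAt_ginv hy).continuousAt.mul
        (contDiffAt_ginv hy).continuousAt).mul
        ((hS p y hy a b).continuousAt.mul (hT p y hy c d).continuousAt)
  refine h.congr ?_
  filter_upwards [target_mem_nhds hy] with z hz using (contract_eq hz).symm

theorem HasCompC.of_le {m n : ℕ∞} (h : HasCompC n S) (hmn : m ≤ n) : HasCompC m S :=
  fun p y hy a b ↦ (h p y hy a b).of_le (by exact_mod_cast hmn)

theorem continuous_inner (hv : ∀ x, FieldCAt 0 v x) (hw : ∀ x, FieldCAt 0 w x) :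
    Continuous fun x ↦ (inner ℝ (v x) (w x) : ℝ) :=
  continuous_iff_continuousAt.2 fun x ↦ (contMDiffAt_inner (n := 0) (hv x) (hw x)).continuousAt

theorem contract_self_nonneg (S : Tensor2 (𝓡 3) M) (x : M) : 0 ≤ contract S S x :=
  Finset.sum_nonneg fun _ _ ↦ Finset.sum_nonneg fun _ _ ↦ mul_self_nonneg _

theorem eq_zero_of_contract_self (h : ∀ x, contract S S x = 0) : S = 0 := by
  funext x
  have h1 : ∀ i j, S x (frame (𝓡 3) x i) (frame (𝓡 3) x j) = 0 := fun i j ↦ by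
    have h2 := (Finset.sum_eq_zero_iff_of_nonneg fun i _ ↦
      Finset.sum_nonneg fun _ _ ↦ mul_self_nonneg _).1 (h x) i (Finset.mem_univ i)
    exact mul_self_eq_zero.1 ((Finset.sum_eq_zero_iff_of_nonneg fun _ _ ↦ mul_self_nonneg _).1 h2 j
      (Finset.mem_univ j))
  have h3 : ∀ i, S x (frame (𝓡 3) x i) = 0 := fun i ↦
    ContinuousLinearMap.coe_injective ((frame (𝓡 3) x).toBasis.ext fun j ↦ by simpa using h1 i j)
  exact ContinuousLinearMap.coe_injective ((frame (𝓡 3) x).toBasis.ext fun i ↦ by simpa using h3 i)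

theorem locally_constant_of_grad (hu : ContMDiff (𝓡 3) 𝓘(ℝ) 1 u) (h : ∀ x, grad (𝓡 3) u x = 0) :
    IsLocallyConstant u := by
  refine (IsLocallyConstant.iff_eventually_eq u).2 fun x ↦ ?_
  have hx := mem_extChartAt_target (I := 𝓡 3) x
  obtain ⟨r, hr, hball⟩ := Metric.mem_nhds_iff.1 (target_mem_nhds hx)
  have hd : ∀ y ∈ ball (extChartAt (𝓡 3) x x) r, DifferentiableAt ℝ (funRep x u) y := fun y hy ↦
    ((contMDiffAt_funRep_iff (n := 1) (hball hy)).1 (hu _)).differentiableAt (by simp)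
  have h0 : ∀ y ∈ ball (extChartAt (𝓡 3) x x) r, fderiv ℝ (funRep x u) y = 0 := fun y hy ↦ by
    refine ContinuousLinearMap.coe_injective
      ((EuclideanSpace.basisFun (Fin 3) ℝ).toBasis.ext fun i ↦ ?_)
    have h1 := mvfderiv_coordField (i := i) (hball hy) ((hu _).mdifferentiableAt (by simp))
    rw [← inner_grad, h, inner_zero_left] at h1
    simpa [pd] using h1.symm
  have hc : ∀ y ∈ ball (extChartAt (𝓡 3) x x) r,
      funRep x u y = funRep x u (extChartAt (𝓡 3) x x) := fun y hy ↦
    isOpen_ball.is_const_of_fderiv_eq_zero (convex_ball _ _).isPreconnected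
      (fun z hz ↦ (hd z hz).differentiableWithinAt) h0 hy (mem_ball_self hr)
  filter_upwards [extChartAt_source_mem_nhds (I := 𝓡 3) x,
    (continuousAt_extChartAt (I := 𝓡 3) x).preimage_mem_nhds (ball_mem_nhds _ hr)] with z hz hz'
  have h2 := hc _ hz'
  have h3 : u ((extChartAt (𝓡 3) x).symm (extChartAt (𝓡 3) x z)) =
    u ((extChartAt (𝓡 3) x).symm (extChartAt (𝓡 3) x x)) := h2
  rwa [(extChartAt (𝓡 3) x).left_inv hz, extChartAt_to_inv] at h3

variable [MeasurableSpace M] [BorelSpace M] [CompactSpace M] [T2Space M]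

/-- Green's formula for the Laplacian. -/
theorem integral_laplacian_mul (hu : ContMDiff (𝓡 3) 𝓘(ℝ) 2 u) (hu' : ContMDiff (𝓡 3) 𝓘(ℝ) 1 u') :
    Continuous (laplacian (𝓡 3) u) ∧ ∫ x, laplacian (𝓡 3) u x * u' x ∂riemannianVolume M =
      -∫ x, inner ℝ (grad (𝓡 3) u x) (grad (𝓡 3) u' x) ∂riemannianVolume M := by
  have hg : ∀ x, FieldCAt 1 (grad (𝓡 3) u) x := fieldCAt_grad (n := 1) (by exact_mod_cast hu)
  have hg' : ∀ x, FieldCAt 0 (grad (𝓡 3) u') x := fieldCAt_grad (n := 0) (by simpa using hu')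
  have hc : Continuous (laplacian (𝓡 3) u) := continuous_divergence hg
  have h1 : ∀ x, divergence (fun q ↦ u' q • grad (𝓡 3) u q) x =
      laplacian (𝓡 3) u x * u' x + inner ℝ (grad (𝓡 3) u x) (grad (𝓡 3) u' x) := fun x ↦ by
    rw [divergence_smul (hg x).fieldDAt ((hu' x).mdifferentiableAt (by simp)), ← inner_grad,
      real_inner_comm, mul_comm]
    rfl
  have h2 := integral_divergence_eq_zero (w := fun q ↦ u' q • grad (𝓡 3) u q)
    fun x ↦ FieldCAt.smul' (n := 1) (hu' x) (hg x)
  simp only [h1] at h2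
  rw [integral_add (f := fun x ↦ laplacian (𝓡 3) u x * u' x) (integrable_of_continuous (hc.mul hu'.continuous))
    (integrable_of_continuous (continuous_inner (fun x ↦ (hg x).of_le (by simp)) hg'))] at h2
  exact ⟨hc, eq_neg_of_add_eq_zero_left h2⟩

/-- Green's formula for the divergence of symmetric trace-free tensors. -/
theorem integral_inner_tensorDivergence (hS : HasCompC 1 S) (hsymm : ∀ x a b, S x a b = S x b a)
    (htr : ∀ x, ∑ i, S x (frame (𝓡 3) x i) (frame (𝓡 3) x i) = 0) (hw : ∀ x, FieldCAt 1 w x) :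
    Continuous (fun x ↦ (inner ℝ (tensorDivergence S x) (w x) : ℝ)) ∧
      ∫ x, inner ℝ (tensorDivergence S x) (w x) ∂riemannianVolume M =
      -(1 / 2) * ∫ x, contract S (conformalKilling w) x ∂riemannianVolume M := by
  have h1 : ∀ x, (inner ℝ (tensorDivergence S x) (w x) : ℝ) =
      divergence (sharp S w) x + -(1 / 2) * contract S (conformalKilling w) x := fun x ↦ by
    rw [divergence_sharp hS hw, contract_conformalKilling (hsymm x) (htr x)]
    ring
  have hsh : ∀ x, FieldCAt 1 (sharp S w) x := fieldCAt_sharp (n := 1) hS hw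
  have hc1 := continuous_divergence hsh
  have hc2 : Continuous (contract S (conformalKilling w)) :=
    continuous_contract (hS.of_le (by simp)) (hasCompC_conformalKilling (n := 0) (by simpa using hw))
  simp only [h1]
  refine ⟨hc1.add (hc2.const_mul _), ?_⟩
  rw [integral_add (integrable_of_continuous hc1) (integrable_of_continuous (hc2.const_mul _)),
    integral_divergence_eq_zero hsh, zero_add, integral_const_mul]

theorem eq_zero_of_integral_eq_zero (hu : Continuous u) (h0 : ∀ x, 0 ≤ u x)
    (h : ∫ x, u x ∂riemannianVolume M = 0) : u = 0 := by
  have h1 := (integral_eq_zero_iff_of_nonneg h0 (integrable_of_continuous hu)).1 h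
  exact (hu.ae_eq_iff_eq (μ := riemannianVolume M) continuous_zero).1 h1

theorem exists_eq_const_of_laplacian_eq_zero [ConnectedSpace M] (hu : ContMDiff (𝓡 3) 𝓘(ℝ) 2 u)
    (h : ∀ x, laplacian (𝓡 3) u x = 0) : ∃ c, u = fun _ ↦ c := by
  have hu1 : ContMDiff (𝓡 3) 𝓘(ℝ) 1 u := hu.of_le (by norm_num)
  have hg : ∀ x, FieldCAt 0 (grad (𝓡 3) u) x := fieldCAt_grad (n := 0) (by simpa using hu1)
  have h1 := (integral_laplacian_mul hu hu1).2
  simp only [h, zero_mul, integral_zero] at h1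
  have h2 := eq_zero_of_integral_eq_zero (continuous_inner hg hg)
    (fun x ↦ real_inner_self_nonneg) (neg_eq_zero.1 h1.symm)
  have h3 := locally_constant_of_grad hu1 fun x ↦ inner_self_eq_zero.1 (congrFun h2 x)
  obtain ⟨x⟩ := (inferInstance : Nonempty M)
  exact ⟨u x, funext fun z ↦ h3.apply_eq_of_preconnectedSpace z x⟩

theorem integral_inner_vectorLaplacian (hv : ∀ x, FieldCAt 2 v x) (hw : ∀ x, FieldCAt 1 w x) :
    Continuous (fun x ↦ (inner ℝ (vectorLaplacian v x) (w x) : ℝ)) ∧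
      ∫ x, inner ℝ (vectorLaplacian v x) (w x) ∂riemannianVolume M =
      1 / 2 * ∫ x, contract (conformalKilling v) (conformalKilling w) x ∂riemannianVolume M := by
  have h := integral_inner_tensorDivergence
    (hasCompC_conformalKilling (n := 1) (w := v) (by exact_mod_cast hv))
    (conformalKilling_symm v) (conformalKilling_trace v) hw
  simp only [vectorLaplacian, inner_neg_left]
  refine ⟨h.1.neg, ?_⟩
  rw [integral_neg, h.2]
  ring

theorem eq_zero_of_vectorLaplacian_eq_zero (hCK : NoConformalKilling (𝓡 3) M)
    (hv : ∀ x, FieldCAt 2 v x) (h : vectorLaplacian v = 0) : v = 0 := by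
  have hv1 : ∀ x, FieldCAt 1 v x := fun x ↦ (hv x).of_le (by norm_num)
  refine hCK v hv (eq_zero_of_contract_self fun x ↦ ?_)
  have h1 := (integral_inner_vectorLaplacian hv hv1).2
  simp only [h, Pi.zero_apply, inner_zero_left, integral_zero] at h1
  have hc := hasCompC_conformalKilling (n := 0) (w := v) (by simpa using hv1)
  exact congrFun (eq_zero_of_integral_eq_zero (continuous_contract hc hc)
    (contract_self_nonneg _) (by linarith)) x

end green

section hoelder

variable {U K : Set E3} {α C D : ℝ} {f g : E3 → ℝ}

/-- `f` and its `α`-Hölder quotients are bounded by `C` on `K`. -/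
def HolderBound (K : Set E3) (α C : ℝ) (f : E3 → ℝ) : Prop :=
  (∀ y ∈ K, |f y| ≤ C) ∧ ∀ y ∈ K, ∀ z ∈ K, |f y - f z| ≤ C * dist y z ^ α

theorem HolderBound.mono (hf : HolderBound K α C f) (h : C ≤ D) : HolderBound K α D f :=
  ⟨fun y hy ↦ (hf.1 y hy).trans h, fun y hy z hz ↦ (hf.2 y hy z hz).trans (by gcongr)⟩

theorem HolderBound.congr (hf : HolderBound K α C f) (h : EqOn f g K) : HolderBound K α C g :=
  ⟨fun y hy ↦ h hy ▸ hf.1 y hy, fun y hy z hz ↦ h hy ▸ h hz ▸ hf.2 y hy z hz⟩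

theorem HolderBound.add (hf : HolderBound K α C f) (hg : HolderBound K α D g) :
    HolderBound K α (C + D) fun y ↦ f y + g y := by
  refine ⟨fun y hy ↦ (abs_add_le _ _).trans (add_le_add (hf.1 y hy) (hg.1 y hy)),
    fun y hy z hz ↦ ?_⟩
  rw [add_sub_add_comm, add_mul]
  exact (abs_add_le _ _).trans (add_le_add (hf.2 y hy z hz) (hg.2 y hy z hz))

theorem HolderBound.mul (hf : HolderBound K α C f) (hg : HolderBound K α D g) :
    HolderBound K α (2 * C * D) fun y ↦ f y * g y := by
  refine ⟨fun y hy ↦ ?_, fun y hy z hz ↦ ?_⟩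
  · have h1 := mul_le_mul (hf.1 y hy) (hg.1 y hy) (abs_nonneg _) ((abs_nonneg _).trans (hf.1 y hy))
    rw [abs_mul]
    nlinarith [mul_nonneg (abs_nonneg (f y)) (abs_nonneg (g y))]
  · have h1 := mul_le_mul (hf.1 y hy) (hg.2 y hy z hz) (abs_nonneg _)
      ((abs_nonneg _).trans (hf.1 y hy))
    have h2 := mul_le_mul (hg.1 z hz) (hf.2 y hy z hz) (abs_nonneg _)
      ((abs_nonneg _).trans (hg.1 z hz))
    rw [← abs_mul] at h1 h2
    calc |f y * g y - f z * g z| = |f y * (g y - g z) + g z * (f y - f z)| := by ring_nf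
      _ ≤ _ := abs_add_le _ _
      _ ≤ 2 * C * D * dist y z ^ α := by linarith

theorem HolderBound.const (c : ℝ) : HolderBound K α |c| fun _ ↦ c :=
  ⟨fun _ _ ↦ le_rfl, fun y _ z _ ↦ by simp; positivity⟩

theorem HolderBound.inv {m : ℝ} (hm : 0 < m) (hf : HolderBound K α C f) (h : ∀ y ∈ K, m ≤ |f y|) :
    HolderBound K α (m⁻¹ + C * (m⁻¹ * m⁻¹)) fun y ↦ (f y)⁻¹ := by
  have hinv : ∀ y ∈ K, |(f y)⁻¹| ≤ m⁻¹ := fun y hy ↦ by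
    rw [abs_inv]
    exact inv_anti₀ hm (h y hy)
  have hne : ∀ y ∈ K, f y ≠ 0 := fun y hy h0 ↦ by
    have := h y hy
    rw [h0, abs_zero] at this
    exact hm.not_ge this
  refine ⟨fun y hy ↦ ?_, fun y hy z hz ↦ ?_⟩
  · have := (abs_nonneg _).trans (hf.1 y hy)
    exact (hinv y hy).trans (le_add_of_nonneg_right (by positivity))
  · have h1 : (f y)⁻¹ - (f z)⁻¹ = -((f y - f z) * ((f y)⁻¹ * (f z)⁻¹)) := by
      field_simp [hne y hy, hne z hz]
      ring
    have hd : 0 ≤ dist y z ^ α := by positivity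
    have h2 := mul_le_mul (hinv y hy) (hinv z hz) (abs_nonneg _) (by positivity)
    have h3 := mul_le_mul (hf.2 y hy z hz) h2 (by positivity) ((abs_nonneg _).trans (hf.2 y hy z hz))
    rw [h1, abs_neg, abs_mul, abs_mul]
    have h4 : 0 ≤ m⁻¹ * dist y z ^ α := by positivity
    linarith

theorem abs_fderiv_apply_le {y : E3} (h : ∀ i, |pd i f y| ≤ C) (v : E3) :
    ‖fderiv ℝ f y v‖ ≤ 3 * C * ‖v‖ := by
  have hv : v = ∑ i, v i • (EuclideanSpace.single i 1 : E3) := by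
    have := (EuclideanSpace.basisFun (Fin 3) ℝ).sum_repr v
    simpa using this.symm
  have h1 : fderiv ℝ f y v = ∑ i, v i * pd i f y := by
    conv_lhs => rw [hv, map_sum]
    exact Finset.sum_congr rfl fun i _ ↦ by rw [map_smul]; rfl
  rw [h1]
  have h2 : ∀ i ∈ Finset.univ, ‖v i * pd i f y‖ ≤ ‖v‖ * C := fun i _ ↦ by
    rw [norm_mul]
    exact mul_le_mul (PiLp.norm_apply_le v i) (h i) (norm_nonneg _) (norm_nonneg _)
  refine (norm_sum_le_of_le _ h2).trans (le_of_eq ?_)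
  simp
  ring

/-- On a convex set, functions with bounded derivatives are Hölder continuous. -/
theorem HolderBound.of_pd (hα : 0 < α) (hα' : α ≤ 1) (hK : Convex ℝ K)
    (hf : ∀ y ∈ K, DifferentiableAt ℝ f y) (h0 : ∀ y ∈ K, |f y| ≤ C)
    (h1 : ∀ i, ∀ y ∈ K, |pd i f y| ≤ C) : HolderBound K α (3 * C) f := by
  have hC : ∀ y ∈ K, 0 ≤ C := fun y hy ↦ (abs_nonneg _).trans (h0 y hy)
  refine ⟨fun y hy ↦ (h0 y hy).trans (by linarith [hC y hy]), fun y hy z hz ↦ ?_⟩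
  have hC0 := hC y hy
  have hl : ‖f y - f z‖ ≤ 3 * C * ‖y - z‖ :=
    hK.norm_image_sub_le_of_norm_hasFDerivWithin_le (f' := fderiv ℝ f)
      (fun x hx ↦ (hf x hx).hasFDerivAt.hasFDerivWithinAt)
      (fun x hx ↦ ContinuousLinearMap.opNorm_le_bound _ (by positivity)
        (abs_fderiv_apply_le fun i ↦ h1 i x hx)) hz hy
  rw [← dist_eq_norm y z] at hl
  rcases le_total (dist y z) 1 with h | h
  · refine hl.trans (mul_le_mul_of_nonneg_left ?_ (by positivity))
    simpa using Real.rpow_le_rpow_of_exponent_ge' dist_nonneg h hα.le hα'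
  · have h2 : 1 ≤ dist y z ^ α := Real.one_le_rpow h hα.le
    have h3 : |f y - f z| ≤ C + C := (abs_sub _ _).trans (add_le_add (h0 y hy) (h0 z hz))
    nlinarith

theorem exists_holderBound (hα : 0 < α) (hα' : α ≤ 1) (hK : Convex ℝ K) (hKc : IsCompact K)
    (hf : ∀ y ∈ K, ContDiffAt ℝ 1 f y) : ∃ C, 0 ≤ C ∧ HolderBound K α C f := by
  have hc : ContinuousOn f K := fun y hy ↦ (hf y hy).continuousAt.continuousWithinAt
  have hp : ∀ i, ContinuousOn (pd i f) K := fun i y hy ↦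
    (contDiffAt_pd (m := 0) (hf y hy) (by simp)).continuousAt.continuousWithinAt
  obtain ⟨A, hA⟩ := hKc.exists_bound_of_continuousOn hc
  choose B hB using fun i ↦ hKc.exists_bound_of_continuousOn (hp i)
  have hle : ∀ i, |B i| ≤ |A| + ∑ i, |B i| := fun i ↦
    (Finset.single_le_sum (f := fun i ↦ |B i|) (fun _ _ ↦ abs_nonneg _) (Finset.mem_univ i)).trans
      (le_add_of_nonneg_left (abs_nonneg A))
  refine ⟨3 * (|A| + ∑ i, |B i|), by positivity, HolderBound.of_pd hα hα' hK
    (fun y hy ↦ (hf y hy).differentiableAt (by simp)) (fun y hy ↦ ?_) fun i y hy ↦ ?_⟩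
  · exact ((hA y hy).trans (le_abs_self A)).trans
      (le_add_of_nonneg_right (Finset.sum_nonneg fun _ _ ↦ abs_nonneg _))
  · exact ((hB i y hy).trans (le_abs_self _)).trans (hle i)

/-- A family of functions on `U` that is continuous and, on `K`, Hölder bounded by a multiple of the
gauge `N`. -/
def HolderFamily {X : Type*} (U K : Set E3) (α : ℝ) (N : X → ℝ) (O : X → E3 → ℝ) : Prop :=
  (∀ v, ContinuousOn (O v) U) ∧ ∃ C, 0 ≤ C ∧ ∀ v, HolderBound K α (C * N v) (O v)

namespace HolderFamily

variable {X Y : Type*} {N N' : X → ℝ} {O P : X → E3 → ℝ}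

theorem add (hO : HolderFamily U K α N O) (hP : HolderFamily U K α N P) :
    HolderFamily U K α N fun v y ↦ O v y + P v y := by
  obtain ⟨h1, C, hC, h2⟩ := hO
  obtain ⟨h3, D, hD, h4⟩ := hP
  exact ⟨fun v ↦ (h1 v).add (h3 v), C + D, by positivity, fun v ↦ by
    rw [add_mul]
    exact (h2 v).add (h4 v)⟩

theorem mul (hO : HolderFamily U K α N O) (hP : HolderFamily U K α N' P) :
    HolderFamily U K α (fun v ↦ N v * N' v) fun v y ↦ O v y * P v y := by
  obtain ⟨h1, C, hC, h2⟩ := hO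
  obtain ⟨h3, D, hD, h4⟩ := hP
  exact ⟨fun v ↦ (h1 v).mul (h3 v), 2 * C * D, by positivity, fun v ↦
    ((h2 v).mul (h4 v)).mono (le_of_eq (by ring))⟩

theorem const (c : ℝ) : HolderFamily U K α (fun _ : X ↦ 1) fun _ _ ↦ c :=
  ⟨fun _ ↦ continuousOn_const, |c|, abs_nonneg c, fun _ ↦ by simpa using HolderBound.const c⟩

theorem const_mul (c : ℝ) (hO : HolderFamily U K α N O) :
    HolderFamily U K α N fun v y ↦ c * O v y := by
  simpa using (const c).mul hO

theorem neg (hO : HolderFamily U K α N O) : HolderFamily U K α N fun v y ↦ -O v y := by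
  simpa using hO.const_mul (-1)

theorem sub (hO : HolderFamily U K α N O) (hP : HolderFamily U K α N P) :
    HolderFamily U K α N fun v y ↦ O v y - P v y := by
  simpa [sub_eq_add_neg] using hO.add hP.neg

theorem sum {ι : Type*} {s : Finset ι} {O : ι → X → E3 → ℝ}
    (hO : ∀ i ∈ s, HolderFamily U K α N (O i)) :
    HolderFamily U K α N fun v y ↦ ∑ i ∈ s, O i v y := by
  classical
  induction s using Finset.induction_on with
  | empty =>
    refine ⟨fun _ ↦ by simpa using continuousOn_const, 0, le_rfl, fun v ↦ ?_⟩
    simpa using HolderBound.const (K := K) (α := α) 0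
  | insert i s hi ih =>
    simp only [Finset.sum_insert hi]
    exact (hO i (Finset.mem_insert_self i s)).add
      (ih fun j hj ↦ hO j (Finset.mem_insert_of_mem hj))

theorem congr (hO : HolderFamily U K α N O) (hKU : K ⊆ U) (h : ∀ v, EqOn (O v) (P v) U) :
    HolderFamily U K α N P := by
  obtain ⟨h1, C, hC, h2⟩ := hO
  exact ⟨fun v ↦ (h1 v).congr (h v).symm, C, hC, fun v ↦ (h2 v).congr ((h v).mono hKU)⟩

theorem comp (hO : HolderFamily U K α N O) (g : Y → X) :
    HolderFamily U K α (fun v ↦ N (g v)) fun v ↦ O (g v) :=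
  ⟨fun _ ↦ hO.1 _, hO.2.choose, hO.2.choose_spec.1, fun _ ↦ hO.2.choose_spec.2 _⟩

theorem gauge_mono {c : ℝ} (hc : 0 ≤ c) (hO : HolderFamily U K α N O)
    (h : ∀ v, N v ≤ c * N' v) : HolderFamily U K α N' O := by
  obtain ⟨h1, C, hC, h2⟩ := hO
  refine ⟨h1, C * c, by positivity, fun v ↦ (h2 v).mono ?_⟩
  rw [mul_assoc]
  exact mul_le_mul_of_nonneg_left (h v) hC

theorem of_contDiffAt (hα : 0 < α) (hα' : α ≤ 1) (hK : Convex ℝ K) (hKc : IsCompact K)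
    (hKU : K ⊆ U) (hf : ∀ y ∈ U, ContDiffAt ℝ 1 f y) :
    HolderFamily U K α (fun _ : X ↦ 1) fun _ ↦ f := by
  obtain ⟨C, hC, h⟩ := exists_holderBound hα hα' hK hKc fun y hy ↦ hf y (hKU hy)
  exact ⟨fun _ y hy ↦ (hf y hy).continuousAt.continuousWithinAt, C, hC, fun _ ↦ by simpa using h⟩

theorem inv {m : ℝ} (hm : 0 < m) (hO : HolderFamily U K α (fun _ ↦ 1) O)
    (h0 : ∀ v, ∀ y ∈ U, O v y ≠ 0) (h : ∀ v, ∀ y ∈ K, m ≤ |O v y|) :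
    HolderFamily U K α (fun _ ↦ 1) fun v y ↦ (O v y)⁻¹ := by
  obtain ⟨h1, C, hC, h2⟩ := hO
  refine ⟨fun v ↦ (h1 v).inv₀ (h0 v), m⁻¹ + C * (m⁻¹ * m⁻¹), by positivity, fun v ↦ ?_⟩
  simpa using (by simpa using h2 v : HolderBound K α C (O v)).inv hm (h v)

theorem pow (hO : HolderFamily U K α (fun _ ↦ 1) O) (n : ℕ) :
    HolderFamily U K α (fun _ ↦ 1) fun v y ↦ O v y ^ n := by
  induction n with
  | zero => simpa using const 1
  | succ n ih => simpa [pow_succ] using ih.mul hO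

end HolderFamily

/-- A family of functions on `U` that is, together with its first partial derivatives, a
`HolderFamily`. -/
structure HolderFamilyC1 {X : Type*} (U K : Set E3) (α : ℝ) (N : X → ℝ) (O : X → E3 → ℝ) :
    Prop where
  contDiffAt : ∀ v, ∀ y ∈ U, ContDiffAt ℝ 1 (O v) y
  family : HolderFamily U K α N O
  pd_family : ∀ i, HolderFamily U K α N fun v ↦ pd i (O v)

namespace HolderFamilyC1

variable {X Y : Type*} {N N' : X → ℝ} {O P : X → E3 → ℝ}

theorem differentiableAt (hO : HolderFamilyC1 U K α N O) (v : X) {y : E3} (hy : y ∈ U) :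
    DifferentiableAt ℝ (O v) y :=
  (hO.contDiffAt v y hy).differentiableAt (by simp)

theorem add (hKU : K ⊆ U) (hO : HolderFamilyC1 U K α N O) (hP : HolderFamilyC1 U K α N P) :
    HolderFamilyC1 U K α N fun v y ↦ O v y + P v y where
  contDiffAt v y hy := (hO.contDiffAt v y hy).add (hP.contDiffAt v y hy)
  family := hO.family.add hP.family
  pd_family i := ((hO.pd_family i).add (hP.pd_family i)).congr hKU fun v _ hy ↦
    (pd_add (hO.differentiableAt v hy) (hP.differentiableAt v hy)).symm

theorem mul (hKU : K ⊆ U) (hO : HolderFamilyC1 U K α N O) (hP : HolderFamilyC1 U K α N' P) :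
    HolderFamilyC1 U K α (fun v ↦ N v * N' v) fun v y ↦ O v y * P v y where
  contDiffAt v y hy := (hO.contDiffAt v y hy).mul (hP.contDiffAt v y hy)
  family := hO.family.mul hP.family
  pd_family i := by
    refine ((hO.family.mul (hP.pd_family i)).add ?_).congr hKU fun v _ hy ↦
      (pd_mul (hO.differentiableAt v hy) (hP.differentiableAt v hy)).symm
    simpa [mul_comm] using hP.family.mul (hO.pd_family i)

theorem sum {ι : Type*} {s : Finset ι} {O : ι → X → E3 → ℝ} (hKU : K ⊆ U)
    (hO : ∀ i ∈ s, HolderFamilyC1 U K α N (O i)) :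
    HolderFamilyC1 U K α N fun v y ↦ ∑ i ∈ s, O i v y where
  contDiffAt v y hy := ContDiffAt.sum fun i hi ↦ (hO i hi).contDiffAt v y hy
  family := HolderFamily.sum fun i hi ↦ (hO i hi).family
  pd_family j := (HolderFamily.sum fun i hi ↦ (hO i hi).pd_family j).congr hKU fun v _ hy ↦
    (pd_sum fun i hi ↦ (hO i hi).differentiableAt v hy).symm

theorem congr (hU : IsOpen U) (hO : HolderFamilyC1 U K α N O) (hKU : K ⊆ U)
    (h : ∀ v, EqOn (O v) (P v) U) : HolderFamilyC1 U K α N P := by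
  have h' : ∀ v, ∀ y ∈ U, O v =ᶠ[𝓝 y] P v := fun v y hy ↦ by
    filter_upwards [hU.mem_nhds hy] with z hz using h v hz
  exact
  { contDiffAt := fun v y hy ↦ (hO.contDiffAt v y hy).congr_of_eventuallyEq (h' v y hy).symm
    family := hO.family.congr hKU h
    pd_family := fun i ↦ (hO.pd_family i).congr hKU fun v y hy ↦ pd_congr (h' v y hy) }

theorem of_contDiffAt (hα : 0 < α) (hα' : α ≤ 1) (hK : Convex ℝ K) (hKc : IsCompact K)
    (hKU : K ⊆ U) (hf : ∀ y ∈ U, ContDiffAt ℝ 2 f y) :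
    HolderFamilyC1 U K α (fun _ : X ↦ 1) fun _ ↦ f where
  contDiffAt _ y hy := (hf y hy).of_le (by norm_num)
  family := HolderFamily.of_contDiffAt hα hα' hK hKc hKU fun y hy ↦ (hf y hy).of_le (by norm_num)
  pd_family i := HolderFamily.of_contDiffAt hα hα' hK hKc hKU fun y hy ↦
    contDiffAt_pd (hf y hy) (by norm_num)

/-- A family with bounded values is determined by its partial derivatives. -/
theorem of_pd (hα : 0 < α) (hα' : α ≤ 1) (hK : Convex ℝ K) (hKU : K ⊆ U)
    (hO : ∀ v, ∀ y ∈ U, ContDiffAt ℝ 1 (O v) y) {C : ℝ} (hC : 0 ≤ C)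
    (h0 : ∀ v, ∀ y ∈ K, |O v y| ≤ C * N v)
    (h1 : ∀ i v, HolderBound K α (C * N v) (pd i (O v))) : HolderFamilyC1 U K α N O where
  contDiffAt := hO
  family := ⟨fun v y hy ↦ (hO v y hy).continuousAt.continuousWithinAt, 3 * C, by positivity,
    fun v ↦ by
      rw [mul_assoc]
      exact HolderBound.of_pd hα hα' hK (fun y hy ↦ (hO v y (hKU hy)).differentiableAt (by simp))
        (h0 v) fun i y hy ↦ (h1 i v).1 y hy⟩
  pd_family i := ⟨fun v y hy ↦
    (contDiffAt_pd (m := 0) (hO v y hy) (by simp)).continuousAt.continuousWithinAt, C, hC, h1 i⟩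

end HolderFamilyC1

end hoelder

section spaces

variable {M : Type*} [TopologicalSpace M] [ChartedSpace E3 M] {F V : Type*} [NormedAddCommGroup F]
  [NormedSpace ℝ F] [AddCommGroup V] [Module ℝ V] {𝒞 : HolderCover M} {T : M → V →ₗ[ℝ] (E3 → F)}
  {k : ℕ} {α : ℝ} {p : M} {y z : E3}

namespace HolderSpace

theorem holderENorm_le (v : HolderSpace 𝒞 T k α) (hp : p ∈ 𝒞.centers) :
    holderENorm k α (𝒞.ball p) (T p v.val) ≤ ENNReal.ofReal ‖v‖ := by
  change _ ≤ ENNReal.ofReal (atlasENorm 𝒞 T k α v.val).toReal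
  rw [ENNReal.ofReal_toReal v.property.2.ne]
  exact Finset.single_le_sum (f := fun p ↦ holderENorm k α (𝒞.ball p) (T p v.val))
    (fun _ _ ↦ zero_le) hp

theorem norm_nonneg' (v : HolderSpace 𝒞 T k α) : 0 ≤ ‖v‖ := ENNReal.toReal_nonneg

theorem norm_iteratedFDeriv_le (v : HolderSpace 𝒞 T k α) (hp : p ∈ 𝒞.centers) {j : ℕ} (hj : j ≤ k)
    (hy : y ∈ 𝒞.ball p) : ‖iteratedFDeriv ℝ j (T p v.val) y‖ ≤ ‖v‖ := by
  have h1 : ‖iteratedFDeriv ℝ j (T p v.val) y‖ₑ ≤ ENNReal.ofReal ‖v‖ := by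
    refine le_trans ?_ (holderENorm_le v hp)
    refine le_trans ?_ le_self_add
    refine le_trans ?_ (Finset.single_le_sum
      (f := fun j ↦ ⨆ y ∈ 𝒞.ball p, ‖iteratedFDeriv ℝ j (T p v.val) y‖ₑ)
      (fun _ _ ↦ zero_le) (Finset.mem_range.2 (Nat.lt_succ_of_le hj)))
    exact le_iSup₂ (f := fun y (_ : y ∈ 𝒞.ball p) ↦ ‖iteratedFDeriv ℝ j (T p v.val) y‖ₑ) y hy
  rwa [← ofReal_norm, ENNReal.ofReal_le_ofReal_iff v.norm_nonneg'] at h1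

theorem norm_iteratedFDeriv_sub_le (v : HolderSpace 𝒞 T k α) (hp : p ∈ 𝒞.centers)
    (hy : y ∈ 𝒞.ball p) (hz : z ∈ 𝒞.ball p) :
    ‖iteratedFDeriv ℝ k (T p v.val) y - iteratedFDeriv ℝ k (T p v.val) z‖ ≤
      ‖v‖ * dist y z ^ α := by
  rcases eq_or_ne y z with rfl | hne
  · simpa using mul_nonneg v.norm_nonneg' (Real.rpow_nonneg le_rfl α)
  have hd : 0 < dist y z ^ α := Real.rpow_pos_of_pos (dist_pos.2 hne) _
  have h1 : ‖iteratedFDeriv ℝ k (T p v.val) y - iteratedFDeriv ℝ k (T p v.val) z‖ₑ /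
      ENNReal.ofReal (dist y z ^ α) ≤ ENNReal.ofReal ‖v‖ := by
    refine le_trans ?_ (holderENorm_le v hp)
    refine le_trans ?_ le_add_self
    exact le_iSup₂_of_le y hy (le_iSup₂_of_le z hz le_rfl)
  rwa [ENNReal.div_le_iff (by simpa using hd) ENNReal.ofReal_ne_top,
    ← ENNReal.ofReal_mul v.norm_nonneg', ← ofReal_norm,
    ENNReal.ofReal_le_ofReal_iff (mul_nonneg v.norm_nonneg' hd.le)] at h1

theorem holderENorm_zero_le {f : E3 → F} {K : Set E3} {C : ℝ} (h0 : ∀ y ∈ K, ‖f y‖ ≤ C)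
    (h1 : ∀ y ∈ K, ∀ z ∈ K, ‖f y - f z‖ ≤ C * dist y z ^ α) :
    holderENorm 0 α K f ≤ ENNReal.ofReal C + ENNReal.ofReal C := by
  refine add_le_add ?_ ?_
  · rw [Finset.sum_range_one]
    refine iSup₂_le fun y hy ↦ ?_
    rw [← ofReal_norm, norm_iteratedFDeriv_zero]
    exact ENNReal.ofReal_le_ofReal (h0 y hy)
  · refine iSup₂_le fun y hy ↦ iSup₂_le fun z hz ↦ ENNReal.div_le_of_le_mul ?_
    have hC : 0 ≤ C := (norm_nonneg _).trans (h0 y hy)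
    rw [← ENNReal.ofReal_mul hC, ← ofReal_norm]
    refine ENNReal.ofReal_le_ofReal ?_
    have h2 : ‖iteratedFDeriv ℝ 0 f y - iteratedFDeriv ℝ 0 f z‖ = ‖f y - f z‖ := by
      rw [iteratedFDeriv_zero_eq_comp]
      simp only [Function.comp_apply, ← map_sub, LinearIsometryEquiv.norm_map]
    rw [h2]
    exact h1 y hy z hz

/-- A coordinate criterion for membership in `C^{0,α}`, with a norm bound. -/
theorem exists_atlasENorm_le {ι : Type*} [Fintype ι] {ℓ : ι → F →L[ℝ] ℝ} {b : ι → F}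
    (hb : ∀ i, ‖b i‖ ≤ 1) (hℓ : ∀ v, v = ∑ i, ℓ i v • b i) {X : Type*} {N : X → ℝ}
    (hN : ∀ x, 0 ≤ N x) {A : X → V}
    (h : ∀ p ∈ 𝒞.centers, ∀ i, HolderFamily (extChartAt (𝓡 3) p).target (𝒞.ball p) α N
      fun x y ↦ ℓ i (T p (A x) y)) :
    ∃ C, 0 ≤ C ∧ ∀ x, A x ∈ holderSubmodule 𝒞 T 0 α ∧
      atlasENorm 𝒞 T 0 α (A x) ≤ ENNReal.ofReal (C * N x) := by
  have hc : ∀ p ∈ 𝒞.centers, ∀ x, ContinuousOn (T p (A x)) (extChartAt (𝓡 3) p).target :=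
    fun p hp x ↦ by
      have h1 : ContinuousOn (fun y ↦ ∑ i, ℓ i (T p (A x) y) • b i) (extChartAt (𝓡 3) p).target :=
        continuousOn_finsetSum _ fun i _ ↦ ((h p hp i).1 x).smul continuousOn_const
      exact h1.congr fun y _ ↦ hℓ _
  choose! C hC hbd using fun p hp i ↦ (h p hp i).2
  set D : M → ℝ := fun p ↦ ∑ i, C p i
  have hD : ∀ p ∈ 𝒞.centers, 0 ≤ D p := fun p hp ↦ Finset.sum_nonneg fun i _ ↦ hC p hp i
  have hle : ∀ c : ι → ℝ, ‖∑ i, c i • b i‖ ≤ ∑ i, |c i| := fun c ↦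
    norm_sum_le_of_le _ fun i _ ↦ by
      rw [norm_smul]
      exact mul_le_of_le_one_right (abs_nonneg _) (hb i)
  have hp1 : ∀ p ∈ 𝒞.centers, ∀ x, ∀ y ∈ 𝒞.ball p, ‖T p (A x) y‖ ≤ D p * N x :=
    fun p hp x y hy ↦ by
      rw [hℓ (T p (A x) y), Finset.sum_mul]
      exact (hle _).trans (Finset.sum_le_sum fun i _ ↦ (hbd p hp i x).1 y hy)
  have hp2 : ∀ p ∈ 𝒞.centers, ∀ x, ∀ y ∈ 𝒞.ball p, ∀ z ∈ 𝒞.ball p,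
      ‖T p (A x) y - T p (A x) z‖ ≤ D p * N x * dist y z ^ α := fun p hp x y hy z hz ↦ by
    rw [hℓ (T p (A x) y - T p (A x) z), Finset.sum_mul, Finset.sum_mul]
    refine (hle _).trans (Finset.sum_le_sum fun i _ ↦ ?_)
    rw [map_sub]
    exact (hbd p hp i x).2 y hy z hz
  have hfin : ∀ x, atlasENorm 𝒞 T 0 α (A x) ≤
      ENNReal.ofReal ((∑ p ∈ 𝒞.centers, (D p + D p)) * N x) := fun x ↦ by
    rw [Finset.sum_mul, ENNReal.ofReal_sum_of_nonneg fun p hp ↦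
      mul_nonneg (add_nonneg (hD p hp) (hD p hp)) (hN x)]
    refine Finset.sum_le_sum fun p hp ↦ ?_
    rw [add_mul, ENNReal.ofReal_add (mul_nonneg (hD p hp) (hN x)) (mul_nonneg (hD p hp) (hN x))]
    exact holderENorm_zero_le (hp1 p hp x) (hp2 p hp x)
  exact ⟨_, Finset.sum_nonneg fun p hp ↦ add_nonneg (hD p hp) (hD p hp), fun x ↦
    ⟨⟨fun p hp ↦ contDiffOn_zero.2 (hc p hp x), (hfin x).trans_lt ENNReal.ofReal_lt_top⟩, hfin x⟩⟩

theorem ofVal_val {v : V} (h : v ∈ holderSubmodule 𝒞 T k α) :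
    (ofVal v : HolderSpace 𝒞 T k α).val = v :=
  congrArg val (dif_pos h)

theorem contDiffAt (v : HolderSpace 𝒞 T k α) (hp : p ∈ 𝒞.centers)
    (hy : y ∈ (extChartAt (𝓡 3) p).target) : ContDiffAt ℝ k (T p v.val) y :=
  (v.property.1 p hp).contDiffAt ((isOpen_extChartAt_target p).mem_nhds hy)

theorem convex_ball (𝒞 : HolderCover M) (p : M) : Convex ℝ (𝒞.ball p) := convex_closedBall _ _

theorem isCompact_ball (𝒞 : HolderCover M) (p : M) : IsCompact (𝒞.ball p) := isCompact_closedBall _ _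

theorem pd_comp {f : E3 → F} (hf : DifferentiableAt ℝ f y) (ℓ : F →L[ℝ] ℝ) (i : Fin 3) :
    pd i (fun y ↦ ℓ (f y)) y = ℓ (iteratedFDeriv ℝ 1 f y fun _ ↦ EuclideanSpace.single i 1) := by
  have h := (ℓ.hasFDerivAt.comp y hf.hasFDerivAt).fderiv
  rw [iteratedFDeriv_one_apply, pd]
  exact DFunLike.congr_fun h _

theorem pd_pd_comp {f : E3 → F} (hf : ContDiffAt ℝ 2 f y) (ℓ : F →L[ℝ] ℝ) (i j : Fin 3) :
    pd i (pd j fun y ↦ ℓ (f y)) y = ℓ (iteratedFDeriv ℝ 2 f y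
      ![EuclideanSpace.single i 1, EuclideanSpace.single j 1]) := by
  have h1 : (pd j fun y ↦ ℓ (f y)) =ᶠ[𝓝 y] fun y ↦ ℓ (fderiv ℝ f y (EuclideanSpace.single j 1)) := by
    filter_upwards [hf.eventually (by simp)] with z hz
    rw [pd_comp (hz.differentiableAt (by simp)), iteratedFDeriv_one_apply]
  have h2 : DifferentiableAt ℝ (fderiv ℝ f) y :=
    (hf.fderiv_right (m := 1) (by norm_num)).differentiableAt (by simp)
  have h3 := (ℓ.hasFDerivAt.comp y (h2.hasFDerivAt.clm_apply
    (hasFDerivAt_const (EuclideanSpace.single j (1 : ℝ)) y))).fderiv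
  rw [pd_congr h1, iteratedFDeriv_two_apply, pd]
  refine (DFunLike.congr_fun h3 _).trans ?_
  simp

theorem abs_apply_le {G : Type*} [NormedAddCommGroup G] [NormedSpace ℝ G] {n : ℕ}
    (A : G [×n]→L[ℝ] F) {ℓ : F →L[ℝ] ℝ} (hℓ : ∀ v, |ℓ v| ≤ ‖v‖) {m : Fin n → G}
    (hm : ∀ i, ‖m i‖ ≤ 1) : |ℓ (A m)| ≤ ‖A‖ :=
  (hℓ _).trans ((A.le_opNorm m).trans (mul_le_of_le_one_right (norm_nonneg _)
    (Finset.prod_le_one (fun _ _ ↦ norm_nonneg _) fun i _ ↦ hm i)))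

theorem norm_single (i : Fin 3) : ‖(EuclideanSpace.single i 1 : E3)‖ ≤ 1 := by simp

theorem holderFamilyC1_one (hα : 0 < α) (hα' : α ≤ 1) (hp : p ∈ 𝒞.centers) {ℓ : F →L[ℝ] ℝ}
    (hℓ : ∀ v, |ℓ v| ≤ ‖v‖) :
    HolderFamilyC1 (extChartAt (𝓡 3) p).target (𝒞.ball p) α (fun v : HolderSpace 𝒞 T 1 α ↦ ‖v‖)
      fun v y ↦ ℓ (T p v.val y) := by
  have hsub := 𝒞.closedBall_subset p hp
  refine HolderFamilyC1.of_pd hα hα' (convex_ball 𝒞 p) hsub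
    (fun v y hy ↦ ℓ.contDiff.contDiffAt.comp y (v.contDiffAt hp hy)) zero_le_one
    (fun v y hy ↦ ?_) fun i v ↦ ⟨fun y hy ↦ ?_, fun y hy z hz ↦ ?_⟩
  · have := v.norm_iteratedFDeriv_le hp (zero_le_one) hy
    rw [norm_iteratedFDeriv_zero] at this
    rw [one_mul]
    exact (hℓ _).trans this
  · rw [one_mul, pd_comp ((v.contDiffAt hp (hsub hy)).differentiableAt (by simp))]
    exact (abs_apply_le _ hℓ fun _ ↦ norm_single i).trans (v.norm_iteratedFDeriv_le hp le_rfl hy)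
  · rw [one_mul, pd_comp ((v.contDiffAt hp (hsub hy)).differentiableAt (by simp)),
      pd_comp ((v.contDiffAt hp (hsub hz)).differentiableAt (by simp)), ← map_sub,
      ← sub_apply]
    exact (abs_apply_le _ hℓ fun _ ↦ norm_single i).trans (v.norm_iteratedFDeriv_sub_le hp hy hz)

theorem holderFamilyC1_pd_two (hα : 0 < α) (hα' : α ≤ 1) (hp : p ∈ 𝒞.centers) {ℓ : F →L[ℝ] ℝ}
    (hℓ : ∀ v, |ℓ v| ≤ ‖v‖) (j : Fin 3) :
    HolderFamilyC1 (extChartAt (𝓡 3) p).target (𝒞.ball p) α (fun v : HolderSpace 𝒞 T 2 α ↦ ‖v‖)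
      fun v ↦ pd j fun y ↦ ℓ (T p v.val y) := by
  have hsub := 𝒞.closedBall_subset p hp
  have hm : ∀ i, ∀ a : Fin 2, ‖(![EuclideanSpace.single i 1, EuclideanSpace.single j 1] :
      Fin 2 → E3) a‖ ≤ 1 := fun i a ↦ by
    fin_cases a
    · exact norm_single i
    · exact norm_single j
  refine HolderFamilyC1.of_pd hα hα' (convex_ball 𝒞 p) hsub
    (fun v y hy ↦ contDiffAt_pd (n := 2) (ℓ.contDiff.contDiffAt.comp y (v.contDiffAt hp hy))
      (by norm_num)) zero_le_one
    (fun v y hy ↦ ?_) fun i v ↦ ⟨fun y hy ↦ ?_, fun y hy z hz ↦ ?_⟩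
  · rw [one_mul, pd_comp ((v.contDiffAt hp (hsub hy)).differentiableAt (by simp))]
    exact (abs_apply_le _ hℓ fun _ ↦ norm_single j).trans
      (v.norm_iteratedFDeriv_le hp one_le_two hy)
  · rw [one_mul, pd_pd_comp (v.contDiffAt hp (hsub hy))]
    exact (abs_apply_le _ hℓ (hm i)).trans (v.norm_iteratedFDeriv_le hp le_rfl hy)
  · rw [one_mul, pd_pd_comp (v.contDiffAt hp (hsub hy)), pd_pd_comp (v.contDiffAt hp (hsub hz)),
      ← map_sub, ← sub_apply]
    exact (abs_apply_le _ hℓ (hm i)).trans (v.norm_iteratedFDeriv_sub_le hp hy hz)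

theorem holderFamilyC1_two (hα : 0 < α) (hα' : α ≤ 1) (hp : p ∈ 𝒞.centers) {ℓ : F →L[ℝ] ℝ}
    (hℓ : ∀ v, |ℓ v| ≤ ‖v‖) :
    HolderFamilyC1 (extChartAt (𝓡 3) p).target (𝒞.ball p) α (fun v : HolderSpace 𝒞 T 2 α ↦ ‖v‖)
      fun v y ↦ ℓ (T p v.val y) := by
  have hsub := 𝒞.closedBall_subset p hp
  have hpd := fun i ↦ (holderFamilyC1_pd_two (T := T) hα hα' hp hℓ i).family
  have hc : ∀ v : HolderSpace 𝒞 T 2 α, ∀ y ∈ (extChartAt (𝓡 3) p).target,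
      ContDiffAt ℝ 2 (fun y ↦ ℓ (T p v.val y)) y := fun v y hy ↦
    ℓ.contDiff.contDiffAt.comp y (v.contDiffAt hp hy)
  have h0 : ∀ v : HolderSpace 𝒞 T 2 α, ∀ y ∈ 𝒞.ball p, |ℓ (T p v.val y)| ≤ 1 * ‖v‖ :=
    fun v y hy ↦ by
      have := v.norm_iteratedFDeriv_le hp (zero_le_two) hy
      rw [norm_iteratedFDeriv_zero] at this
      rw [one_mul]
      exact (hℓ _).trans this
  have h1 : ∀ i, ∀ v : HolderSpace 𝒞 T 2 α, ∀ y ∈ 𝒞.ball p,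
      |pd i (fun y ↦ ℓ (T p v.val y)) y| ≤ 1 * ‖v‖ := fun i v y hy ↦ by
    rw [one_mul, pd_comp ((v.contDiffAt hp (hsub hy)).differentiableAt (by simp))]
    exact (abs_apply_le _ hℓ fun _ ↦ norm_single i).trans
      (v.norm_iteratedFDeriv_le hp one_le_two hy)
  exact
  { contDiffAt := fun v y hy ↦ (hc v y hy).of_le (by norm_num)
    family := ⟨fun v y hy ↦ (hc v y hy).continuousAt.continuousWithinAt, 3, by norm_num, fun v ↦ by
      simpa using HolderBound.of_pd hα hα' (convex_ball 𝒞 p)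
        (fun y hy ↦ (hc v y (hsub hy)).differentiableAt (by simp)) (h0 v) fun i y hy ↦ h1 i v y hy⟩
    pd_family := hpd }

end HolderSpace

end spaces

section linearity
variable {M : Type*} [TopologicalSpace M] [ChartedSpace E3 M] [IsManifold (𝓡 3) ∞ M]
  [RiemannianBundle (fun x : M ↦ TangentSpace (𝓡 3) x)]
  [IsContMDiffRiemannianBundle (𝓡 3) ∞ E3 (fun x : M ↦ TangentSpace (𝓡 3) x)]

variable {p q x : M} {y : E3} {i j k l a b c : Fin 3} {S T : Tensor2 (𝓡 3) M}
  {v w : Π q : M, TangentSpace (𝓡 3) q} {u u' : M → ℝ} (r : ℝ)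

theorem ContMDiffAt.real_mdifferentiableAt (hu : ContMDiffAt (𝓡 3) 𝓘(ℝ) 1 u x) :
    MDifferentiableAt (𝓡 3) 𝓘(ℝ) u x :=
  hu.mdifferentiableAt (by simp)

theorem pd_linear {f g : E3 → ℝ} (hf : DifferentiableAt ℝ f y) (hg : DifferentiableAt ℝ g y) :
    pd i (fun z ↦ r * f z + g z) y = r * pd i f y + pd i g y := by
  rw [pd_add (hf.const_mul r) hg, pd_mul (differentiableAt_const r) hf]
  simp [pd]

theorem contMDiff_linear {n : ℕ∞ω} (hu : ContMDiff (𝓡 3) 𝓘(ℝ) n u)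
    (hu' : ContMDiff (𝓡 3) 𝓘(ℝ) n u') : ContMDiff (𝓡 3) 𝓘(ℝ) n (r • u + u') :=
  (contMDiff_const.mul hu).add hu'

theorem fieldRep_linear : fieldRep p (r • v + w) y k = r * fieldRep p v y k + fieldRep p w y k := by
  rw [map_add, map_smul]
  rfl

theorem field_ext_comp (h : ∀ p : M, ∀ y ∈ (extChartAt (𝓡 3) p).target, ∀ k,
    fieldRep p v y k = fieldRep p w y k) : v = w := by
  funext x
  obtain ⟨p, y, hy, rfl⟩ := exists_chart_point x
  exact fieldRep_ext hy (PiLp.ext (h p y hy))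

theorem grad_linear (hu : ContMDiff (𝓡 3) 𝓘(ℝ) 1 u) (hu' : ContMDiff (𝓡 3) 𝓘(ℝ) 1 u') :
    grad (𝓡 3) (r • u + u') = r • grad (𝓡 3) u + grad (𝓡 3) u' := by
  refine field_ext_comp fun p y hy k ↦ ?_
  have hd : ∀ {u : M → ℝ}, ContMDiff (𝓡 3) 𝓘(ℝ) 1 u → DifferentiableAt ℝ (funRep p u) y :=
    fun hu ↦ ((contMDiffAt_funRep_iff (n := 1) hy).1 (hu _)).differentiableAt (by simp)
  rw [fieldRep_linear, fieldRep_grad hy (contMDiff_linear r hu hu' _).real_mdifferentiableAt,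
    fieldRep_grad hy (hu _).real_mdifferentiableAt, fieldRep_grad hy (hu' _).real_mdifferentiableAt,
    Finset.mul_sum, ← Finset.sum_add_distrib]
  refine Finset.sum_congr rfl fun l _ ↦ ?_
  have h : pd l (funRep p (r • u + u')) y = r * pd l (funRep p u) y + pd l (funRep p u') y :=
    pd_linear r (hd hu) (hd hu')
  rw [h]
  ring

theorem nabla_linear (hv : FieldCAt 1 v x) (hw : FieldCAt 1 w x) (z : TangentSpace (𝓡 3) x) :
    nabla (r • v + w) x z = r • nabla v x z + nabla w x z := by
  have hr : MDifferentiableAt (𝓡 3) 𝓘(ℝ) (fun _ : M ↦ r) x := mdifferentiableAt_const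
  have h1 := nabla_smul hv.fieldDAt hr z
  have h0 : mvfderiv (𝓡 3) (fun _ : M ↦ r) x z = 0 :=
    congrArg (fun A ↦ A z) (mvfderiv_const (I := 𝓡 3) (M := M) r)
  rw [h0, zero_smul, add_zero] at h1
  have hlc := (leviCivita (𝓡 3) M).isCovariantDerivativeOnUniv
  have h2 := hlc.add (hr.smul_section hv.fieldDAt) hw.fieldDAt (mem_univ x)
  refine (congrArg (fun A ↦ A z) h2).trans ?_
  exact congrArg (· + nabla w x z) h1

theorem divergence_linear (hv : FieldCAt 1 v x) (hw : FieldCAt 1 w x) :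
    divergence (r • v + w) x = r * divergence v x + divergence w x := by
  simp only [divergence_eq_frame, nabla_linear r hv hw, inner_add_right, real_inner_smul_right,
    Finset.sum_add_distrib, Finset.mul_sum]

theorem laplacian_linear (hu : ContMDiff (𝓡 3) 𝓘(ℝ) 2 u) (hu' : ContMDiff (𝓡 3) 𝓘(ℝ) 2 u') :
    laplacian (𝓡 3) (r • u + u') = r • laplacian (𝓡 3) u + laplacian (𝓡 3) u' := by
  funext x
  have h1 : ∀ {u : M → ℝ}, ContMDiff (𝓡 3) 𝓘(ℝ) 2 u → ContMDiff (𝓡 3) 𝓘(ℝ) 1 u :=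
    fun hu ↦ hu.of_le (by norm_num)
  have hg : ∀ {u : M → ℝ}, ContMDiff (𝓡 3) 𝓘(ℝ) 2 u → FieldCAt 1 (grad (𝓡 3) u) x :=
    fun hu ↦ fieldCAt_grad (n := 1) (by exact_mod_cast hu) x
  rw [laplacian, grad_linear r (h1 hu) (h1 hu')]
  exact divergence_linear r (hg hu) (hg hu')

theorem conformalKilling_linear (hv : ∀ x, FieldCAt 1 v x) (hw : ∀ x, FieldCAt 1 w x) :
    conformalKilling (r • v + w) = r • conformalKilling v + conformalKilling w := by
  funext x
  refine ContinuousLinearMap.ext fun a ↦ ContinuousLinearMap.ext fun b ↦ ?_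
  change conformalKilling (r • v + w) x a b =
    r * conformalKilling v x a b + conformalKilling w x a b
  simp only [conformalKilling_apply, nabla_linear r (hv x) (hw x),
    divergence_linear r (hv x) (hw x), inner_add_left, real_inner_smul_left]
  ring

theorem hasCompC_linear {n : ℕ∞} (hS : HasCompC n S) (hT : HasCompC n T) :
    HasCompC n (r • S + T) := fun p y hy a b ↦
  (contDiffAt_const.mul (hS p y hy a b)).add (hT p y hy a b)

theorem covRep_linear (hy : y ∈ (extChartAt (𝓡 3) p).target) (hS : HasCompC 1 S)
    (hT : HasCompC 1 T) :
    covRep p (r • S + T) c a b y = r * covRep p S c a b y + covRep p T c a b y := by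
  have hd : ∀ {S : Tensor2 (𝓡 3) M}, HasCompC 1 S → DifferentiableAt ℝ (tensorRep p S a b) y :=
    fun hS ↦ (hS p y hy a b).differentiableAt (by simp)
  have h : pd c (tensorRep p (r • S + T) a b) y =
      r * pd c (tensorRep p S a b) y + pd c (tensorRep p T a b) y := pd_linear r (hd hS) (hd hT)
  have h' : ∀ a b, tensorRep p (r • S + T) a b y = r * tensorRep p S a b y + tensorRep p T a b y :=
    fun _ _ ↦ rfl
  simp only [covRep, h, h', mul_add, Finset.sum_add_distrib, mul_sub, Finset.mul_sum,
    mul_left_comm r]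
  ring

theorem tensorDivergence_linear (hS : HasCompC 1 S) (hT : HasCompC 1 T) :
    tensorDivergence (r • S + T) = r • tensorDivergence S + tensorDivergence T := by
  refine field_ext_comp fun p y hy k ↦ ?_
  rw [fieldRep_linear, fieldRep_tensorDivergence hy (hasCompC_linear r hS hT p y hy),
    fieldRep_tensorDivergence hy (hS p y hy), fieldRep_tensorDivergence hy (hT p y hy)]
  simp only [covRep_linear r hy hS hT, mul_add, Finset.sum_add_distrib, Finset.mul_sum]
  congr 1
  exact Finset.sum_congr rfl fun _ _ ↦ Finset.sum_congr rfl fun _ _ ↦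
    Finset.sum_congr rfl fun _ _ ↦ by ring

theorem vectorLaplacian_linear (hv : ∀ x, FieldCAt 2 v x) (hw : ∀ x, FieldCAt 2 w x) :
    vectorLaplacian (r • v + w) = r • vectorLaplacian v + vectorLaplacian w := by
  have h1 : ∀ {v : Π q : M, TangentSpace (𝓡 3) q}, (∀ x, FieldCAt 2 v x) → ∀ x, FieldCAt 1 v x :=
    fun hv x ↦ (hv x).of_le (by norm_num)
  have h2 : ∀ {v : Π q : M, TangentSpace (𝓡 3) q}, (∀ x, FieldCAt 2 v x) →
      HasCompC 1 (conformalKilling v) :=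
    fun hv ↦ hasCompC_conformalKilling (n := 1) (by exact_mod_cast hv)
  funext x
  change -tensorDivergence (conformalKilling (r • v + w)) x =
    r • -tensorDivergence (conformalKilling v) x + -tensorDivergence (conformalKilling w) x
  rw [conformalKilling_linear r (h1 hv) (h1 hw), tensorDivergence_linear r (h2 hv) (h2 hw)]
  change -(r • tensorDivergence (conformalKilling v) x + tensorDivergence (conformalKilling w) x) = _
  module

theorem contract_linear_right (S T T' : Tensor2 (𝓡 3) M) (x : M) :
    contract S (r • T + T') x = r * contract S T x + contract S T' x := by
  simp only [contract, Finset.mul_sum, ← Finset.sum_add_distrib]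
  refine Finset.sum_congr rfl fun i _ ↦ Finset.sum_congr rfl fun j _ ↦ ?_
  change S x _ _ * (r * T x _ _ + T' x _ _) = _
  ring

theorem contract_comm (S T : Tensor2 (𝓡 3) M) (x : M) : contract S T x = contract T S x :=
  Finset.sum_congr rfl fun _ _ ↦ Finset.sum_congr rfl fun _ _ ↦ mul_comm _ _

theorem contract_add_self (S T : Tensor2 (𝓡 3) M) (x : M) :
    contract (S + T) (S + T) x = contract S S x + 2 * contract S T x + contract T T x := by
  simp only [contract, Finset.mul_sum, ← Finset.sum_add_distrib]
  refine Finset.sum_congr rfl fun i _ ↦ Finset.sum_congr rfl fun j _ ↦ ?_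
  change (S x _ _ + T x _ _) * (S x _ _ + T x _ _) = _
  ring

/-- The divergence of `u S` for a divergence-free tensor field `S`. -/
theorem fieldRep_tensorDivergence_smul (hy : y ∈ (extChartAt (𝓡 3) p).target)
    (hu : ContMDiff (𝓡 3) 𝓘(ℝ) 1 u) (hS : HasCompC 1 S) (hdiv : ∀ x, tensorDivergence S x = 0) :
    fieldRep p (tensorDivergence fun q ↦ u q • S q) y k =
      ∑ a, ginv p y k a * ∑ c, ∑ b, ginv p y b c * (pd c (funRep p u) y * tensorRep p S a b y) := by
  have hd : DifferentiableAt ℝ (funRep p u) y :=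
    ((contMDiffAt_funRep_iff (n := 1) hy).1 (hu _)).differentiableAt (by simp)
  have h : ∀ c a b, pd c (tensorRep p (fun q ↦ u q • S q) a b) y =
      funRep p u y * pd c (tensorRep p S a b) y + tensorRep p S a b y * pd c (funRep p u) y :=
    fun c a b ↦ pd_mul hd ((hS p y hy a b).differentiableAt (by simp))
  have h' : ∀ a b, tensorRep p (fun q ↦ u q • S q) a b y = funRep p u y * tensorRep p S a b y :=
    fun _ _ ↦ rfl
  have hc : ∀ c a b, covRep p (fun q ↦ u q • S q) c a b y =
      funRep p u y * covRep p S c a b y + pd c (funRep p u) y * tensorRep p S a b y :=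
    fun c a b ↦ by
      simp only [covRep, h, h', mul_sub, Finset.mul_sum, mul_left_comm (funRep p u y)]
      ring
  have h0 : fieldRep p (tensorDivergence S) y k = 0 := by
    rw [show tensorDivergence S = 0 from funext hdiv, map_zero]
    rfl
  rw [fieldRep_tensorDivergence hy (hS p y hy)] at h0
  rw [fieldRep_tensorDivergence hy (hasCompC_smul (n := 1) hu hS p y hy)]
  have h2 : ∑ a, ginv p y k a * ∑ c, ∑ b, ginv p y b c * (funRep p u y * covRep p S c a b y) = 0 := by
    refine Eq.trans ?_ (mul_zero (funRep p u y))
    rw [← h0]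
    simp only [Finset.mul_sum]
    exact Finset.sum_congr rfl fun _ _ ↦ Finset.sum_congr rfl fun _ _ ↦
      Finset.sum_congr rfl fun _ _ ↦ by ring
  simp only [hc, mul_add, Finset.sum_add_distrib, h2, zero_add]

theorem tensorDivergence_smul_linear (hu : ContMDiff (𝓡 3) 𝓘(ℝ) 1 u)
    (hu' : ContMDiff (𝓡 3) 𝓘(ℝ) 1 u') (hS : HasCompC 1 S) (c : ℝ) :
    tensorDivergence (fun q ↦ (c * (r • u + u') q) • S q) =
      r • tensorDivergence (fun q ↦ (c * u q) • S q) + tensorDivergence fun q ↦ (c * u' q) • S q := by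
  have h1 : (fun q ↦ (c * (r • u + u') q) • S q) =
      r • (fun q ↦ (c * u q) • S q) + fun q ↦ (c * u' q) • S q := by
    funext q
    refine ContinuousLinearMap.ext fun a ↦ ContinuousLinearMap.ext fun b ↦ ?_
    change (c * (r * u q + u' q)) * S q a b = r * ((c * u q) * S q a b) + (c * u' q) * S q a b
    ring
  rw [h1]
  exact tensorDivergence_linear r (hasCompC_smul (n := 1) (contMDiff_const.mul hu) hS)
    (hasCompC_smul (n := 1) (contMDiff_const.mul hu') hS)

end linearity

section families
variable {M : Type*} [TopologicalSpace M] [ChartedSpace E3 M] [IsManifold (𝓡 3) ∞ M]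
  [RiemannianBundle (fun x : M ↦ TangentSpace (𝓡 3) x)]
  [IsContMDiffRiemannianBundle (𝓡 3) ∞ E3 (fun x : M ↦ TangentSpace (𝓡 3) x)]

variable {𝒞 : HolderCover M} {α : ℝ} {p : M} {X : Type*} {N N' : X → ℝ}

/-- `HolderFamily` for the chart image and the coordinate ball at `p`. -/
abbrev ChartFamily (𝒞 : HolderCover M) (α : ℝ) (p : M) (N : X → ℝ) (O : X → E3 → ℝ) : Prop :=
  HolderFamily (extChartAt (𝓡 3) p).target (𝒞.ball p) α N O

/-- `HolderFamilyC1` for the chart image and the coordinate ball at `p`. -/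
abbrev ChartFamilyC1 (𝒞 : HolderCover M) (α : ℝ) (p : M) (N : X → ℝ) (O : X → E3 → ℝ) : Prop :=
  HolderFamilyC1 (extChartAt (𝓡 3) p).target (𝒞.ball p) α N O

theorem HolderSpace.contMDiff {k : ℕ} (u : HolderFun 𝒞 k α) : ContMDiff (𝓡 3) 𝓘(ℝ) k u.val := by
  intro x
  obtain ⟨p, hp, hx, -⟩ := 𝒞.covers x
  have h := (contMDiffAt_funRep_iff (n := k) ((extChartAt (𝓡 3) p).map_source hx)).2
    (u.contDiffAt hp ((extChartAt (𝓡 3) p).map_source hx))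
  rw [(extChartAt (𝓡 3) p).left_inv hx] at h
  exact h

theorem HolderSpace.fieldCAt {k : ℕ} (w : HolderField 𝒞 k α) (x : M) :
    FieldCAt (k : ℕ∞) w.val x := by
  obtain ⟨p, hp, hx, -⟩ := 𝒞.covers x
  have h := (contMDiffAt_fieldRep_iff (n := k) ((extChartAt (𝓡 3) p).map_source hx)).2
    (w.contDiffAt hp ((extChartAt (𝓡 3) p).map_source hx))
  rw [(extChartAt (𝓡 3) p).left_inv hx] at h
  exact h

section coefficients

variable {f : E3 → ℝ} {O : X → E3 → ℝ}

theorem ChartFamily.coeff (hα : 0 < α) (hα' : α ≤ 1) (hp : p ∈ 𝒞.centers)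
    (hf : ∀ y ∈ (extChartAt (𝓡 3) p).target, ContDiffAt ℝ 1 f y) :
    ChartFamily 𝒞 α p (fun _ : X ↦ 1) fun _ ↦ f :=
  HolderFamily.of_contDiffAt hα hα' (HolderSpace.convex_ball 𝒞 p) (HolderSpace.isCompact_ball 𝒞 p)
    (𝒞.closedBall_subset p hp) hf

theorem ChartFamily.coeff_mul (hα : 0 < α) (hα' : α ≤ 1) (hp : p ∈ 𝒞.centers)
    (hf : ∀ y ∈ (extChartAt (𝓡 3) p).target, ContDiffAt ℝ 1 f y)
    (hO : ChartFamily 𝒞 α p N O) : ChartFamily 𝒞 α p N fun v y ↦ f y * O v y := by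
  simpa only [one_mul] using (ChartFamily.coeff (X := X) hα hα' hp hf).mul hO

theorem ChartFamilyC1.coeff_mul (hα : 0 < α) (hα' : α ≤ 1) (hp : p ∈ 𝒞.centers)
    (hf : ∀ y ∈ (extChartAt (𝓡 3) p).target, ContDiffAt ℝ ∞ f y)
    (hO : ChartFamilyC1 𝒞 α p N O) : ChartFamilyC1 𝒞 α p N fun v y ↦ f y * O v y := by
  have h : ChartFamilyC1 𝒞 α p (fun _ : X ↦ 1) fun _ ↦ f :=
    HolderFamilyC1.of_contDiffAt hα hα' (HolderSpace.convex_ball 𝒞 p)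
      (HolderSpace.isCompact_ball 𝒞 p) (𝒞.closedBall_subset p hp)
      fun y hy ↦ (hf y hy).of_le (ENat.LEInfty.out)
  have h2 : ChartFamilyC1 𝒞 α p (fun v ↦ 1 * N v) fun v y ↦ f y * O v y :=
    h.mul (𝒞.closedBall_subset p hp) hO
  simpa only [one_mul] using h2

end coefficients

section operators

theorem ContDiffAt.one_of_infty {f : E3 → ℝ} {y : E3} (h : ContDiffAt ℝ ∞ f y) :
    ContDiffAt ℝ 1 f y :=
  h.of_le (ENat.LEInfty.out)

theorem chartFamily_grad (hα : 0 < α) (hα' : α ≤ 1) (hp : p ∈ 𝒞.centers)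
    {k : Fin 3} {A : X → M → ℝ} (hA : ∀ x, ContMDiff (𝓡 3) 𝓘(ℝ) 1 (A x))
    (h : ∀ i, ChartFamily 𝒞 α p N fun x ↦ pd i (funRep p (A x))) :
    ChartFamily 𝒞 α p N fun x y ↦ fieldRep p (grad (𝓡 3) (A x)) y k :=
  (HolderFamily.sum fun l (_ : l ∈ Finset.univ) ↦ ChartFamily.coeff_mul hα hα' hp
    (fun _ hy ↦ ContDiffAt.one_of_infty (contDiffAt_ginv (i := k) hy)) (h l)).congr
    (𝒞.closedBall_subset p hp) fun x _ hy ↦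
      (fieldRep_grad hy (hA x _).real_mdifferentiableAt).symm

theorem chartFamilyC1_grad (hα : 0 < α) (hα' : α ≤ 1) (hp : p ∈ 𝒞.centers)
    {k : Fin 3} {A : X → M → ℝ} (hA : ∀ x, ContMDiff (𝓡 3) 𝓘(ℝ) 1 (A x))
    (h : ∀ i, ChartFamilyC1 𝒞 α p N fun x ↦ pd i (funRep p (A x))) :
    ChartFamilyC1 𝒞 α p N fun x y ↦ fieldRep p (grad (𝓡 3) (A x)) y k :=
  (HolderFamilyC1.sum (𝒞.closedBall_subset p hp) fun l (_ : l ∈ Finset.univ) ↦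
    ChartFamilyC1.coeff_mul hα hα' hp
      (fun _ hy ↦ contDiffAt_ginv (i := k) hy) (h l)).congr (isOpen_extChartAt_target p)
    (𝒞.closedBall_subset p hp) fun x _ hy ↦
      (fieldRep_grad hy (hA x _).real_mdifferentiableAt).symm

theorem chartFamily_nablaRep (hα : 0 < α) (hα' : α ≤ 1) (hp : p ∈ 𝒞.centers)
    {i k : Fin 3} {A : X → Π q : M, TangentSpace (𝓡 3) q}
    (h : ∀ i, ChartFamilyC1 𝒞 α p N fun x y ↦ fieldRep p (A x) y i) :
    ChartFamily 𝒞 α p N fun x ↦ nablaRep p (A x) i k :=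
  ((h k).pd_family i).add (HolderFamily.sum fun j _ ↦ by
    simpa only [mul_comm] using ChartFamily.coeff_mul hα hα' hp
      (fun _ hy ↦ ContDiffAt.one_of_infty (contDiffAt_christoffel (i := i) (j := j) (k := k) hy))
      (h j).family)

theorem chartFamilyC1_nablaRep (hα : 0 < α) (hα' : α ≤ 1) (hp : p ∈ 𝒞.centers)
    {i k : Fin 3} {A : X → Π q : M, TangentSpace (𝓡 3) q}
    (h : ∀ i, ChartFamilyC1 𝒞 α p N fun x y ↦ fieldRep p (A x) y i)
    (h' : ∀ i j, ChartFamilyC1 𝒞 α p N fun x ↦ pd i fun y ↦ fieldRep p (A x) y j) :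
    ChartFamilyC1 𝒞 α p N fun x ↦ nablaRep p (A x) i k :=
  (h' i k).add (𝒞.closedBall_subset p hp) (HolderFamilyC1.sum (𝒞.closedBall_subset p hp) fun j _ ↦ by
    simpa only [mul_comm] using ChartFamilyC1.coeff_mul hα hα' hp
      (fun _ hy ↦ contDiffAt_christoffel (i := i) (j := j) (k := k) hy) (h j))

theorem chartFamily_divergence (hα : 0 < α) (hα' : α ≤ 1) (hp : p ∈ 𝒞.centers)
    {A : X → Π q : M, TangentSpace (𝓡 3) q}
    (hA : ∀ x q, FieldCAt 1 (A x) q)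
    (h : ∀ i, ChartFamilyC1 𝒞 α p N fun x y ↦ fieldRep p (A x) y i) :
    ChartFamily 𝒞 α p N fun x ↦ funRep p (divergence (A x)) :=
  (HolderFamily.sum fun _ (_ : _ ∈ Finset.univ) ↦ chartFamily_nablaRep hα hα' hp h).congr
    (𝒞.closedBall_subset p hp) fun x _ hy ↦ (divergence_eq hy (hA x _)).symm

theorem chartFamilyC1_conformalKilling (hα : 0 < α) (hα' : α ≤ 1) (hp : p ∈ 𝒞.centers)
    {a b : Fin 3} {A : X → Π q : M, TangentSpace (𝓡 3) q}
    (hA : ∀ x q, FieldCAt 1 (A x) q)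
    (h : ∀ i, ChartFamilyC1 𝒞 α p N fun x y ↦ fieldRep p (A x) y i)
    (h' : ∀ i j, ChartFamilyC1 𝒞 α p N fun x ↦ pd i fun y ↦ fieldRep p (A x) y j) :
    ChartFamilyC1 𝒞 α p N fun x ↦ tensorRep p (conformalKilling (A x)) a b := by
  have hsub := 𝒞.closedBall_subset p hp
  have hg : ∀ i j, ∀ y ∈ (extChartAt (𝓡 3) p).target, ContDiffAt ℝ ∞ (fun y ↦ gram p y i j) y :=
    fun i j y hy ↦ contDiffAt_gram hy
  have hn := fun i k ↦ chartFamilyC1_nablaRep (i := i) (k := k) hα hα' hp h h'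
  have h1 := fun a b ↦ HolderFamilyC1.sum hsub fun k (_ : k ∈ Finset.univ) ↦
    ChartFamilyC1.coeff_mul hα hα' hp (hg k b) (hn a k)
  have h2 := ChartFamilyC1.coeff_mul hα hα' hp
    (f := fun y ↦ -(2 / 3) * gram p y a b) (fun y hy ↦ contDiffAt_const.mul (hg a b y hy))
    (HolderFamilyC1.sum hsub fun k (_ : k ∈ Finset.univ) ↦ hn k k)
  refine (((h1 a b).add hsub (h1 b a)).add hsub h2).congr (isOpen_extChartAt_target p) hsub
    fun x y hy ↦ ?_
  refine Eq.trans ?_ (tensorRep_conformalKilling hy (hA x _)).symm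
  simp only [mul_comm (gram p y _ _)]
  ring

theorem chartFamily_tensorDivergence (hα : 0 < α) (hα' : α ≤ 1) (hp : p ∈ 𝒞.centers)
    {k : Fin 3} {S : X → Tensor2 (𝓡 3) M}
    (hS : ∀ x, HasCompC 1 (S x)) (h : ∀ a b, ChartFamilyC1 𝒞 α p N fun x ↦ tensorRep p (S x) a b) :
    ChartFamily 𝒞 α p N fun x y ↦ fieldRep p (tensorDivergence (S x)) y k := by
  have hΓ : ∀ i j k, ∀ y ∈ (extChartAt (𝓡 3) p).target,
      ContDiffAt ℝ 1 (christoffel p i j k) y := fun i j k y hy ↦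
    ContDiffAt.one_of_infty (contDiffAt_christoffel hy)
  have hg : ∀ i j, ∀ y ∈ (extChartAt (𝓡 3) p).target, ContDiffAt ℝ 1 (fun y ↦ ginv p y i j) y :=
    fun i j y hy ↦ ContDiffAt.one_of_infty (contDiffAt_ginv hy)
  have hc : ∀ c a b, ChartFamily 𝒞 α p N fun x ↦ covRep p (S x) c a b := fun c a b ↦
    (((h a b).pd_family c).sub (HolderFamily.sum fun k _ ↦
      ChartFamily.coeff_mul hα hα' hp (hΓ c a k) (h k b).family)).sub (HolderFamily.sum fun k _ ↦
      ChartFamily.coeff_mul hα hα' hp (hΓ c b k) (h a k).family)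
  exact (HolderFamily.sum fun a (_ : a ∈ Finset.univ) ↦ ChartFamily.coeff_mul hα hα' hp (hg k a)
    (HolderFamily.sum fun c (_ : c ∈ Finset.univ) ↦ HolderFamily.sum fun b (_ : b ∈ Finset.univ) ↦
      ChartFamily.coeff_mul hα hα' hp (hg b c) (hc c a b))).congr (𝒞.closedBall_subset p hp)
    fun x y hy ↦ (fieldRep_tensorDivergence hy (hS x p y hy)).symm

theorem chartFamily_contract (hα : 0 < α) (hα' : α ≤ 1) (hp : p ∈ 𝒞.centers)
    {S T : X → Tensor2 (𝓡 3) M}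
    (hS : ∀ a b, ChartFamily 𝒞 α p N fun x ↦ tensorRep p (S x) a b)
    (hT : ∀ a b, ChartFamily 𝒞 α p N' fun x ↦ tensorRep p (T x) a b) :
    ChartFamily 𝒞 α p (fun x ↦ N x * N' x) fun x ↦ funRep p (contract (S x) (T x)) := by
  have hg : ∀ i j, ∀ y ∈ (extChartAt (𝓡 3) p).target, ContDiffAt ℝ 1 (fun y ↦ ginv p y i j) y :=
    fun i j y hy ↦ ContDiffAt.one_of_infty (contDiffAt_ginv hy)
  exact (HolderFamily.sum fun a (_ : a ∈ Finset.univ) ↦ HolderFamily.sum fun b (_ : b ∈ Finset.univ) ↦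
    HolderFamily.sum fun c (_ : c ∈ Finset.univ) ↦ HolderFamily.sum fun d (_ : d ∈ Finset.univ) ↦
    ChartFamily.coeff_mul hα hα' hp (fun y hy ↦ (hg a c y hy).mul (hg b d y hy))
      ((hS a b).mul (hT c d))).congr (𝒞.closedBall_subset p hp) fun x y hy ↦ (contract_eq hy).symm

theorem chartFamily_tensorDivergence_smul (hα : 0 < α) (hα' : α ≤ 1) (hp : p ∈ 𝒞.centers)
    {k : Fin 3} {S : Tensor2 (𝓡 3) M} (hS : HasCompC 1 S)
    (hdiv : ∀ x, tensorDivergence S x = 0) {A : X → M → ℝ}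
    (hA : ∀ x, ContMDiff (𝓡 3) 𝓘(ℝ) 1 (A x))
    (h : ∀ i, ChartFamily 𝒞 α p N fun x ↦ pd i (funRep p (A x))) :
    ChartFamily 𝒞 α p N fun x y ↦ fieldRep p (tensorDivergence fun q ↦ A x q • S q) y k := by
  have hg : ∀ i j, ∀ y ∈ (extChartAt (𝓡 3) p).target, ContDiffAt ℝ 1 (fun y ↦ ginv p y i j) y :=
    fun i j y hy ↦ ContDiffAt.one_of_infty (contDiffAt_ginv hy)
  have h1 : ∀ c a b, ChartFamily 𝒞 α p N
      fun x y ↦ pd c (funRep p (A x)) y * tensorRep p S a b y := fun c a b ↦ by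
    simpa only [mul_comm] using ChartFamily.coeff_mul hα hα' hp (fun y hy ↦ hS p y hy a b) (h c)
  exact (HolderFamily.sum fun a (_ : a ∈ Finset.univ) ↦ ChartFamily.coeff_mul hα hα' hp (hg k a)
    (HolderFamily.sum fun c (_ : c ∈ Finset.univ) ↦ HolderFamily.sum fun b (_ : b ∈ Finset.univ) ↦
      ChartFamily.coeff_mul hα hα' hp (hg b c) (h1 c a b))).congr (𝒞.closedBall_subset p hp)
    fun x y hy ↦ (fieldRep_tensorDivergence_smul hy (hA x) hS hdiv).symm

end operators

end families

section spaces
variable {M : Type*} [TopologicalSpace M] [ChartedSpace E3 M] [IsManifold (𝓡 3) ∞ M]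
  [RiemannianBundle (fun x : M ↦ TangentSpace (𝓡 3) x)]
  [IsContMDiffRiemannianBundle (𝓡 3) ∞ E3 (fun x : M ↦ TangentSpace (𝓡 3) x)]

variable {𝒞 : HolderCover M} {α : ℝ} {p : M} {S : Tensor2 (𝓡 3) M}

theorem HolderFun.exists_atlasENorm_le {X : Type*} {N : X → ℝ} (hN : ∀ x, 0 ≤ N x)
    {A : X → M → ℝ} (h : ∀ p ∈ 𝒞.centers, ChartFamily 𝒞 α p N fun x ↦ funRep p (A x)) :
    ∃ C, 0 ≤ C ∧ ∀ x, A x ∈ holderSubmodule 𝒞 (funRep (M := M)) 0 α ∧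
      atlasENorm 𝒞 funRep 0 α (A x) ≤ ENNReal.ofReal (C * N x) :=
  HolderSpace.exists_atlasENorm_le (ι := Unit) (ℓ := fun _ ↦ ContinuousLinearMap.id ℝ ℝ)
    (b := fun _ ↦ 1) (by simp) (by simp) hN fun p hp _ ↦ h p hp

theorem HolderField.exists_atlasENorm_le {X : Type*} {N : X → ℝ} (hN : ∀ x, 0 ≤ N x)
    {A : X → Π q : M, TangentSpace (𝓡 3) q}
    (h : ∀ p ∈ 𝒞.centers, ∀ k, ChartFamily 𝒞 α p N fun x y ↦ fieldRep p (A x) y k) :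
    ∃ C, 0 ≤ C ∧ ∀ x, A x ∈ holderSubmodule 𝒞 (fieldRep (M := M)) 0 α ∧
      atlasENorm 𝒞 fieldRep 0 α (A x) ≤ ENNReal.ofReal (C * N x) :=
  HolderSpace.exists_atlasENorm_le (ℓ := fun i ↦ EuclideanSpace.proj i)
    (b := fun i ↦ EuclideanSpace.single i 1) (by simp) (fun v ↦ by
      have := (EuclideanSpace.basisFun (Fin 3) ℝ).sum_repr v
      simpa using this.symm) hN fun p hp i ↦ h p hp i

theorem HolderFun.norm_ofVal_le {u : M → ℝ} {C : ℝ} (hC : 0 ≤ C)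
    (h : u ∈ holderSubmodule 𝒞 (funRep (M := M)) 0 α ∧
      atlasENorm 𝒞 funRep 0 α u ≤ ENNReal.ofReal C) :
    ‖(HolderSpace.ofVal u : HolderFun 𝒞 0 α)‖ ≤ C := by
  change (atlasENorm 𝒞 funRep 0 α (HolderSpace.ofVal u : HolderFun 𝒞 0 α).val).toReal ≤ C
  rw [HolderSpace.ofVal_val h.1]
  exact ENNReal.toReal_le_of_le_ofReal hC h.2

theorem HolderField.norm_ofVal_le {w : Π q : M, TangentSpace (𝓡 3) q} {C : ℝ} (hC : 0 ≤ C)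
    (h : w ∈ holderSubmodule 𝒞 (fieldRep (M := M)) 0 α ∧
      atlasENorm 𝒞 fieldRep 0 α w ≤ ENNReal.ofReal C) :
    ‖(HolderSpace.ofVal w : HolderField 𝒞 0 α)‖ ≤ C := by
  change (atlasENorm 𝒞 fieldRep 0 α (HolderSpace.ofVal w : HolderField 𝒞 0 α).val).toReal ≤ C
  rw [HolderSpace.ofVal_val h.1]
  exact ENNReal.toReal_le_of_le_ofReal hC h.2

theorem map_zero_of_linear {V W : Type*} [AddCommGroup V] [Module ℝ V] [AddCommGroup W]
    [Module ℝ W] {A : V → W} (hA : ∀ (r : ℝ) x x', A (r • x + x') = r • A x + A x') : A 0 = 0 := by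
  have h := hA 1 0 0
  rw [one_smul, one_smul, add_zero] at h
  exact left_eq_add.1 h

section clm

variable {X : Type*} [NormedAddCommGroup X] [NormedSpace ℝ X]

theorem HolderFun.exists_clm {A : X → M → ℝ}
    (hA : ∀ (r : ℝ) x x', A (r • x + x') = r • A x + A x')
    (h : ∀ p ∈ 𝒞.centers, ChartFamily 𝒞 α p (fun x : X ↦ ‖x‖) fun x ↦ funRep p (A x)) :
    ∃ L : X →L[ℝ] HolderFun 𝒞 0 α, ∀ x, (L x).val = A x := by
  obtain ⟨C, hC, hb⟩ := HolderFun.exists_atlasENorm_le (fun x : X ↦ norm_nonneg x) h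
  have hv : ∀ x, (HolderSpace.ofVal (A x) : HolderFun 𝒞 0 α).val = A x := fun x ↦
    HolderSpace.ofVal_val (hb x).1
  refine ⟨LinearMap.mkContinuous
    { toFun := fun x ↦ (HolderSpace.ofVal (A x) : HolderFun 𝒞 0 α)
      map_add' := fun x x' ↦ HolderSpace.val_injective ?_
      map_smul' := fun r x ↦ HolderSpace.val_injective ?_ } C fun x ↦
      HolderFun.norm_ofVal_le (mul_nonneg hC (norm_nonneg x)) (hb x), hv⟩
  · refine (hv _).trans ?_
    have h1 := hA 1 x x'
    rw [one_smul, one_smul] at h1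
    exact h1.trans (congrArg₂ (· + ·) (hv x).symm (hv x').symm)
  · refine (hv _).trans ?_
    have h1 := hA r x 0
    rw [map_zero_of_linear hA, add_zero, add_zero] at h1
    exact h1.trans (congrArg (r • ·) (hv x).symm)

theorem HolderField.exists_clm {A : X → Π q : M, TangentSpace (𝓡 3) q}
    (hA : ∀ (r : ℝ) x x', A (r • x + x') = r • A x + A x')
    (h : ∀ p ∈ 𝒞.centers, ∀ k,
      ChartFamily 𝒞 α p (fun x : X ↦ ‖x‖) fun x y ↦ fieldRep p (A x) y k) :
    ∃ L : X →L[ℝ] HolderField 𝒞 0 α, ∀ x, (L x).val = A x := by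
  obtain ⟨C, hC, hb⟩ := HolderField.exists_atlasENorm_le (fun x : X ↦ norm_nonneg x) h
  have hv : ∀ x, (HolderSpace.ofVal (A x) : HolderField 𝒞 0 α).val = A x := fun x ↦
    HolderSpace.ofVal_val (hb x).1
  refine ⟨LinearMap.mkContinuous
    { toFun := fun x ↦ (HolderSpace.ofVal (A x) : HolderField 𝒞 0 α)
      map_add' := fun x x' ↦ HolderSpace.val_injective ?_
      map_smul' := fun r x ↦ HolderSpace.val_injective ?_ } C fun x ↦
      HolderField.norm_ofVal_le (mul_nonneg hC (norm_nonneg x)) (hb x), hv⟩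
  · refine (hv _).trans ?_
    have h1 := hA 1 x x'
    rw [one_smul, one_smul] at h1
    exact h1.trans (congrArg₂ (· + ·) (hv x).symm (hv x').symm)
  · refine (hv _).trans ?_
    have h1 := hA r x 0
    rw [map_zero_of_linear hA, add_zero, add_zero] at h1
    exact h1.trans (congrArg (r • ·) (hv x).symm)

end clm

theorem chartFamilyC1_fun (hα : 0 < α) (hα' : α ≤ 1) (hp : p ∈ 𝒞.centers) :
    ChartFamilyC1 𝒞 α p (fun u : HolderFun 𝒞 2 α ↦ ‖u‖) fun u ↦ funRep p u.val :=
  HolderSpace.holderFamilyC1_two hα hα' hp (ℓ := ContinuousLinearMap.id ℝ ℝ) fun _ ↦ le_rfl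

theorem chartFamilyC1_pd_fun (hα : 0 < α) (hα' : α ≤ 1) (hp : p ∈ 𝒞.centers) (i : Fin 3) :
    ChartFamilyC1 𝒞 α p (fun u : HolderFun 𝒞 2 α ↦ ‖u‖) fun u ↦ pd i (funRep p u.val) :=
  HolderSpace.holderFamilyC1_pd_two hα hα' hp (ℓ := ContinuousLinearMap.id ℝ ℝ) (fun _ ↦ le_rfl) i

theorem chartFamilyC1_field (hα : 0 < α) (hα' : α ≤ 1) (hp : p ∈ 𝒞.centers) (i : Fin 3) :
    ChartFamilyC1 𝒞 α p (fun w : HolderField 𝒞 2 α ↦ ‖w‖) fun w y ↦ fieldRep p w.val y i :=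
  HolderSpace.holderFamilyC1_two hα hα' hp (ℓ := EuclideanSpace.proj i)
    fun v ↦ PiLp.norm_apply_le v i

theorem chartFamilyC1_pd_field (hα : 0 < α) (hα' : α ≤ 1) (hp : p ∈ 𝒞.centers) (i j : Fin 3) :
    ChartFamilyC1 𝒞 α p (fun w : HolderField 𝒞 2 α ↦ ‖w‖)
      fun w ↦ pd i fun y ↦ fieldRep p w.val y j :=
  HolderSpace.holderFamilyC1_pd_two hα hα' hp (ℓ := EuclideanSpace.proj j)
    (fun v ↦ PiLp.norm_apply_le v j) i

theorem HolderSpace.contMDiff_one (u : HolderFun 𝒞 2 α) : ContMDiff (𝓡 3) 𝓘(ℝ) 1 u.val :=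
  u.contMDiff.of_le (by norm_num)

theorem HolderSpace.fieldCAt_one (w : HolderField 𝒞 2 α) (x : M) : FieldCAt 1 w.val x :=
  (w.fieldCAt x).of_le (by norm_num)

theorem chartFamily_laplacian (hα : 0 < α) (hα' : α ≤ 1) (hp : p ∈ 𝒞.centers) :
    ChartFamily 𝒞 α p (fun u : HolderFun 𝒞 2 α ↦ ‖u‖) fun u ↦ funRep p (laplacian (𝓡 3) u.val) :=
  chartFamily_divergence hα hα' hp
    (fun u ↦ fieldCAt_grad (n := 1) (by exact_mod_cast u.contMDiff))
    fun _ ↦ chartFamilyC1_grad hα hα' hp (fun u ↦ u.contMDiff_one)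
      fun i ↦ chartFamilyC1_pd_fun hα hα' hp i

theorem chartFamilyC1_tensorRep (hα : 0 < α) (hα' : α ≤ 1) (hp : p ∈ 𝒞.centers) (a b : Fin 3) :
    ChartFamilyC1 𝒞 α p (fun w : HolderField 𝒞 2 α ↦ ‖w‖)
      fun w ↦ tensorRep p (conformalKilling w.val) a b :=
  chartFamilyC1_conformalKilling hα hα' hp (fun w ↦ w.fieldCAt_one)
    (chartFamilyC1_field hα hα' hp) (chartFamilyC1_pd_field hα hα' hp)

theorem chartFamily_vectorLaplacian (hα : 0 < α) (hα' : α ≤ 1) (hp : p ∈ 𝒞.centers) (k : Fin 3) :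
    ChartFamily 𝒞 α p (fun w : HolderField 𝒞 2 α ↦ ‖w‖)
      fun w y ↦ fieldRep p (vectorLaplacian w.val) y k := by
  have h := chartFamily_tensorDivergence (k := k) hα hα' hp
    (fun w : HolderField 𝒞 2 α ↦ hasCompC_conformalKilling (n := 1) (w := w.val)
      (by exact_mod_cast w.fieldCAt)) fun a b ↦ chartFamilyC1_tensorRep hα hα' hp a b
  refine h.neg.congr (𝒞.closedBall_subset p hp) fun w y hy ↦ ?_
  have h2 : fieldRep p (vectorLaplacian w.val) = -fieldRep p (tensorDivergence
    (conformalKilling w.val)) := map_neg (fieldRep p) (tensorDivergence (conformalKilling w.val))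
  rw [h2]
  rfl

theorem chartFamily_contract_conformalKilling (hα : 0 < α) (hα' : α ≤ 1) (hp : p ∈ 𝒞.centers)
    (hS : HasCompC 1 S) :
    ChartFamily 𝒞 α p (fun w : HolderField 𝒞 2 α ↦ ‖w‖)
      fun w ↦ funRep p (contract S (conformalKilling w.val)) := by
  simpa only [one_mul] using chartFamily_contract hα hα' hp
    (fun a b ↦ ChartFamily.coeff (X := HolderField 𝒞 2 α) hα hα' hp fun y hy ↦ hS p y hy a b)
    fun a b ↦ (chartFamilyC1_tensorRep hα hα' hp a b).family

theorem exists_laplacian_clm (hα : 0 < α) (hα' : α ≤ 1) :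
    ∃ L : HolderFun 𝒞 2 α →L[ℝ] HolderFun 𝒞 0 α, ∀ u, (L u).val = laplacian (𝓡 3) u.val :=
  HolderFun.exists_clm (fun r u u' ↦ laplacian_linear r u.contMDiff u'.contMDiff)
    fun _ hp ↦ chartFamily_laplacian hα hα' hp

theorem exists_vectorLaplacian_clm (hα : 0 < α) (hα' : α ≤ 1) :
    ∃ L : HolderField 𝒞 2 α →L[ℝ] HolderField 𝒞 0 α, ∀ w, (L w).val = vectorLaplacian w.val :=
  HolderField.exists_clm (fun r w w' ↦ vectorLaplacian_linear r w.fieldCAt w'.fieldCAt)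
    fun _ hp k ↦ chartFamily_vectorLaplacian hα hα' hp k

theorem exists_contract_clm (hα : 0 < α) (hα' : α ≤ 1) (hS : HasCompC 1 S) :
    ∃ L : HolderField 𝒞 2 α →L[ℝ] HolderFun 𝒞 0 α,
      ∀ w, (L w).val = contract S (conformalKilling w.val) :=
  HolderFun.exists_clm (fun r w w' ↦ by
    funext x
    have h := conformalKilling_linear r w.fieldCAt_one w'.fieldCAt_one
    refine Eq.trans ?_ (contract_linear_right r S (conformalKilling w.val)
      (conformalKilling w'.val) x)
    rw [← h]
    rfl) fun _ hp ↦ chartFamily_contract_conformalKilling hα hα' hp hS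

theorem exists_tensorDivergence_clm (hα : 0 < α) (hα' : α ≤ 1) (hS : HasCompC 1 S)
    (hdiv : ∀ x, tensorDivergence S x = 0) (c : ℝ) :
    ∃ L : HolderFun 𝒞 2 α →L[ℝ] HolderField 𝒞 0 α,
      ∀ u, (L u).val = tensorDivergence fun q ↦ (c * u.val q) • S q := by
  refine HolderField.exists_clm (fun r u u' ↦ tensorDivergence_smul_linear r u.contMDiff_one
    u'.contMDiff_one hS c) fun p hp k ↦ chartFamily_tensorDivergence_smul hα hα' hp hS hdiv
    (A := fun (u : HolderFun 𝒞 2 α) q ↦ c * u.val q)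
    (fun u ↦ contMDiff_const.mul u.contMDiff_one) fun i ↦ ?_
  refine (((chartFamilyC1_pd_fun hα hα' hp i).family).const_mul c).congr
    (𝒞.closedBall_subset p hp) fun u y hy ↦ ?_
  have hd : DifferentiableAt ℝ (funRep p u.val) y :=
    ((contMDiffAt_funRep_iff (n := 1) hy).1 (u.contMDiff_one _)).differentiableAt (by simp)
  have h := pd_mul (i := i) (differentiableAt_const c) hd
  refine Eq.trans ?_ h.symm
  simp [pd]

end spaces

section bounded

variable {X : Type*} {U K : Set E3} {α : ℝ} {N : X → ℝ} {O P : X → E3 → ℝ}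

theorem HolderFamily.mul_bounded (hO : HolderFamily U K α N O)
    (hP : HolderFamily U K α (fun _ ↦ 1) P) : HolderFamily U K α N fun v y ↦ O v y * P v y := by
  simpa only [mul_one] using hO.mul hP

theorem HolderFamily.congr' (hO : HolderFamily U K α N O) (h : ∀ v y, O v y = P v y) :
    HolderFamily U K α N P := by
  rwa [show P = O from funext fun v ↦ funext fun y ↦ (h v y).symm]

end bounded

section mapping
variable {M : Type*} [TopologicalSpace M] [ChartedSpace E3 M] [IsManifold (𝓡 3) ∞ M]
  [RiemannianBundle (fun x : M ↦ TangentSpace (𝓡 3) x)]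
  [IsContMDiffRiemannianBundle (𝓡 3) ∞ E3 (fun x : M ↦ TangentSpace (𝓡 3) x)]

variable {𝒞 : HolderCover M} {α : ℝ} {p : M} {S σ : Tensor2 (𝓡 3) M}

theorem exists_pos_le_abs [CompactSpace M] [Nonempty M] {u : M → ℝ} (hu : Continuous u)
    (h : ∀ x, u x ≠ 0) : ∃ m > 0, ∀ x, m ≤ |u x| := by
  obtain ⟨x, -, hx⟩ := isCompact_univ.exists_isMinOn univ_nonempty hu.abs.continuousOn
  exact ⟨|u x|, abs_pos.2 (h x), fun z ↦ hx (mem_univ z)⟩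

theorem inv_pow_seven (t : ℝ) : t ^ (-7 : ℤ) = t⁻¹ ^ 7 := by
  rw [zpow_neg, inv_pow]
  norm_cast

/-- The Hamiltonian constraint maps into `C^{0,α}`. -/
theorem hamiltonian_mem [CompactSpace M] [Nonempty M] (hα : 0 < α) (hα' : α ≤ 1)
    (hσ : HasCompC 1 σ) {R : ℝ} (hscal : ∀ x : M, scalarCurvature (𝓡 3) x = R)
    (τ : HolderFun 𝒞 1 α) (ρ lam : ℝ) (φ : HolderFun 𝒞 2 α) (w : HolderField 𝒞 2 α)
    (hφ : ∀ x, φ.val x ≠ 0) :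
    hamiltonian τ.val σ ρ φ.val w.val lam ∈ holderSubmodule 𝒞 (funRep (M := M)) 0 α := by
  obtain ⟨m, hm, hmφ⟩ := exists_pos_le_abs φ.contMDiff_one.continuous hφ
  have key : ∀ p ∈ 𝒞.centers, ChartFamily 𝒞 α p (fun _ : Unit ↦ 1)
      fun _ ↦ funRep p (hamiltonian τ.val σ ρ φ.val w.val lam) := by
    intro p hp
    have hl := ((chartFamily_laplacian hα hα' hp).comp fun _ : Unit ↦ φ).gauge_mono
      (N' := fun _ ↦ 1) φ.norm_nonneg' fun _ ↦ (mul_one _).ge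
    have hf := ((chartFamilyC1_fun hα hα' hp).family.comp fun _ : Unit ↦ φ).gauge_mono
      (N' := fun _ ↦ 1) φ.norm_nonneg' fun _ ↦ (mul_one _).ge
    have hτ := ((HolderSpace.holderFamilyC1_one (T := funRep (M := M)) hα hα' hp
      (ℓ := ContinuousLinearMap.id ℝ ℝ) fun _ ↦ le_rfl).family.comp fun _ : Unit ↦ τ).gauge_mono
      (N' := fun _ ↦ 1) τ.norm_nonneg' fun _ ↦ (mul_one _).ge
    have hL := fun a b ↦ ((chartFamilyC1_tensorRep hα hα' hp a b).family.comp
      fun _ : Unit ↦ w).gauge_mono (N' := fun _ ↦ 1) w.norm_nonneg' fun _ ↦ (mul_one _).ge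
    have hS : ∀ a b, ChartFamily 𝒞 α p (fun _ : Unit ↦ 1)
        fun _ ↦ tensorRep p (σ + conformalKilling w.val) a b := fun a b ↦
      (ChartFamily.coeff hα hα' hp fun y hy ↦ hσ p y hy a b).add (hL a b)
    have hc : ChartFamily 𝒞 α p (fun _ : Unit ↦ 1) fun _ ↦
        funRep p (contract (σ + conformalKilling w.val) (σ + conformalKilling w.val)) := by
      simpa only [one_mul] using chartFamily_contract hα hα' hp hS hS
    have hi := (hf.inv hm (fun _ y _ ↦ hφ _) fun _ y _ ↦ hmφ _).pow 7
    refine ((((hl.neg.add (hf.const_mul (R / 8))).add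
      (((hτ.pow 2).const_mul (lam ^ 2 / 12)).mul_bounded (hf.pow 5))).sub
      ((hc.const_mul (1 / 8)).mul_bounded hi)).sub
      ((hf.pow 5).const_mul (2 * Real.pi * ρ * Real.exp (-lam)))).congr' fun _ y ↦ ?_
    change _ = hamiltonian τ.val σ ρ φ.val w.val lam ((extChartAt (𝓡 3) p).symm y)
    rw [hamiltonian, hscal, inv_pow_seven]
    simp only [funRep, LinearMap.coe_mk, AddHom.coe_mk, Function.comp_apply,
      ContinuousLinearMap.coe_id', id_eq]
    ring
  obtain ⟨C, -, h⟩ := HolderFun.exists_atlasENorm_le (𝒞 := 𝒞) (α := α) (X := Unit)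
    (N := fun _ ↦ 1) (fun _ ↦ zero_le_one) (A := fun _ ↦ hamiltonian τ.val σ ρ φ.val w.val lam) key
  exact (h ()).1

theorem fieldRep_smul {y : E3} {k : Fin 3} (u : M → ℝ) (w : Π q : M, TangentSpace (𝓡 3) q) :
    fieldRep p (fun q ↦ u q • w q) y k =
      u ((extChartAt (𝓡 3) p).symm y) * fieldRep p w y k :=
  congrArg (fun v : E3 ↦ v k) (ContinuousLinearMap.map_smul _ _ _)

/-- The momentum constraint maps into `C^{0,α}`. -/
theorem momentum_mem (hα : 0 < α) (hα' : α ≤ 1) (τ : HolderFun 𝒞 1 α) (lam : ℝ)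
    (φ : HolderFun 𝒞 2 α) (w : HolderField 𝒞 2 α) :
    momentum τ.val φ.val w.val lam ∈ holderSubmodule 𝒞 (fieldRep (M := M)) 0 α := by
  have key : ∀ p ∈ 𝒞.centers, ∀ k, ChartFamily 𝒞 α p (fun _ : Unit ↦ 1)
      fun _ y ↦ fieldRep p (momentum τ.val φ.val w.val lam) y k := by
    intro p hp k
    have hv := ((chartFamily_vectorLaplacian hα hα' hp k).comp fun _ : Unit ↦ w).gauge_mono
      (N' := fun _ ↦ 1) w.norm_nonneg' fun _ ↦ (mul_one _).ge
    have hf := ((chartFamilyC1_fun hα hα' hp).family.comp fun _ : Unit ↦ φ).gauge_mono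
      (N' := fun _ ↦ 1) φ.norm_nonneg' fun _ ↦ (mul_one _).ge
    have hτ := fun i ↦ (((HolderSpace.holderFamilyC1_one (T := funRep (M := M)) hα hα' hp
      (ℓ := ContinuousLinearMap.id ℝ ℝ) fun _ ↦ le_rfl).pd_family i).comp fun _ : Unit ↦ τ).gauge_mono
      (N' := fun _ ↦ 1) τ.norm_nonneg' fun _ ↦ (mul_one _).ge
    have hg := chartFamily_grad (k := k) hα hα' hp (A := fun _ : Unit ↦ τ.val)
      (fun _ ↦ by exact_mod_cast τ.contMDiff) hτ
    refine (hv.add (((hf.pow 6).const_mul (lam * (2 / 3))).mul_bounded hg)).congr' fun _ y ↦ ?_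
    have h0 : momentum τ.val φ.val w.val lam = (1 : ℝ) • vectorLaplacian w.val +
        fun q ↦ (lam * φ.val q ^ 6 * (2 / 3)) • grad (𝓡 3) τ.val q := by
      funext q
      rw [one_smul, Pi.add_apply, ← smul_smul (lam * φ.val q ^ 6)]
      rfl
    rw [h0, fieldRep_linear, fieldRep_smul]
    simp only [funRep, LinearMap.coe_mk, AddHom.coe_mk, Function.comp_apply]
    ring
  obtain ⟨C, -, h⟩ := HolderField.exists_atlasENorm_le (𝒞 := 𝒞) (α := α) (X := Unit)
    (N := fun _ ↦ 1) (fun _ ↦ zero_le_one) (A := fun _ ↦ momentum τ.val φ.val w.val lam) key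
  exact (h ()).1

end mapping

section constants

variable {R s : ℝ}

theorem rhoC_pos (hR : 0 < R) (hs : 0 < s) : 0 < rhoC R s := by
  have := Real.pi_pos
  rw [rhoC]
  positivity

theorem phiC_pos (hR : 0 < R) (hs : 0 < s) : 0 < phiC R s := by
  have := Real.pi_pos
  have := rhoC_pos hR hs
  rw [phiC]
  positivity

theorem phiC_pow_four (hR : 0 < R) (hs : 0 < s) :
    phiC R s ^ 4 = R / (24 * Real.pi * rhoC R s) := by
  have := Real.pi_pos
  have := rhoC_pos hR hs
  rw [phiC, ← Real.rpow_natCast, ← Real.rpow_mul (by positivity)]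
  norm_num

theorem two_pi_rhoC (hR : 0 < R) (hs : 0 < s) :
    2 * Real.pi * rhoC R s = R / (12 * phiC R s ^ 4) := by
  have := Real.pi_pos
  have := rhoC_pos hR hs
  rw [phiC_pow_four hR hs]
  field_simp
  norm_num

theorem sq_eq_phiC (hR : 0 < R) (hs : 0 < s) : s ^ 2 = R * phiC R s ^ 8 / 3 := by
  have := Real.pi_pos
  have h1 : R ^ (3 / 2 : ℝ) = R * √R := by
    rw [show (3 / 2 : ℝ) = 1 + 1 / 2 by norm_num, Real.rpow_add hR, Real.rpow_one,
      Real.sqrt_eq_rpow]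
  have h2 : phiC R s ^ 4 = √3 * s / √R := by
    rw [phiC_pow_four hR hs, rhoC, h1]
    have : 0 < √R := Real.sqrt_pos.2 hR
    field_simp
  rw [show phiC R s ^ 8 = (phiC R s ^ 4) ^ 2 by ring, h2, div_pow, mul_pow, Real.sq_sqrt hR.le,
    Real.sq_sqrt (by norm_num)]
  field_simp

end constants

/-- Second-order expansion of the algebraic part of the Hamiltonian constraint. -/
theorem hamiltonian_expansion {R c u b Q : ℝ} (hc : c ≠ 0) (hcu : c + u ≠ 0) :
    R / 8 * u - 1 / 8 * (R * c ^ 8 / 3 + 2 * b + Q) * (c + u)⁻¹ ^ 7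
      + 1 / 8 * (R * c ^ 8 / 3) * c⁻¹ ^ 7 - R / (12 * c ^ 4) * ((c + u) ^ 5 - c ^ 5)
      + 1 / 4 * c⁻¹ ^ 7 * b =
    u * u * (-(R * c / 24) * ((c + u)⁻¹ ^ 2 * (21 + -35 * (u * (c + u)⁻¹) +
        35 * (u * (c + u)⁻¹) ^ 2 + -21 * (u * (c + u)⁻¹) ^ 3 + 7 * (u * (c + u)⁻¹) ^ 4
        - (u * (c + u)⁻¹) ^ 5)) + -(7 * R / 24) * (c + u)⁻¹
        + -(R / (12 * c ^ 4)) * (10 * c ^ 3 + 10 * c ^ 2 * u + 5 * c * u ^ 2 + u ^ 3))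
      + b * u * (-(1 / 4) * c⁻¹ ^ 7 * ((c + u)⁻¹ * (-7 + 21 * (u * (c + u)⁻¹) +
        -35 * (u * (c + u)⁻¹) ^ 2 + 35 * (u * (c + u)⁻¹) ^ 3 + -21 * (u * (c + u)⁻¹) ^ 4
        + 7 * (u * (c + u)⁻¹) ^ 5 - (u * (c + u)⁻¹) ^ 6)))
      + Q * (-(1 / 8) * (c + u)⁻¹ ^ 7) := by
  field_simp
  ring

section derivative
variable {M : Type*} [TopologicalSpace M] [ChartedSpace E3 M] [IsManifold (𝓡 3) ∞ M]
  [RiemannianBundle (fun x : M ↦ TangentSpace (𝓡 3) x)]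
  [IsContMDiffRiemannianBundle (𝓡 3) ∞ E3 (fun x : M ↦ TangentSpace (𝓡 3) x)]

variable {𝒞 : HolderCover M} {α : ℝ} {p x : M} {σ : Tensor2 (𝓡 3) M}

theorem HolderSpace.abs_le {k : ℕ} (u : HolderFun 𝒞 k α) (q : M) : |u.val q| ≤ ‖u‖ := by
  obtain ⟨p, hp, hq, hb⟩ := 𝒞.covers q
  have h := u.norm_iteratedFDeriv_le hp (zero_le) (ball_subset_closedBall hb)
  rw [norm_iteratedFDeriv_zero] at h
  have h' : |u.val ((extChartAt (𝓡 3) p).symm (extChartAt (𝓡 3) p q))| ≤ ‖u‖ := h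
  rwa [(extChartAt (𝓡 3) p).left_inv hq] at h'

theorem fieldCAt_zero (n : ℕ∞) (x : M) : FieldCAt n (0 : Π q : M, TangentSpace (𝓡 3) q) x := by
  obtain ⟨p, y, hy, rfl⟩ := exists_chart_point x
  refine (contMDiffAt_fieldRep_iff hy).2 ?_
  rw [map_zero]
  exact contDiffAt_const

theorem divergence_zero (x : M) : divergence (0 : Π q : M, TangentSpace (𝓡 3) q) x = 0 := by
  have h := divergence_linear 1 (fieldCAt_zero 1 x) (fieldCAt_zero 1 x)
  rw [one_smul, add_zero, one_mul] at h
  exact left_eq_add.1 h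

theorem laplacian_const (c : ℝ) : laplacian (𝓡 3) (fun _ : M ↦ c) = 0 := by
  have h : grad (𝓡 3) (fun _ : M ↦ c) = 0 := by
    funext x
    have h1 : mvfderiv (𝓡 3) (fun _ : M ↦ c) x = 0 := mvfderiv_const (I := 𝓡 3) (M := M) c
    rw [grad, h1, map_zero]
    rfl
  funext x
  rw [laplacian, h]
  exact divergence_zero x

theorem conformalKilling_zero_apply (x : M) (a b : TangentSpace (𝓡 3) x) :
    conformalKilling (0 : Π q : M, TangentSpace (𝓡 3) q) x a b = 0 := by
  have h := congrArg (fun T : Tensor2 (𝓡 3) M ↦ T x a b)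
    (conformalKilling_linear 1 (fieldCAt_zero (M := M) 1) (fieldCAt_zero 1))
  rw [one_smul, add_zero] at h
  have h' : conformalKilling (0 : Π q : M, TangentSpace (𝓡 3) q) x a b =
    1 * conformalKilling (0 : Π q : M, TangentSpace (𝓡 3) q) x a b +
      conformalKilling (0 : Π q : M, TangentSpace (𝓡 3) q) x a b := h
  linarith

theorem vectorLaplacian_zero : vectorLaplacian (0 : Π q : M, TangentSpace (𝓡 3) q) = 0 := by
  have h := vectorLaplacian_linear 1 (fieldCAt_zero (M := M) 2) (fieldCAt_zero 2)
  rw [one_smul, one_smul, add_zero] at h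
  exact left_eq_add.1 h

theorem contract_conformalKilling_zero (S : Tensor2 (𝓡 3) M) (x : M) :
    contract S (conformalKilling (0 : Π q : M, TangentSpace (𝓡 3) q)) x = 0 :=
  Finset.sum_eq_zero fun _ _ ↦ Finset.sum_eq_zero fun _ _ ↦
    (congrArg _ (conformalKilling_zero_apply x _ _)).trans (mul_zero _)

theorem momentum_zero (τ φ : M → ℝ) (w : Π q : M, TangentSpace (𝓡 3) q) :
    momentum τ φ w 0 = vectorLaplacian w := by
  funext x
  rw [momentum, zero_mul, zero_smul, add_zero]

/-- The part of second order of the Hamiltonian constraint at `(c, 0)`. -/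
def hamiltonianRemainder (σ : Tensor2 (𝓡 3) M) (R c : ℝ) (u : M → ℝ)
    (w : Π q : M, TangentSpace (𝓡 3) q) (q : M) : ℝ :=
  R / 8 * u q - 1 / 8 * (R * c ^ 8 / 3 + 2 * contract σ (conformalKilling w) q
      + contract (conformalKilling w) (conformalKilling w) q) * (c + u q)⁻¹ ^ 7
    + 1 / 8 * (R * c ^ 8 / 3) * c⁻¹ ^ 7 - R / (12 * c ^ 4) * ((c + u q) ^ 5 - c ^ 5)
    + 1 / 4 * c⁻¹ ^ 7 * contract σ (conformalKilling w) q

theorem half_le_add {c u : ℝ} (hu : |u| ≤ c / 2) : c / 2 ≤ c + u := by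
  linarith [neg_abs_le u]

theorem chartFamily_hamiltonianRemainder (hα : 0 < α) (hα' : α ≤ 1) (hp : p ∈ 𝒞.centers)
    (hσ : HasCompC 1 σ) (R : ℝ) {c : ℝ} (hc : 0 < c) :
    ChartFamily 𝒞 α p (fun x : {x : DomainSpace 𝒞 α // ‖x‖ ≤ c / 2} ↦ ‖x.1‖ * ‖x.1‖)
      fun x ↦ funRep p (hamiltonianRemainder σ R c x.1.1.val x.1.2.val) := by
  have hlow : ∀ (x : {x : DomainSpace 𝒞 α // ‖x‖ ≤ c / 2}) (q : M), c / 2 ≤ c + x.1.1.val q :=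
    fun x q ↦ half_le_add ((x.1.1.abs_le q).trans ((norm_fst_le x.1).trans x.2))
  have hu := ((chartFamilyC1_fun hα hα' hp).family.comp
    fun x : {x : DomainSpace 𝒞 α // ‖x‖ ≤ c / 2} ↦ x.1.1).gauge_mono
    (N' := fun x ↦ ‖x.1‖) zero_le_one fun x ↦ (norm_fst_le x.1).trans (one_mul _).ge
  have hu1 := hu.gauge_mono (N' := fun _ ↦ 1) (half_pos hc).le fun x ↦ x.2.trans (mul_one _).ge
  have hb := ((chartFamily_contract_conformalKilling hα hα' hp hσ).comp
    fun x : {x : DomainSpace 𝒞 α // ‖x‖ ≤ c / 2} ↦ x.1.2).gauge_mono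
    (N' := fun x ↦ ‖x.1‖) zero_le_one fun x ↦ (norm_snd_le x.1).trans (one_mul _).ge
  have hL := fun a b ↦ ((chartFamilyC1_tensorRep hα hα' hp a b).family.comp
    fun x : {x : DomainSpace 𝒞 α // ‖x‖ ≤ c / 2} ↦ x.1.2).gauge_mono
    (N' := fun x ↦ ‖x.1‖) zero_le_one fun x ↦ (norm_snd_le x.1).trans (one_mul _).ge
  have hQ := chartFamily_contract hα hα' hp hL hL
  have hv := (((HolderFamily.const c).add hu1).inv (half_pos hc)
    (fun x y _ ↦ ((half_pos hc).trans_le (hlow x _)).ne')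
    fun x y _ ↦ (hlow x _).trans (le_abs_self _))
  have ht := hu1.mul_bounded hv
  have hP1 := (((hv.pow 2).mul_bounded ((((((HolderFamily.const 21).add (ht.const_mul (-35))).add
    ((ht.pow 2).const_mul 35)).add ((ht.pow 3).const_mul (-21))).add ((ht.pow 4).const_mul 7)).sub
    (ht.pow 5))).const_mul (-(R * c / 24))).add (hv.const_mul (-(7 * R / 24)))
  have hP1' := hP1.add (((((HolderFamily.const (10 * c ^ 3)).add (hu1.const_mul (10 * c ^ 2))).add
    ((hu1.pow 2).const_mul (5 * c))).add (hu1.pow 3)).const_mul (-(R / (12 * c ^ 4))))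
  have hP2 := (hv.mul_bounded (((((((HolderFamily.const (-7)).add (ht.const_mul 21)).add
    ((ht.pow 2).const_mul (-35))).add ((ht.pow 3).const_mul 35)).add
    ((ht.pow 4).const_mul (-21))).add ((ht.pow 5).const_mul 7)).sub
    (ht.pow 6))).const_mul (-(1 / 4) * c⁻¹ ^ 7)
  have hP3 := (hv.pow 7).const_mul (-(1 / 8))
  refine ((((hu.mul hu).mul_bounded hP1').add ((hb.mul hu).mul_bounded hP2)).add
    (hQ.mul_bounded hP3)).congr' fun x y ↦ ?_
  exact (hamiltonian_expansion hc.ne'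
    ((half_pos hc).trans_le (hlow x ((extChartAt (𝓡 3) p).symm y))).ne').symm

theorem contract_self_eq {s : ℝ} (h : √(contract σ σ x) = s) :
    contract σ σ x = s ^ 2 := by
  rw [← h, Real.sq_sqrt (contract_self_nonneg σ x)]

variable [CompactSpace M] [Nonempty M]

/-- The derivative of the constraint map at the critical constant solution. -/
theorem hasFDerivAt_constraintMap (hα : 0 < α) (hα' : α ≤ 1) (hσ : HasCompC 1 σ)
    {R s : ℝ} (hR : 0 < R) (hs : 0 < s) (hscal : ∀ x : M, scalarCurvature (𝓡 3) x = R)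
    (hnorm : ∀ x : M, √(contract σ σ x) = s) (τ : HolderFun 𝒞 1 α)
    {D : DomainSpace 𝒞 α →L[ℝ] TargetSpace 𝒞 α}
    (hD : ∀ (u : HolderFun 𝒞 2 α) (v : HolderField 𝒞 2 α),
      (D (u, v)).1.val = (fun x ↦ -laplacian (𝓡 3) u.val x
        + (-(1 / 4) * phiC R s ^ (-7 : ℤ) * contract σ (conformalKilling v.val) x)) ∧
      (D (u, v)).2.val = vectorLaplacian v.val) :
    HasFDerivAt (fun X : DomainSpace 𝒞 α ↦ constraintMap τ.val σ (rhoC R s) X 0) D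
      (HolderFun.const 𝒞 2 α (phiC R s), 0) := by
  have hc := phiC_pos hR hs
  set c := phiC R s
  obtain ⟨C, hC, hrem⟩ := HolderFun.exists_atlasENorm_le (𝒞 := 𝒞) (α := α)
    (fun x : {x : DomainSpace 𝒞 α // ‖x‖ ≤ c / 2} ↦ mul_self_nonneg ‖x.1‖)
    fun p hp ↦ chartFamily_hamiltonianRemainder hα hα' hp hσ R hc
  have key : ∀ h : DomainSpace 𝒞 α, ‖h‖ ≤ c / 2 →
      constraintMap τ.val σ (rhoC R s) ((HolderFun.const 𝒞 2 α c, 0) + h) 0 -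
        constraintMap τ.val σ (rhoC R s) (HolderFun.const 𝒞 2 α c, 0) 0 - D h =
      (HolderSpace.ofVal (hamiltonianRemainder σ R c h.1.val h.2.val), 0) := by
    rintro ⟨u, w⟩ hh
    have hne : ∀ x, (HolderFun.const 𝒞 2 α c + u).val x ≠ 0 := fun x ↦
      ((half_pos hc).trans_le (half_le_add ((u.abs_le x).trans
        ((norm_fst_le (u, w)).trans hh)))).ne'
    have h1 := HolderSpace.ofVal_val (hamiltonian_mem hα hα' hσ hscal τ (rhoC R s) 0
      (HolderFun.const 𝒞 2 α c + u) (0 + w) hne)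
    have h2 := HolderSpace.ofVal_val (hamiltonian_mem hα hα' hσ hscal τ (rhoC R s) 0
      (HolderFun.const 𝒞 2 α c) (0 : HolderField 𝒞 2 α) fun _ ↦ hc.ne')
    have h3 := HolderSpace.ofVal_val (momentum_mem hα hα' τ 0 (HolderFun.const 𝒞 2 α c + u) (0 + w))
    have h4 := HolderSpace.ofVal_val
      (momentum_mem hα hα' τ 0 (HolderFun.const 𝒞 2 α c) (0 : HolderField 𝒞 2 α))
    refine Prod.ext (HolderSpace.val_injective ?_) (HolderSpace.val_injective ?_)
    · rw [HolderSpace.ofVal_val (hrem ⟨(u, w), hh⟩).1]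
      refine (congrArg₂ (· - ·) (congrArg₂ (· - ·) h1 h2) (hD u w).1).trans ?_
      funext x
      have hlap : laplacian (𝓡 3) (HolderFun.const 𝒞 2 α c + u).val x = laplacian (𝓡 3) u.val x := by
        have h := laplacian_linear 1 (HolderFun.const 𝒞 2 α c).contMDiff u.contMDiff
        rw [one_smul, one_smul, show (HolderFun.const 𝒞 2 α c).val = fun _ ↦ c from rfl,
          laplacian_const, zero_add] at h
        exact congrFun h x
      have hlap0 : laplacian (𝓡 3) (HolderFun.const 𝒞 2 α c).val x = 0 :=
        congrFun (laplacian_const c) x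
      have hw : ((0 : HolderField 𝒞 2 α) + w).val = w.val := congrArg HolderSpace.val (zero_add w)
      have h0 : σ + conformalKilling (0 : HolderField 𝒞 2 α).val = σ := by
        funext x
        refine ContinuousLinearMap.ext fun a ↦ ContinuousLinearMap.ext fun b ↦ ?_
        refine Eq.trans ?_ (add_zero (σ x a b))
        exact congrArg (σ x a b + ·) (conformalKilling_zero_apply x a b)
      have hu : (HolderFun.const 𝒞 2 α c + u).val x = c + u.val x := rfl
      have hcx : (HolderFun.const 𝒞 2 α c).val x = c := rfl
      change hamiltonian τ.val σ (rhoC R s) (HolderFun.const 𝒞 2 α c + u).val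
        ((0 : HolderField 𝒞 2 α) + w).val 0 x - hamiltonian τ.val σ (rhoC R s)
        (HolderFun.const 𝒞 2 α c).val (0 : HolderField 𝒞 2 α).val 0 x -
        (-laplacian (𝓡 3) u.val x + (-(1 / 4) * c ^ (-7 : ℤ) *
          contract σ (conformalKilling w.val) x)) = hamiltonianRemainder σ R c u.val w.val x
      simp only [hamiltonian, hlap, hlap0, hw, h0, hu, hcx, hscal, inv_pow_seven, contract_add_self,
        contract_self_eq (hnorm x), sq_eq_phiC hR hs, two_pi_rhoC hR hs, neg_zero, Real.exp_zero,
        hamiltonianRemainder]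
      change _ - 1 / 8 * (R * c ^ 8 / 3 + _ + _) * _ - R / (12 * c ^ 4) * 1 * _ - _ - _ = _
      ring
    · refine (congrArg₂ (· - ·) (congrArg₂ (· - ·) h3 h4) (hD u w).2).trans ?_
      rw [momentum_zero, momentum_zero, zero_add]
      have : vectorLaplacian (0 : HolderField 𝒞 2 α).val = 0 := vectorLaplacian_zero
      rw [this, sub_zero, sub_self]
      rfl
  rw [hasFDerivAt_iff_isLittleO_nhds_zero]
  refine Asymptotics.IsBigO.trans_isLittleO (Asymptotics.IsBigO.of_bound C ?_)
    (Asymptotics.isLittleO_norm_pow_id one_lt_two)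
  filter_upwards [Metric.closedBall_mem_nhds (0 : DomainSpace 𝒞 α) (half_pos hc)] with h hh
  rw [mem_closedBall_zero_iff] at hh
  rw [key h hh, Prod.norm_def, norm_zero, max_eq_left (norm_nonneg _), norm_pow, norm_norm, sq]
  exact HolderFun.norm_ofVal_le (mul_nonneg hC (mul_self_nonneg _)) (hrem ⟨h, hh⟩)

end derivative

section test_functions

theorem holderENorm_lt_top {F : Type*} [NormedAddCommGroup F] [NormedSpace ℝ F] {k : ℕ} {α : ℝ}
    (hα : α ≤ 1) {K : Set E3} (hK : IsCompact K) (hconv : Convex ℝ K) {f : E3 → F}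
    (hf : ∀ y ∈ K, ContDiffAt ℝ (k + 1 : ℕ) f y) : holderENorm k α K f < ⊤ := by
  refine ENNReal.add_lt_top.2 ⟨ENNReal.sum_lt_top.2 fun j hj ↦ ?_, ?_⟩
  · have hj' : j ≤ k + 1 := (Finset.mem_range.1 hj).le
    have hc : ContinuousOn (iteratedFDeriv ℝ j f) K := fun y hy ↦
      ((hf y hy).iteratedFDeriv_right (m := 0)
        (by rw [zero_add]; exact_mod_cast hj')).continuousAt.continuousWithinAt
    obtain ⟨C, hC⟩ := hK.exists_bound_of_continuousOn hc
    refine lt_of_le_of_lt (iSup₂_le fun y hy ↦ ?_) (ENNReal.ofReal_lt_top (r := C))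
    rw [← ofReal_norm]
    exact ENNReal.ofReal_le_ofReal (hC y hy)
  · have h1 : ∀ y ∈ K, ContDiffAt ℝ 1 (iteratedFDeriv ℝ k f) y := fun y hy ↦
      (hf y hy).iteratedFDeriv_right (by push_cast; rw [add_comm])
    have hc : ContinuousOn (iteratedFDeriv ℝ (k + 1) f) K := fun y hy ↦
      ((hf y hy).iteratedFDeriv_right (m := 0) (by simp)).continuousAt.continuousWithinAt
    obtain ⟨C, hC⟩ := hK.exists_bound_of_continuousOn hc
    refine lt_of_le_of_lt (iSup₂_le fun y hy ↦ iSup₂_le fun z hz ↦ ?_)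
      (ENNReal.ofReal_lt_top (r := C * diam K ^ (1 - α)))
    have hC0 : 0 ≤ C := (norm_nonneg _).trans (hC y hy)
    refine ENNReal.div_le_of_le_mul ?_
    rw [← ENNReal.ofReal_mul (mul_nonneg hC0 (Real.rpow_nonneg diam_nonneg _)), ← ofReal_norm]
    refine ENNReal.ofReal_le_ofReal ?_
    have h2 := hconv.norm_image_sub_le_of_norm_fderiv_le
      (fun z hz ↦ (h1 z hz).differentiableAt (by simp))
      (fun z hz ↦ norm_fderiv_iteratedFDeriv.trans_le (hC z hz)) hz hy
    refine h2.trans ?_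
    rw [mul_assoc, ← dist_eq_norm]
    refine mul_le_mul_of_nonneg_left ?_ hC0
    rcases dist_nonneg.eq_or_lt' (a := dist y z) with h0 | h0
    · rw [h0]
      exact mul_nonneg (Real.rpow_nonneg diam_nonneg _) (Real.rpow_nonneg le_rfl _)
    · calc dist y z = dist y z ^ (1 - α) * dist y z ^ α := by
            rw [← Real.rpow_add h0, sub_add_cancel, Real.rpow_one]
        _ ≤ _ := mul_le_mul_of_nonneg_right (Real.rpow_le_rpow h0.le
            (dist_le_diam_of_mem hK.isBounded hy hz) (by linarith)) (Real.rpow_nonneg h0.le _)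

theorem mem_holderSubmodule_of_contDiffAt {M : Type*} [TopologicalSpace M] [ChartedSpace E3 M]
    {F V : Type*} [NormedAddCommGroup F] [NormedSpace ℝ F] [AddCommGroup V] [Module ℝ V]
    {𝒞 : HolderCover M} {T : M → V →ₗ[ℝ] (E3 → F)} {k : ℕ} {α : ℝ} (hα : α ≤ 1) {v : V}
    (hv : ∀ p, ∀ y ∈ (extChartAt (𝓡 3) p).target, ContDiffAt ℝ (k + 1 : ℕ) (T p v) y) :
    v ∈ holderSubmodule 𝒞 T k α :=
  ⟨fun p _ y hy ↦ ((hv p y hy).of_le (by exact_mod_cast k.le_succ)).contDiffWithinAt,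
    ENNReal.sum_lt_top.2 fun p hp ↦ holderENorm_lt_top hα (HolderSpace.isCompact_ball 𝒞 p)
      (HolderSpace.convex_ball 𝒞 p) fun y hy ↦ hv p y (𝒞.closedBall_subset p hp hy)⟩

variable {M : Type*} [TopologicalSpace M] [ChartedSpace E3 M] [IsManifold (𝓡 3) ∞ M]
  [RiemannianBundle (fun x : M ↦ TangentSpace (𝓡 3) x)]
  [IsContMDiffRiemannianBundle (𝓡 3) ∞ E3 (fun x : M ↦ TangentSpace (𝓡 3) x)]

variable {p x : M} {w : Π q : M, TangentSpace (𝓡 3) q} {u : M → ℝ} {U : Set M}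

theorem fieldCAt_smul_of_tsupport {n : ℕ∞} (hu : ContMDiff (𝓡 3) 𝓘(ℝ) n u)
    (hw : ∀ q ∈ tsupport u, FieldCAt n w q) (x : M) : FieldCAt n (fun q ↦ u q • w q) x := by
  by_cases hx : x ∈ tsupport u
  · exact FieldCAt.smul' (hu x) (hw x hx)
  · refine (fieldCAt_zero n x).congr_of_eventuallyEq ?_
    filter_upwards [(isClosed_tsupport u).isOpen_compl.mem_nhds hx] with q hq
    have h : u q • w q = 0 := by rw [image_eq_zero_of_notMem_tsupport hq, zero_smul]
    exact congrArg (TotalSpace.mk' E3 q) h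

theorem continuous_mul_of_tsupport {h : M → ℝ} (hu : Continuous u)
    (hh : ∀ q ∈ tsupport u, ContinuousAt h q) : Continuous fun q ↦ u q * h q := by
  refine continuous_iff_continuousAt.2 fun x ↦ ?_
  by_cases hx : x ∈ tsupport u
  · exact hu.continuousAt.mul (hh x hx)
  · refine (continuousAt_const (y := (0 : ℝ))).congr ?_
    filter_upwards [(isClosed_tsupport u).isOpen_compl.mem_nhds hx] with q hq
    rw [image_eq_zero_of_notMem_tsupport hq, zero_mul]

variable [MeasurableSpace M] [BorelSpace M] [CompactSpace M] [T2Space M]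

theorem eq_zero_of_integral_bump_mul {h : M → ℝ} (hU : IsOpen U) (hx : x ∈ U)
    (hc : ∀ q ∈ U, ContinuousAt h q)
    (hint : ∀ f : SmoothBumpFunction (𝓡 3) x, tsupport f ⊆ U →
      ∫ q, f q * h q ∂riemannianVolume M = 0) : h x = 0 := by
  by_contra hne
  have hV : U ∩ {q | 0 < h x * h q} ∈ 𝓝 x :=
    inter_mem (hU.mem_nhds hx) (((hc x hx).const_mul (h x)).eventually_const_lt (mul_self_pos.2 hne))
  obtain ⟨f, -, hf⟩ := (SmoothBumpFunction.nhds_basis_tsupport (I := 𝓡 3) x).mem_iff.1 hV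
  have h1 : Continuous fun q ↦ h x * (f q * h q) :=
    (continuous_mul_of_tsupport f.continuous fun q hq ↦ hc q (hf hq).1).const_mul _
  have h2 : ∀ q, 0 ≤ h x * (f q * h q) := fun q ↦ by
    by_cases hq : q ∈ tsupport f
    · rw [mul_left_comm]
      exact mul_nonneg f.nonneg (hf hq).2.le
    · rw [image_eq_zero_of_notMem_tsupport hq, zero_mul, mul_zero]
  have h3 := congrFun (eq_zero_of_integral_eq_zero h1 h2
    (by rw [integral_const_mul, hint f fun q hq ↦ (hf hq).1, mul_zero])) x
  rw [f.eq_one, one_mul] at h3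
  exact hne (mul_self_eq_zero.1 h3)

variable {𝒞 : HolderCover M} {α : ℝ}

/-- The pairs of class `C^{2,α}` separate those of class `C^{0,α}` in the `L²` inner product. -/
theorem eq_zero_of_l2Inner_eq_zero (hα : α ≤ 1) (g : TargetSpace 𝒞 α)
    (hg : ∀ y : DomainSpace 𝒞 α, l2Inner (y.1.val, y.2.val) (g.1.val, g.2.val) = 0) : g = 0 := by
  have hg1 : Continuous g.1.val := g.1.contMDiff.continuous
  have hg2 : ∀ x, FieldCAt 0 g.2.val x := g.2.fieldCAt
  refine Prod.ext (HolderSpace.val_injective ?_) (HolderSpace.val_injective ?_)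
  · funext x
    refine eq_zero_of_integral_bump_mul isOpen_univ (mem_univ x)
      (fun q _ ↦ hg1.continuousAt) fun f _ ↦ ?_
    have hf : (f : M → ℝ) ∈ holderSubmodule 𝒞 (funRep (M := M)) 2 α :=
      mem_holderSubmodule_of_contDiffAt hα fun p y hy ↦
        (contMDiffAt_funRep_iff hy).1 ((f.contMDiff _).of_le ENat.LEInfty.out)
    have h := hg (HolderSpace.ofVal f, 0)
    rw [HolderSpace.ofVal_val hf] at h
    refine Eq.trans (integral_congr_ae (ae_of_all _ fun q ↦ ?_)) h
    have h0 : (inner ℝ ((0 : HolderField 𝒞 2 α).val q) (g.2.val q) : ℝ) = 0 := inner_zero_left _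
    exact (add_zero _).symm.trans (congrArg _ h0.symm)
  · funext x
    have hx := mem_extChartAt_source (I := 𝓡 3) x
    have key : ∀ i, (inner ℝ (coordField x i x) (g.2.val x) : ℝ) = 0 := fun i ↦ by
      refine eq_zero_of_integral_bump_mul (h := fun q ↦ inner ℝ (coordField x i q) (g.2.val q))
        (isOpen_extChartAt_source (I := 𝓡 3) x) hx (fun q hq ↦ (contMDiffAt_inner (n := 0)
          ((contMDiffAt_coordField hq).of_le zero_le) (hg2 q)).continuousAt) fun f hfx ↦ ?_
      have hf : (fun q ↦ f q • coordField x i q) ∈ holderSubmodule 𝒞 (fieldRep (M := M)) 2 α :=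
        mem_holderSubmodule_of_contDiffAt hα fun p y hy ↦ by
          refine (contMDiffAt_fieldRep_iff (n := 3) hy).1 (fieldCAt_smul_of_tsupport (n := 3)
            (f.contMDiff.of_le ENat.LEInfty.out) (fun q hq ↦
              (contMDiffAt_coordField (hfx hq)).of_le ENat.LEInfty.out) _)
      have h := hg (0, HolderSpace.ofVal fun q ↦ f q • coordField x i q)
      rw [HolderSpace.ofVal_val hf] at h
      refine Eq.trans (integral_congr_ae (ae_of_all _ fun q ↦ ?_)) h
      have h0 : (0 : HolderFun 𝒞 2 α).val q * g.1.val q = 0 := zero_mul _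
      have h1 : (inner ℝ (f q • coordField x i q) (g.2.val q) : ℝ) =
        f q * inner ℝ (coordField x i q) (g.2.val q) := real_inner_smul_left _ _ _
      exact ((congrArg₂ (· + ·) h0 h1).trans (zero_add _)).symm
    have hs : g.2.val x = ∑ i, fieldRep x g.2.val (extChartAt (𝓡 3) x x) i • coordField x i x := by
      have := field_eq_sum (w := g.2.val) (mem_extChartAt_target (I := 𝓡 3) x)
      rwa [extChartAt_to_inv] at this
    have h2 : (inner ℝ (g.2.val x) (g.2.val x) : ℝ) = 0 := by
      conv_lhs => arg 2; rw [hs]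
      rw [sum_inner]
      exact Finset.sum_eq_zero fun i _ ↦ by rw [real_inner_smul_left, key i, mul_zero]
    exact inner_self_eq_zero.1 h2

end test_functions

section adjoint
variable {M : Type*} [TopologicalSpace M] [ChartedSpace E3 M] [IsManifold (𝓡 3) ∞ M]
  [RiemannianBundle (fun x : M ↦ TangentSpace (𝓡 3) x)]
  [IsContMDiffRiemannianBundle (𝓡 3) ∞ E3 (fun x : M ↦ TangentSpace (𝓡 3) x)]

variable {𝒞 : HolderCover M} {α : ℝ} {σ : Tensor2 (𝓡 3) M}

theorem contract_smul_left (u : M → ℝ) (S T : Tensor2 (𝓡 3) M) (x : M) :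
    contract (fun q ↦ u q • S q) T x = u x * contract S T x := by
  simp only [contract, Finset.mul_sum]
  exact Finset.sum_congr rfl fun i _ ↦ Finset.sum_congr rfl fun j _ ↦ mul_assoc _ _ _

theorem tensorDivergence_const_smul (hσ : HasCompC 1 σ)
    (hdiv : ∀ x, tensorDivergence σ x = 0) (d : ℝ) :
    tensorDivergence (fun q ↦ d • σ q) = 0 := by
  refine field_ext_comp fun p y hy k ↦ ?_
  have h := fieldRep_tensorDivergence_smul (k := k) (u := fun _ ↦ d) hy contMDiff_const hσ hdiv
  have h0 : ∀ c, pd c (funRep p fun _ : M ↦ d) y = 0 := fun c ↦ by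
    have : funRep p (fun _ : M ↦ d) = fun _ ↦ d := rfl
    simp [pd, this]
  refine h.trans ?_
  simp only [h0, zero_mul, mul_zero, Finset.sum_const_zero, map_zero]
  rfl

variable [MeasurableSpace M] [BorelSpace M] [CompactSpace M] [T2Space M]

theorem integral_laplacian_mul_comm {u u' : M → ℝ} (hu : ContMDiff (𝓡 3) 𝓘(ℝ) 2 u)
    (hu' : ContMDiff (𝓡 3) 𝓘(ℝ) 2 u') :
    ∫ x, laplacian (𝓡 3) u x * u' x ∂riemannianVolume M =
      ∫ x, u x * laplacian (𝓡 3) u' x ∂riemannianVolume M := by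
  have h1 := (integral_laplacian_mul hu (hu'.of_le (by norm_num))).2
  have h2 := (integral_laplacian_mul hu' (hu.of_le (by norm_num))).2
  simp only [real_inner_comm, mul_comm] at h1 h2 ⊢
  exact h1.trans h2.symm

theorem integral_inner_vectorLaplacian_comm {v w : Π q : M, TangentSpace (𝓡 3) q}
    (hv : ∀ x, FieldCAt 2 v x) (hw : ∀ x, FieldCAt 2 w x) :
    ∫ x, inner ℝ (vectorLaplacian v x) (w x) ∂riemannianVolume M =
      ∫ x, inner ℝ (v x) (vectorLaplacian w x) ∂riemannianVolume M := by
  have h1 := (integral_inner_vectorLaplacian hv fun x ↦ (hw x).of_le (by norm_num)).2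
  have h2 := (integral_inner_vectorLaplacian hw fun x ↦ (hv x).of_le (by norm_num)).2
  simp only [contract_comm (conformalKilling w)] at h2
  refine h1.trans (h2.symm.trans ?_)
  exact integral_congr_ae (ae_of_all _ fun x ↦ real_inner_comm _ _)

/-- The formal adjoint of `v ↦ -c σ_ab (𝓛v)^ab / 2` is `u ↦ D_b (c u σ^ab)`. -/
theorem integral_mul_contract_conformalKilling (hσ : HasCompC 1 σ)
    (hsymm : ∀ x a b, σ x a b = σ x b a)
    (htr : ∀ x, ∑ i, σ x (frame (𝓡 3) x i) (frame (𝓡 3) x i) = 0) {u : M → ℝ}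
    (hu : ContMDiff (𝓡 3) 𝓘(ℝ) 1 u) {v : Π q : M, TangentSpace (𝓡 3) q}
    (hv : ∀ x, FieldCAt 1 v x) (c : ℝ) :
    Continuous (fun x ↦ (inner ℝ (v x) (tensorDivergence (fun q ↦ (c * u q) • σ q) x) : ℝ)) ∧
      ∫ x, -(1 / 2) * c * contract σ (conformalKilling v) x * u x ∂riemannianVolume M =
        ∫ x, inner ℝ (v x) (tensorDivergence (fun q ↦ (c * u q) • σ q) x) ∂riemannianVolume M := by
  have h := integral_inner_tensorDivergence (S := fun q ↦ (c * u q) • σ q)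
    (hasCompC_smul (n := 1) (contMDiff_const.mul hu) hσ)
    (fun x a b ↦ congrArg (c * u x * ·) (hsymm x a b))
    (fun x ↦ (Finset.mul_sum _ _ _).symm.trans ((congrArg (c * u x * ·) (htr x)).trans
      (mul_zero _))) hv
  simp only [contract_smul_left, real_inner_comm] at h
  refine ⟨h.1, ?_⟩
  rw [h.2, ← integral_const_mul]
  exact integral_congr_ae (ae_of_all _ fun x ↦ by ring)

theorem integral_neg_add_add {f g h : M → ℝ} (hf : Continuous f) (hg : Continuous g)
    (hh : Continuous h) : ∫ x, (-f x + (g x + h x)) ∂riemannianVolume M =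
      -∫ x, f x ∂riemannianVolume M +
        (∫ x, g x ∂riemannianVolume M + ∫ x, h x ∂riemannianVolume M) := by
  rw [integral_add (f := fun x ↦ -f x) (g := fun x ↦ g x + h x)
    (integrable_of_continuous hf.neg) (integrable_of_continuous (hg.add hh)), integral_neg,
    integral_add (integrable_of_continuous hg) (integrable_of_continuous hh)]

theorem isL2Adjoint_of_blocks (hσ : IsTT σ) (c : ℝ) {D B : DomainSpace 𝒞 α →L[ℝ] TargetSpace 𝒞 α}
    (hD : ∀ (u : HolderFun 𝒞 2 α) (v : HolderField 𝒞 2 α),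
      (D (u, v)).1.val = (fun x ↦ -laplacian (𝓡 3) u.val x
        + (-(1 / 4) * c * contract σ (conformalKilling v.val) x)) ∧
      (D (u, v)).2.val = vectorLaplacian v.val)
    (hB : ∀ (u : HolderFun 𝒞 2 α) (v : HolderField 𝒞 2 α),
      (B (u, v)).1.val = (fun x ↦ -laplacian (𝓡 3) u.val x) ∧
      (B (u, v)).2.val = fun x ↦ tensorDivergence (fun q ↦ (1 / 2 * c * u.val q) • σ q) x
        + vectorLaplacian v.val x) : IsL2Adjoint D B := by
  rintro ⟨u, v⟩ ⟨u', v'⟩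
  have hs := hσ.contMDiff.hasCompC
  have hu := u.contMDiff
  have hu' := u'.contMDiff
  have hv := v.fieldCAt
  have hv' := v'.fieldCAt
  have hmix := integral_mul_contract_conformalKilling hs hσ.symm hσ.trace_eq_zero
    u'.contMDiff_one v.fieldCAt_one (1 / 2 * c)
  have hc1 : Continuous fun x ↦ laplacian (𝓡 3) u.val x * u'.val x :=
    (integral_laplacian_mul hu u'.contMDiff_one).1.mul hu'.continuous
  have hc2 : Continuous fun x ↦ u.val x * laplacian (𝓡 3) u'.val x :=
    hu.continuous.mul (integral_laplacian_mul hu' u.contMDiff_one).1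
  have hc3 : Continuous fun x ↦ (inner ℝ (vectorLaplacian v.val x) (v'.val x) : ℝ) :=
    (integral_inner_vectorLaplacian hv v'.fieldCAt_one).1
  have hc4 : Continuous fun x ↦ (inner ℝ (v.val x) (vectorLaplacian v'.val x) : ℝ) :=
    (integral_inner_vectorLaplacian hv' v.fieldCAt_one).1.congr fun x ↦ real_inner_comm _ _
  have hc5 : Continuous fun x ↦ -(1 / 2) * (1 / 2 * c) *
      contract σ (conformalKilling v.val) x * u'.val x :=
    ((continuous_contract (hs.of_le (by simp)) (hasCompC_conformalKilling (n := 0)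
      (by simpa using v.fieldCAt_one))).const_mul _).mul hu'.continuous
  have e1 : l2Inner ((D (u, v)).1.val, (D (u, v)).2.val) (u'.val, v'.val) =
      ∫ x, (-(laplacian (𝓡 3) u.val x * u'.val x) + (-(1 / 2) * (1 / 2 * c) *
        contract σ (conformalKilling v.val) x * u'.val x
        + inner ℝ (vectorLaplacian v.val x) (v'.val x))) ∂riemannianVolume M := by
    rw [(hD u v).1, (hD u v).2]
    refine integral_congr_ae (ae_of_all _ fun x ↦ ?_)
    change (-laplacian (𝓡 3) u.val x + -(1 / 4) * c * contract σ (conformalKilling v.val) x) *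
      u'.val x + inner ℝ (vectorLaplacian v.val x) (v'.val x) = _
    ring
  have e2 : l2Inner (u.val, v.val) ((B (u', v')).1.val, (B (u', v')).2.val) =
      ∫ x, (-(u.val x * laplacian (𝓡 3) u'.val x) + (inner ℝ (v.val x)
        (tensorDivergence (fun q ↦ (1 / 2 * c * u'.val q) • σ q) x)
        + inner ℝ (v.val x) (vectorLaplacian v'.val x))) ∂riemannianVolume M := by
    rw [(hB u' v').1, (hB u' v').2]
    refine integral_congr_ae (ae_of_all _ fun x ↦ ?_)
    change u.val x * -laplacian (𝓡 3) u'.val x + inner ℝ (v.val x) (_ + _) = _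
    rw [inner_add_right]
    ring
  refine e1.trans (Eq.trans ?_ e2.symm)
  rw [integral_neg_add_add hc1 hc5 hc3, integral_neg_add_add hc2 hmix.1 hc4,
    integral_laplacian_mul_comm hu hu', hmix.2,
    integral_inner_vectorLaplacian_comm hv hv']

theorem IsL2Adjoint.unique (hα : α ≤ 1) {A B B' : DomainSpace 𝒞 α →L[ℝ] TargetSpace 𝒞 α}
    (hB : IsL2Adjoint A B) (hB' : IsL2Adjoint A B') : B = B' := by
  refine ContinuousLinearMap.ext fun z ↦ sub_eq_zero.1 (eq_zero_of_l2Inner_eq_zero hα _ fun y ↦ ?_)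
  have h := (hB y z).symm.trans (hB' y z)
  have hc : ∀ g : TargetSpace 𝒞 α, Integrable
      (fun q ↦ y.1.val q * g.1.val q + inner ℝ (y.2.val q) (g.2.val q)) (riemannianVolume M) :=
    fun g ↦ integrable_of_continuous ((y.1.contMDiff.continuous.mul g.1.contMDiff.continuous).add
      (continuous_inner (fun x ↦ (y.2.fieldCAt x).of_le (by norm_num)) g.2.fieldCAt))
  refine Eq.trans ?_ (sub_eq_zero.2 h)
  refine Eq.trans (integral_congr_ae (ae_of_all _ fun q ↦ ?_)) (integral_sub (hc (B z)) (hc (B' z)))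
  change y.1.val q * ((B z).1.val q - (B' z).1.val q) +
    inner ℝ (y.2.val q) ((B z).2.val q - (B' z).2.val q) = _
  rw [inner_sub_right]
  ring

theorem ker_eq_span_const [Nonempty M] {A : DomainSpace 𝒞 α →L[ℝ] TargetSpace 𝒞 α}
    (hA : ∀ u v, A (u, v) = 0 ↔ v = 0 ∧ ∃ d : ℝ, u.val = fun _ ↦ d) :
    LinearMap.ker A.toLinearMap = Submodule.span ℝ {(HolderFun.const 𝒞 2 α 1, 0)} ∧
      Module.finrank ℝ (LinearMap.ker A.toLinearMap) = 1 := by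
  have h1 : LinearMap.ker A.toLinearMap = Submodule.span ℝ {(HolderFun.const 𝒞 2 α 1, 0)} := by
    ext ⟨u, v⟩
    rw [Submodule.mem_span_singleton]
    refine (hA u v).trans ⟨?_, ?_⟩
    · rintro ⟨rfl, d, hd⟩
      refine ⟨d, Prod.ext (HolderSpace.val_injective ?_) (smul_zero d)⟩
      rw [hd]
      funext x
      exact mul_one d
    · rintro ⟨d, hd⟩
      obtain ⟨h1, h2⟩ := Prod.ext_iff.1 hd
      refine ⟨h2.symm.trans (smul_zero d), d, ?_⟩
      refine (congrArg HolderSpace.val h1).symm.trans ?_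
      funext x
      exact mul_one d
  refine ⟨h1, ?_⟩
  rw [h1]
  refine finrank_span_singleton fun h ↦ ?_
  obtain ⟨x⟩ := (inferInstance : Nonempty M)
  have h2 : (1 : ℝ) = 0 := congrFun (congrArg HolderSpace.val (Prod.ext_iff.1 h).1) x
  exact one_ne_zero h2

end adjoint

end CTT

end

theorem theorem3p2 {M : Type*} [TopologicalSpace M] [T2Space M] [CompactSpace M] [ConnectedSpace M]
    [MeasurableSpace M] [BorelSpace M]
    [ChartedSpace (EuclideanSpace ℝ (Fin 3)) M] [IsManifold (𝓡 3) ∞ M]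
    [RiemannianBundle (fun x : M ↦ TangentSpace (𝓡 3) x)]
    [IsContMDiffRiemannianBundle (𝓡 3) ∞ (EuclideanSpace ℝ (Fin 3))
      (fun x : M ↦ TangentSpace (𝓡 3) x)]
    (hCK : NoConformalKilling (𝓡 3) M)
    (R : ℝ) (hR : 0 < R) (hscal : ∀ x : M, scalarCurvature (𝓡 3) x = R)
    (σ : Tensor2 (𝓡 3) M) (hσ : IsTT σ)
    (s : ℝ) (hs : 0 < s) (hnorm : ∀ x : M, √(contract σ σ x) = s)
    (𝒞 : HolderCover M) (α : ℝ) (hα₀ : 0 < α) (hα₁ : α < 1) (τ : HolderFun 𝒞 1 α) :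
    -- `F` maps `C^{2,α} ⊕ C^{2,α}` into `C^{0,α} ⊕ C^{0,α}`, for `φ` without zeros
    (∀ (X : DomainSpace 𝒞 α) (lam : ℝ), (∀ x, X.1.val x ≠ 0) →
      (constraintMap τ.val σ (rhoC R s) X lam).1.val =
          hamiltonian τ.val σ (rhoC R s) X.1.val X.2.val lam ∧
        (constraintMap τ.val σ (rhoC R s) X lam).2.val =
          momentum τ.val X.1.val X.2.val lam) ∧
    ∃ D : DomainSpace 𝒞 α →L[ℝ] TargetSpace 𝒞 α,
      HasFDerivAt (fun X : DomainSpace 𝒞 α ↦ constraintMap τ.val σ (rhoC R s) X 0) D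
        (HolderFun.const 𝒞 2 α (phiC R s), 0) ∧
      -- block form of the derivative
      (∀ (u : HolderFun 𝒞 2 α) (v : HolderField 𝒞 2 α),
        (D (u, v)).1.val = (fun x ↦ -laplacian (𝓡 3) u.val x
          + (-(1 / 4) * phiC R s ^ (-7 : ℤ) * contract σ (conformalKilling v.val) x)) ∧
        (D (u, v)).2.val = vectorLaplacian v.val) ∧
      -- its kernel
      LinearMap.ker D.toLinearMap = Submodule.span ℝ {(HolderFun.const 𝒞 2 α 1, 0)} ∧
      Module.finrank ℝ (LinearMap.ker D.toLinearMap) = 1 ∧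
      -- the adjoint and its kernel
      (∃! B : DomainSpace 𝒞 α →L[ℝ] TargetSpace 𝒞 α, IsL2Adjoint D B) ∧
      ∀ B : DomainSpace 𝒞 α →L[ℝ] TargetSpace 𝒞 α, IsL2Adjoint D B →
        (∀ (u : HolderFun 𝒞 2 α) (v : HolderField 𝒞 2 α),
          (B (u, v)).1.val = (fun x ↦ -laplacian (𝓡 3) u.val x) ∧
          (B (u, v)).2.val = fun x ↦
            tensorDivergence (fun q ↦ (1 / 2 * phiC R s ^ (-7 : ℤ) * u.val q) • σ q) x
              + vectorLaplacian v.val x) ∧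
        LinearMap.ker B.toLinearMap = Submodule.span ℝ {(HolderFun.const 𝒞 2 α 1, 0)} ∧
        Module.finrank ℝ (LinearMap.ker B.toLinearMap) = 1 := by
  have hα : α ≤ 1 := hα₁.le
  have : Nonempty M := inferInstance
  have hs' : HasCompC 1 σ := hσ.contMDiff.hasCompC
  set c := phiC R s ^ (-7 : ℤ)
  obtain ⟨L, hL⟩ := exists_laplacian_clm (𝒞 := 𝒞) hα₀ hα
  obtain ⟨V, hV⟩ := exists_vectorLaplacian_clm (𝒞 := 𝒞) hα₀ hα
  obtain ⟨C, hC⟩ := exists_contract_clm (𝒞 := 𝒞) hα₀ hα hs'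
  obtain ⟨T, hT⟩ := exists_tensorDivergence_clm (𝒞 := 𝒞) hα₀ hα hs' hσ.divergence_eq_zero
    (1 / 2 * c)
  let f := ContinuousLinearMap.fst ℝ (HolderFun 𝒞 2 α) (HolderField 𝒞 2 α)
  let g := ContinuousLinearMap.snd ℝ (HolderFun 𝒞 2 α) (HolderField 𝒞 2 α)
  let D : DomainSpace 𝒞 α →L[ℝ] TargetSpace 𝒞 α :=
    (-(L.comp f) + (-(1 / 4) * c) • C.comp g).prod (V.comp g)
  let B : DomainSpace 𝒞 α →L[ℝ] TargetSpace 𝒞 α := (-(L.comp f)).prod (T.comp f + V.comp g)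
  have hD : ∀ (u : HolderFun 𝒞 2 α) (v : HolderField 𝒞 2 α),
      (D (u, v)).1.val = (fun x ↦ -laplacian (𝓡 3) u.val x
        + (-(1 / 4) * c * contract σ (conformalKilling v.val) x)) ∧
      (D (u, v)).2.val = vectorLaplacian v.val := fun u v ↦ by
    refine ⟨?_, hV v⟩
    rw [← hL, ← hC]
    rfl
  have hB : ∀ (u : HolderFun 𝒞 2 α) (v : HolderField 𝒞 2 α),
      (B (u, v)).1.val = (fun x ↦ -laplacian (𝓡 3) u.val x) ∧
      (B (u, v)).2.val = fun x ↦ tensorDivergence (fun q ↦ (1 / 2 * c * u.val q) • σ q) x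
        + vectorLaplacian v.val x := fun u v ↦ by
    rw [← hL, ← hV, ← hT]
    exact ⟨rfl, rfl⟩
  have hadj : IsL2Adjoint D B := isL2Adjoint_of_blocks hσ c hD hB
  have hkerD : ∀ u v, D (u, v) = 0 ↔ v = 0 ∧ ∃ d : ℝ, u.val = fun _ ↦ d := fun u v ↦ by
    constructor
    · intro h
      have h1 := (hD u v).1.symm.trans (congrArg (fun z : TargetSpace 𝒞 α ↦ z.1.val) h)
      have h2 := (hD u v).2.symm.trans (congrArg (fun z : TargetSpace 𝒞 α ↦ z.2.val) h)
      obtain rfl : v = 0 := HolderSpace.val_injective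
        (eq_zero_of_vectorLaplacian_eq_zero hCK v.fieldCAt h2)
      refine ⟨rfl, exists_eq_const_of_laplacian_eq_zero u.contMDiff fun x ↦ ?_⟩
      have h3 : -laplacian (𝓡 3) u.val x + -(1 / 4) * c *
        contract σ (conformalKilling (0 : Π q : M, TangentSpace (𝓡 3) q)) x = 0 := congrFun h1 x
      rwa [contract_conformalKilling_zero, mul_zero, add_zero, neg_eq_zero] at h3
    · rintro ⟨rfl, d, hd⟩
      refine Prod.ext (HolderSpace.val_injective ((hD u 0).1.trans ?_))
        (HolderSpace.val_injective ((hD u 0).2.trans vectorLaplacian_zero))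
      funext x
      rw [hd, laplacian_const]
      change -(0 : ℝ) + -(1 / 4) * c * contract σ (conformalKilling 0) x = 0
      rw [contract_conformalKilling_zero, mul_zero, add_zero, neg_zero]
  have hdivc : ∀ d : ℝ, (fun x ↦ tensorDivergence (fun q ↦ (1 / 2 * c * d) • σ q) x) = 0 :=
    fun d ↦ tensorDivergence_const_smul hs' hσ.divergence_eq_zero _
  have hkerB : ∀ u v, B (u, v) = 0 ↔ v = 0 ∧ ∃ d : ℝ, u.val = fun _ ↦ d := fun u v ↦ by
    constructor
    · intro h
      have h1 := (hB u v).1.symm.trans (congrArg (fun z : TargetSpace 𝒞 α ↦ z.1.val) h)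
      have h2 := (hB u v).2.symm.trans (congrArg (fun z : TargetSpace 𝒞 α ↦ z.2.val) h)
      obtain ⟨d, hd⟩ := exists_eq_const_of_laplacian_eq_zero u.contMDiff fun x ↦
        neg_eq_zero.1 (congrFun h1 x)
      refine ⟨HolderSpace.val_injective (eq_zero_of_vectorLaplacian_eq_zero hCK v.fieldCAt ?_),
        d, hd⟩
      rw [hd] at h2
      funext x
      have h3 := congrFun h2 x
      have h4 := congrFun (hdivc d) x
      exact (zero_add _).symm.trans ((congrArg (· + vectorLaplacian v.val x) h4.symm).trans h3)
    · rintro ⟨rfl, d, hd⟩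
      refine Prod.ext (HolderSpace.val_injective ((hB u 0).1.trans ?_))
        (HolderSpace.val_injective ((hB u 0).2.trans ?_))
      · rw [hd, laplacian_const]
        funext x
        exact neg_zero
      · rw [hd]
        funext x
        exact (congrArg₂ (· + ·) (congrFun (hdivc d) x)
          (congrFun vectorLaplacian_zero x)).trans (zero_add _)
  refine ⟨fun X lam hX ↦ ⟨HolderSpace.ofVal_val (hamiltonian_mem hα₀ hα hs' hscal τ _ lam _ _ hX),
    HolderSpace.ofVal_val (momentum_mem hα₀ hα τ lam _ _)⟩, D,
    hasFDerivAt_constraintMap hα₀ hα hs' hR hs hscal hnorm τ hD, hD,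
    (ker_eq_span_const hkerD).1, (ker_eq_span_const hkerD).2,
    ⟨B, hadj, fun B' hB' ↦ hB'.unique hα hadj⟩, fun B' hB' ↦ ?_⟩
  obtain rfl := hB'.unique hα hadj
  exact ⟨hB, ker_eq_span_const hkerB⟩
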